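/- An instance of the minimum-power channel allocation problem (MPCA) consists of integers $1\le M\le N$ (numbers of users and of channels), gains $g_{mn}>0$ and rate targets $R_m>0$ ($m=1,\dots,M$, $n=1,\dots,N$). A feasible solution consists of pairwise disjoint channel sets $\mathcal N_1,\dots,\mathcal N_M\subseteq\{1,\dots,N\}$ and powers $P_{mn}\ge 0$ ($n\in\mathcal N_m$) such that $\sum_{n\in\mathcal N_m}\log_2(1+g_{mn}P_{mn})\ge R_m$ for every user $m$; the aim is to minimize the total power $\sum_{m}\sum_{n\in\mathcal N_m}P_{mn}$. Time is measured by the number of elementary operations on a real random-access machine: natural numbers (with addition and truncated subtraction) and exact real numbers (with the four arithmetic operations, $\exp$, $\log$, and the embedding of the natural numbers) are stored in variables and arrays, and array access, arithmetic operations, comparisons, assignments, branchings and procedure calls have unit cost. **Theorem.** Suppose that $M$ divides $N$ and that each user must be allocated exactly $N/M$ channels, which must be consecutive in $1,\dots,N$. Then this restriction of MPCA can be solved to global optimality in time $O(\max\{M^3,MN\})$: there are a single program and a constant $C$ such that for all $M,N$ with $1\le M\le N$ and $M\mid N$, and for all gains $g_{mn}>0$ and targets $R_m>0$, the program, given $M$,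 $N$, $(g_{mn})$ and $(R_m)$, halts after at most $C\max\{M^3,MN\}$ steps and outputs sets $\mathcal N_1,\dots,\mathcal N_M$ and powers $P_{mn}$ ($n\in\mathcal N_m$) that form a feasible solution of minimum total power among all feasible solutions in which every $\mathcal N_m$ consists of exactly $N/M$ consecutive channels. -/

import Mathlib

/-! # The minimum-power channel allocation problem -/

/-- An instance of the minimum-power channel allocation problem (MPCA) with `M` users and
`N` channels: positive channel gains and positive rate targets. -/
structure MPCA (M N : ℕ) where
  /-- `gain m n` is the gain of channel `n` for user `m`. -/
  gain : Fin M → Fin N → ℝ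
  gain_pos : ∀ m n, 0 < gain m n
  /-- `target m` is the rate that user `m` has to be given. -/
  target : Fin M → ℝ
  target_pos : ∀ m, 0 < target m

namespace MPCA

/-- A candidate solution: a set of channels for every user, and powers. The entry
`power m n` is meaningful only if `n ∈ channels m`. -/
structure Solution (M N : ℕ) where
  channels : Fin M → Finset (Fin N)
  power : Fin M → Fin N → ℝ

variable {M N : ℕ}

/-- The total transmit power. -/
noncomputable def Solution.totalPower (S : Solution M N) : ℝ :=
  ∑ m, ∑ n ∈ S.channels m, S.power m n

/-- Feasibility for MPCA: no channel is shared, powers are non-negative, and every user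
reaches its rate target under the rate function `P ↦ log₂ (1 + g P)`. -/
structure Feasible (I : MPCA M N) (S : Solution M N) : Prop where
  disjoint : ∀ m₁ m₂, m₁ ≠ m₂ → Disjoint (S.channels m₁) (S.channels m₂)
  power_nonneg : ∀ m, ∀ n ∈ S.channels m, 0 ≤ S.power m n
  rate_ge : ∀ m, I.target m ≤ ∑ n ∈ S.channels m, Real.logb 2 (1 + S.power m n * I.gain m n)

/-- Feasibility under the additional restriction that every user is given exactly `N / M`
channels, and that these are consecutive. -/
structure UniformBlockFeasible (I : MPCA M N) (S : Solution M N) : Prop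
    extends I.Feasible S where
  card_eq : ∀ m, (S.channels m).card = N / M
  consecutive : ∀ m, (S.channels m : Set (Fin N)).OrdConnected

/-- `S` is a global optimum of the restricted problem. -/
def UniformBlockOptimal (I : MPCA M N) (S : Solution M N) : Prop :=
  I.UniformBlockFeasible S ∧
    ∀ S' : Solution M N, I.UniformBlockFeasible S' → S.totalPower ≤ S'.totalPower

end MPCA

/-! # A real random-access machine

Programs handle natural numbers (used for counting and addressing) and exact real numbers.
The store has scalar variables and arrays of both sorts. Every elementary operation has unit
cost. There is neither a rounding operation from real to natural numbers, nor any constants in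
programs other than natural numbers, nor multiplication or division of natural numbers. -/

namespace RealRAM

/-- The store. The first argument of an array is its name, the second one the index. -/
structure Store where
  natVar : ℕ → ℕ
  realVar : ℕ → ℝ
  natArr : ℕ → ℕ → ℕ
  realArr : ℕ → ℕ → ℝ

/-- Expressions for natural numbers. -/
inductive NExp where
  | lit (k : ℕ)
  | var (x : ℕ)
  | get (a : ℕ) (i : NExp)
  | add (e f : NExp)
  | sub (e f : NExp)

/-- Expressions for real numbers. -/
inductive RExp where
  | ofNat (e : NExp)
  | var (x : ℕ)
  | get (a : ℕ) (i : NExp)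
  | add (e f : RExp)
  | sub (e f : RExp)
  | mul (e f : RExp)
  | div (e f : RExp)
  | exp (e : RExp)
  | log (e : RExp)

/-- Tests. -/
inductive BExp where
  | natLt (e f : NExp)
  | realLt (e f : RExp)
  | not (b : BExp)
  | and (b c : BExp)

/-- The value of an expression; subtraction of natural numbers is truncated at zero. -/
def NExp.eval (s : Store) : NExp → ℕ
  | .lit k => k
  | .var x => s.natVar x
  | .get a i => s.natArr a (i.eval s)
  | .add e f => e.eval s + f.eval s
  | .sub e f => e.eval s - f.eval s

/-- The value of an expression; `exp` and `log` are natural, and Mathlib's total conventions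
hold for division by zero and for the logarithm of a non-positive number. -/
noncomputable def RExp.eval (s : Store) : RExp → ℝ
  | .ofNat e => (e.eval s : ℝ)
  | .var x => s.realVar x
  | .get a i => s.realArr a (i.eval s)
  | .add e f => e.eval s + f.eval s
  | .sub e f => e.eval s - f.eval s
  | .mul e f => e.eval s * f.eval s
  | .div e f => e.eval s / f.eval s
  | .exp e => Real.exp (e.eval s)
  | .log e => Real.log (e.eval s)

/-- The truth value of a test. -/
def BExp.holds (s : Store) : BExp → Prop
  | .natLt e f => e.eval s < f.eval s
  | .realLt e f => e.eval s < f.eval s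
  | .not b => ¬ b.holds s
  | .and b c => b.holds s ∧ c.holds s

/-- The number of elementary operations in the evaluation of an expression. -/
def NExp.cost : NExp → ℕ
  | .lit _ => 1
  | .var _ => 1
  | .get _ i => i.cost + 1
  | .add e f => e.cost + f.cost + 1
  | .sub e f => e.cost + f.cost + 1

/-- The number of elementary operations in the evaluation of an expression. -/
def RExp.cost : RExp → ℕ
  | .ofNat e => e.cost + 1
  | .var _ => 1
  | .get _ i => i.cost + 1
  | .add e f => e.cost + f.cost + 1
  | .sub e f => e.cost + f.cost + 1
  | .mul e f => e.cost + f.cost + 1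
  | .div e f => e.cost + f.cost + 1
  | .exp e => e.cost + 1
  | .log e => e.cost + 1

/-- The number of elementary operations in the evaluation of a test. -/
def BExp.cost : BExp → ℕ
  | .natLt e f => e.cost + f.cost + 1
  | .realLt e f => e.cost + f.cost + 1
  | .not b => b.cost + 1
  | .and b c => b.cost + c.cost + 1

/-- Commands. -/
inductive Cmd where
  | skip
  | setNat (x : ℕ) (e : NExp)
  | setReal (x : ℕ) (e : RExp)
  | putNat (a : ℕ) (i : NExp) (e : NExp)
  | putReal (a : ℕ) (i : NExp) (e : RExp)
  | seq (c d : Cmd)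
  | ite (b : BExp) (c d : Cmd)
  | loop (b : BExp) (c : Cmd)
  | call (p : ℕ)

/-- A program: a finite list of parameterless procedures, which may call each other and
themselves and which all work on the same store, and a main command. -/
structure Program where
  procs : List Cmd
  main : Cmd

/-- Assign a natural number to a scalar variable. -/
def Store.setNat (s : Store) (x v : ℕ) : Store :=
  { s with natVar := Function.update s.natVar x v }

/-- Assign a real number to a scalar variable. -/
noncomputable def Store.setReal (s : Store) (x : ℕ) (v : ℝ) : Store :=
  { s with realVar := Function.update s.realVar x v }

/-- Write a natural number to an array cell. -/
def Store.putNat (s : Store) (a i v : ℕ) : Store :=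
  { s with natArr := Function.update s.natArr a (Function.update (s.natArr a) i v) }

/-- Write a real number to an array cell. -/
noncomputable def Store.putReal (s : Store) (a i : ℕ) (v : ℝ) : Store :=
  { s with realArr := Function.update s.realArr a (Function.update (s.realArr a) i v) }

/-- `Exec procs c s s' t`: command `c`, started in store `s`, terminates in store `s'` after
exactly `t` steps, where `procs` is the list of procedures. -/
inductive Exec (procs : List Cmd) : Cmd → Store → Store → ℕ → Prop where
  | skip (s : Store) : Exec procs .skip s s 1
  | setNat (s : Store) (x : ℕ) (e : NExp) :
      Exec procs (.setNat x e) s (s.setNat x (e.eval s)) (e.cost + 1)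
  | setReal (s : Store) (x : ℕ) (e : RExp) :
      Exec procs (.setReal x e) s (s.setReal x (e.eval s)) (e.cost + 1)
  | putNat (s : Store) (a : ℕ) (i : NExp) (e : NExp) :
      Exec procs (.putNat a i e) s (s.putNat a (i.eval s) (e.eval s)) (i.cost + e.cost + 1)
  | putReal (s : Store) (a : ℕ) (i : NExp) (e : RExp) :
      Exec procs (.putReal a i e) s (s.putReal a (i.eval s) (e.eval s)) (i.cost + e.cost + 1)
  | seq {c d : Cmd} {s s₁ s₂ : Store} {t₁ t₂ : ℕ} :
      Exec procs c s s₁ t₁ → Exec procs d s₁ s₂ t₂ → Exec procs (.seq c d) s s₂ (t₁ + t₂)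
  | iteTrue {b : BExp} {c d : Cmd} {s s' : Store} {t : ℕ} :
      b.holds s → Exec procs c s s' t → Exec procs (.ite b c d) s s' (b.cost + t + 1)
  | iteFalse {b : BExp} {c d : Cmd} {s s' : Store} {t : ℕ} :
      ¬ b.holds s → Exec procs d s s' t → Exec procs (.ite b c d) s s' (b.cost + t + 1)
  | loopDone {b : BExp} {c : Cmd} {s : Store} :
      ¬ b.holds s → Exec procs (.loop b c) s s (b.cost + 1)
  | loopStep {b : BExp} {c : Cmd} {s s₁ s₂ : Store} {t₁ t₂ : ℕ} :
      b.holds s → Exec procs c s s₁ t₁ → Exec procs (.loop b c) s₁ s₂ t₂ →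
      Exec procs (.loop b c) s s₂ (b.cost + t₁ + t₂ + 1)
  | call {p : ℕ} {c : Cmd} {s s' : Store} {t : ℕ} :
      procs[p]? = some c → Exec procs c s s' t → Exec procs (.call p) s s' (t + 1)

/-- The program, started in store `s`, halts in store `s'` after exactly `t` steps. -/
def Program.Halts (prog : Program) (s s' : Store) (t : ℕ) : Prop :=
  Exec prog.procs prog.main s s' t

end RealRAM

namespace MPCA

variable {M N : ℕ}

/-- The initial store for an instance: the natural variables `0` and `1` hold `M` and `N`, the
real array `0` holds the gains row by row (`gain m n` in cell `m * N + n`), the real array `1`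
holds the rate targets, and everything else is zero. -/
noncomputable def encode (I : MPCA M N) : RealRAM.Store where
  natVar x := if x = 0 then M else if x = 1 then N else 0
  realVar _ := 0
  natArr _ _ := 0
  realArr a i :=
    if a = 0 then
      if h : i < M * N then I.gain (Fin.divNat ⟨i, h⟩) (Fin.modNat ⟨i, h⟩) else 0
    else if a = 1 then
      if h : i < M then I.target ⟨i, h⟩ else 0
    else 0

/-- The solution read off a final store: cell `n` of the natural array `0` holds the user to
whom channel `n` is given, and cell `n` of the real array `2` holds the power used on
channel `n`. -/
noncomputable def decode (M N : ℕ) (s : RealRAM.Store) : Solution M N where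
  channels m := Finset.univ.filter fun n : Fin N => s.natArr 0 n = (m : ℕ)
  power _ n := s.realArr 2 n

end MPCA

/-! Write `K = N / M`. The `M` disjoint intervals of `K` channels contain `M * K = N` channels, so
they cover everything, and by induction from the left every one of them starts at a multiple of `K`
(`exists_tiles`). Hence a solution is a bijection between users and the `M` tiles, together with
powers that can be optimized separately for every pair of a user and a tile. With `c m j` the least
power for user `m` on tile `j`, the problem becomes an assignment problem for the matrix `c`.

The number `c m j` comes from water-filling: the optimal powers are `max (ν - 1 / g) 0` with a
common level `ν = exp μ`, by comparing the concave logarithm with its tangents (`waterfill`). In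
terms of `x = -log g` the rate is the piecewise linear, increasing function `∑ max (μ - x) 0`, and
`μ` is where it takes the value `T = R log 2`. Once the number `n₀` and the sum `S₀` of the entries
`x` below the level are known, `μ = (T + S₀) / n₀` (`IsBoundary.excess_level`).

Sorting would cost a logarithmic factor, so the entries are separated in linear time by prune and
search (`searchWithin`). A pivot is compared with the boundary, and all candidates on its wrong side
are dropped. The pivot is the median of the medians of medians of three; at least `2 * (l / 9)` of
`l` candidates lie on either side of it. Its computation is a recursive call on `l / 9` entries, and
`1/9 + 7/9 < 1` makes the total linear. The recursive call can use the same procedure, because the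
function that is compared with the threshold is a combination `level α β` of the excess and the
count: `(1, 0)` gives the water level and `(0, 1)` the median. The table has `M ^ 2` entries at cost
`O(K)` each, altogether `O(M * N)`.

The assignment problem is solved by the Hungarian method with potentials: `M` insertions of rows,
each with at most `M` rounds of linear cost (`hungarianCmd_within`). A complete matching along tight
edges is optimal by linear programming duality (`Partial.optimal`). `uniformBlockOptimal_decode`
puts the two halves together.

On the machine side, `Within` is a Hoare triple for total correctness with a time bound. Footprints
supply the frame conditions, also across the recursive call. Products of natural numbers are not
elementary operations, so all multiples needed as addresses are obtained by repeated addition. -/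

namespace RealRAM

/-! ### Stores -/

section Store
variable (s : Store) (x a i v : ℕ) (r : ℝ)

@[simp] theorem Store.setNat_natVar (y : ℕ) :
    (s.setNat x v).natVar y = if y = x then v else s.natVar y := by
  simp [Store.setNat, Function.update_apply]
@[simp] theorem Store.setNat_realVar : (s.setNat x v).realVar = s.realVar := rfl
@[simp] theorem Store.setNat_natArr : (s.setNat x v).natArr = s.natArr := rfl
@[simp] theorem Store.setNat_realArr : (s.setNat x v).realArr = s.realArr := rfl

@[simp] theorem Store.setReal_realVar (y : ℕ) :
    (s.setReal x r).realVar y = if y = x then r else s.realVar y := by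
  simp [Store.setReal, Function.update_apply]
@[simp] theorem Store.setReal_natVar : (s.setReal x r).natVar = s.natVar := rfl
@[simp] theorem Store.setReal_natArr : (s.setReal x r).natArr = s.natArr := rfl
@[simp] theorem Store.setReal_realArr : (s.setReal x r).realArr = s.realArr := rfl

@[simp] theorem Store.putNat_natArr (b : ℕ) :
    (s.putNat a i v).natArr b
      = if b = a then Function.update (s.natArr b) i v else s.natArr b := by
  by_cases h : b = a <;> simp [Store.putNat, h]
@[simp] theorem Store.putNat_natVar : (s.putNat a i v).natVar = s.natVar := rfl
@[simp] theorem Store.putNat_realVar : (s.putNat a i v).realVar = s.realVar := rfl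
@[simp] theorem Store.putNat_realArr : (s.putNat a i v).realArr = s.realArr := rfl

@[simp] theorem Store.putReal_realArr (b : ℕ) :
    (s.putReal a i r).realArr b
      = if b = a then Function.update (s.realArr b) i r else s.realArr b := by
  by_cases h : b = a <;> simp [Store.putReal, h]
@[simp] theorem Store.putReal_natVar : (s.putReal a i r).natVar = s.natVar := rfl
@[simp] theorem Store.putReal_realVar : (s.putReal a i r).realVar = s.realVar := rfl
@[simp] theorem Store.putReal_natArr : (s.putReal a i r).natArr = s.natArr := rfl

end Store

attribute [simp] NExp.eval RExp.eval BExp.holds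

/-! ### Footprints -/

/-- Names of scalar variables and of arrays. -/
structure Footprint where
  natVar : List ℕ
  realVar : List ℕ
  natArr : List ℕ
  realArr : List ℕ

/-- The union of two footprints. -/
def Footprint.union (F G : Footprint) : Footprint :=
  ⟨F.natVar ++ G.natVar, F.realVar ++ G.realVar, F.natArr ++ G.natArr, F.realArr ++ G.realArr⟩

/-- The names that a command may write to, where procedures write at most to `P`. -/
def Cmd.footprint (P : Footprint) : Cmd → Footprint
  | .skip => ⟨[], [], [], []⟩
  | .setNat x _ => ⟨[x], [], [], []⟩
  | .setReal x _ => ⟨[], [x], [], []⟩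
  | .putNat a _ _ => ⟨[], [], [a], []⟩
  | .putReal a _ _ => ⟨[], [], [], [a]⟩
  | .seq c d => (c.footprint P).union (d.footprint P)
  | .ite _ c d => (c.footprint P).union (d.footprint P)
  | .loop _ c => c.footprint P
  | .call _ => P

/-- The stores agree outside of the footprint. -/
structure EqOff (F : Footprint) (s s' : Store) : Prop where
  natVar : ∀ x, x ∉ F.natVar → s'.natVar x = s.natVar x
  realVar : ∀ x, x ∉ F.realVar → s'.realVar x = s.realVar x
  natArr : ∀ x, x ∉ F.natArr → s'.natArr x = s.natArr x
  realArr : ∀ x, x ∉ F.realArr → s'.realArr x = s.realArr x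

/-- Containment of footprints. -/
structure Footprint.Le (F G : Footprint) : Prop where
  natVar : F.natVar ⊆ G.natVar
  realVar : F.realVar ⊆ G.realVar
  natArr : F.natArr ⊆ G.natArr
  realArr : F.realArr ⊆ G.realArr

theorem EqOff.refl (F : Footprint) (s : Store) : EqOff F s s :=
  ⟨fun _ _ => rfl, fun _ _ => rfl, fun _ _ => rfl, fun _ _ => rfl⟩

theorem EqOff.trans {F : Footprint} {s₁ s₂ s₃ : Store} (h : EqOff F s₁ s₂) (h' : EqOff F s₂ s₃) :
    EqOff F s₁ s₃ where
  natVar x hx := (h'.natVar x hx).trans (h.natVar x hx)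
  realVar x hx := (h'.realVar x hx).trans (h.realVar x hx)
  natArr x hx := (h'.natArr x hx).trans (h.natArr x hx)
  realArr x hx := (h'.realArr x hx).trans (h.realArr x hx)

theorem EqOff.mono {F G : Footprint} {s s' : Store} (h : EqOff F s s') (hFG : F.Le G) :
    EqOff G s s' where
  natVar x hx := h.natVar x fun hh => hx (hFG.natVar hh)
  realVar x hx := h.realVar x fun hh => hx (hFG.realVar hh)
  natArr x hx := h.natArr x fun hh => hx (hFG.natArr hh)
  realArr x hx := h.realArr x fun hh => hx (hFG.realArr hh)

theorem Footprint.le_union_left (F G : Footprint) : F.Le (F.union G) := by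
  constructor <;> simp [Footprint.union]

theorem Footprint.le_union_right (F G : Footprint) : G.Le (F.union G) := by
  constructor <;> simp [Footprint.union]

/-- Induction on the execution. At a call, the hypothesis that `P` contains the footprint of every
procedure body, computed with `P` in place of the calls inside it, closes the induction. Recursion
therefore needs no bound on its depth. -/
theorem Exec.eqOff {procs : List Cmd} {P : Footprint}
    (hP : ∀ c ∈ procs, (c.footprint P).Le P) {c : Cmd} {s s' : Store} {t : ℕ}
    (h : Exec procs c s s' t) : EqOff (c.footprint P) s s' := by
  induction h with
  | skip s => exact EqOff.refl _ _
  | setNat s x e => constructor <;> simp +contextual [Cmd.footprint]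
  | setReal s x e => constructor <;> simp +contextual [Cmd.footprint]
  | putNat s a i e => constructor <;> simp +contextual [Cmd.footprint]
  | putReal s a i e => constructor <;> simp +contextual [Cmd.footprint]
  | seq _ _ ih₁ ih₂ =>
    exact (ih₁.mono (Footprint.le_union_left _ _)).trans (ih₂.mono (Footprint.le_union_right _ _))
  | iteTrue _ _ ih => exact ih.mono (Footprint.le_union_left _ _)
  | iteFalse _ _ ih => exact ih.mono (Footprint.le_union_right _ _)
  | loopDone _ => exact EqOff.refl _ _
  | loopStep _ _ _ ih₁ ih₂ => exact ih₁.trans ih₂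
  | call hp _ ih => exact ih.mono (hP _ (List.mem_of_getElem? hp))

/-! ### Total correctness with time bounds -/

/-- Command `c`, started in `s`, halts within `t` steps in a store that satisfies `Q`. -/
def Within (procs : List Cmd) (c : Cmd) (s : Store) (t : ℕ) (Q : Store → Prop) : Prop :=
  ∃ s' t', Exec procs c s s' t' ∧ t' ≤ t ∧ Q s'

section Within
variable {procs : List Cmd} {c d body : Cmd} {b : BExp} {s : Store} {t t₁ t₂ : ℕ}
  {Q Q₁ : Store → Prop}

theorem Within.mono (h : Within procs c s t₁ Q₁) (ht : t₁ ≤ t) (hQ : ∀ s', Q₁ s' → Q s') :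
    Within procs c s t Q := by
  obtain ⟨s', t', he, ht', hq⟩ := h
  exact ⟨s', t', he, ht'.trans ht, hQ _ hq⟩

theorem Within.frame {P : Footprint} (hP : ∀ c ∈ procs, (c.footprint P).Le P)
    (h : Within procs c s t Q) :
    Within procs c s t fun s' => EqOff (c.footprint P) s s' ∧ Q s' := by
  obtain ⟨s', t', he, ht', hq⟩ := h
  exact ⟨s', t', he, ht', he.eqOff hP, hq⟩

theorem Within.seq (h₁ : Within procs c s t₁ Q₁) (h₂ : ∀ s', Q₁ s' → Within procs d s' t₂ Q)
    (ht : t₁ + t₂ ≤ t) : Within procs (.seq c d) s t Q := by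
  obtain ⟨s', t', he, ht', hq⟩ := h₁
  obtain ⟨s'', t'', he', ht'', hq'⟩ := h₂ s' hq
  exact ⟨s'', _, .seq he he', by omega, hq'⟩

theorem Within.ite (h₁ : b.holds s → Within procs c s t₁ Q)
    (h₂ : ¬ b.holds s → Within procs d s t₁ Q) (ht : b.cost + t₁ + 1 ≤ t) :
    Within procs (.ite b c d) s t Q := by
  by_cases hb : b.holds s
  · obtain ⟨s', t', he, ht', hq⟩ := h₁ hb
    exact ⟨s', _, .iteTrue hb he, by omega, hq⟩
  · obtain ⟨s', t', he, ht', hq⟩ := h₂ hb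
    exact ⟨s', _, .iteFalse hb he, by omega, hq⟩

theorem Within.call {p : ℕ} (hp : procs[p]? = some c) (h : Within procs c s t₁ Q)
    (ht : t₁ + 1 ≤ t) : Within procs (.call p) s t Q := by
  obtain ⟨s', t', he, ht', hq⟩ := h
  exact ⟨s', _, .call hp he, by omega, hq⟩

theorem Within.loop_done (hb : ¬ b.holds s) (hQ : Q s) (ht : b.cost + 1 ≤ t) :
    Within procs (.loop b body) s t Q :=
  ⟨s, _, .loopDone hb, ht, hQ⟩

theorem Within.loop_step (hb : b.holds s) (h₁ : Within procs body s t₁ Q₁)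
    (h₂ : ∀ s', Q₁ s' → Within procs (.loop b body) s' t₂ Q) (ht : b.cost + t₁ + t₂ + 1 ≤ t) :
    Within procs (.loop b body) s t Q := by
  obtain ⟨s', t', he, ht', hq⟩ := h₁
  obtain ⟨s'', t'', he', ht'', hq'⟩ := h₂ s' hq
  exact ⟨s'', _, .loopStep hb he he', by omega, hq'⟩

/-- A loop with an invariant that is indexed by a bound for the number of iterations left. -/
theorem Within.loop {Inv : ℕ → Store → Prop}
    (step : ∀ f s, Inv f s → b.holds s → ∃ f', f = f' + 1 ∧ Within procs body s t (Inv f')) :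
    ∀ f s, Inv f s → Within procs (.loop b body) s (f * (b.cost + t + 1) + b.cost + 1)
      fun s' => ¬ b.holds s' ∧ ∃ f', Inv f' s' := by
  intro f
  induction f with
  | zero =>
    intro s hs
    by_cases hb : b.holds s
    · obtain ⟨f', hf, -⟩ := step 0 s hs hb
      omega
    · exact .loop_done hb ⟨hb, _, hs⟩ (by omega)
  | succ f ih =>
    intro s hs
    by_cases hb : b.holds s
    · obtain ⟨f', hf, h⟩ := step _ s hs hb
      obtain rfl : f = f' := by omega
      exact .loop_step hb h ih (by linarith)
    · exact .loop_done hb ⟨hb, _, hs⟩ (by linarith [Nat.zero_le ((f + 1) * (b.cost + t + 1))])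

end Within

/-! ### Commands without loops and calls -/

/-- The command contains neither loops nor calls. -/
def Cmd.flat : Cmd → Bool
  | .seq c d => c.flat && d.flat
  | .ite _ c d => c.flat && d.flat
  | .loop _ _ => false
  | .call _ => false
  | _ => true

/-- A bound for the number of steps of a flat command. -/
def Cmd.time : Cmd → ℕ
  | .skip => 1
  | .setNat _ e => e.cost + 1
  | .setReal _ e => e.cost + 1
  | .putNat _ i e => i.cost + e.cost + 1
  | .putReal _ i e => i.cost + e.cost + 1
  | .seq c d => c.time + d.time
  | .ite b c d => b.cost + max c.time d.time + 1
  | .loop _ _ => 0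
  | .call _ => 0

open Classical in
/-- The effect of a flat command. -/
@[simp] noncomputable def Cmd.eff : Cmd → Store → Store
  | .skip, s => s
  | .setNat x e, s => s.setNat x (e.eval s)
  | .setReal x e, s => s.setReal x (e.eval s)
  | .putNat a i e, s => s.putNat a (i.eval s) (e.eval s)
  | .putReal a i e, s => s.putReal a (i.eval s) (e.eval s)
  | .seq c d, s => d.eff (c.eff s)
  | .ite b c d, s => if b.holds s then c.eff s else d.eff s
  | .loop _ _, s => s
  | .call _, s => s

/-- Without loops and calls the final store is a total function of the initial one, so such commands
can be verified by simplifying `Cmd.eff` instead of building executions. -/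
theorem Cmd.exec_flat (procs : List Cmd) (c : Cmd) (hc : c.flat = true) (s : Store) :
    ∃ t ≤ c.time, Exec procs c s (c.eff s) t := by
  induction c generalizing s with
  | skip => exact ⟨_, le_rfl, .skip s⟩
  | setNat x e => exact ⟨_, le_rfl, .setNat s x e⟩
  | setReal x e => exact ⟨_, le_rfl, .setReal s x e⟩
  | putNat a i e => exact ⟨_, le_rfl, .putNat s a i e⟩
  | putReal a i e => exact ⟨_, le_rfl, .putReal s a i e⟩
  | seq c d ihc ihd =>
    simp only [Cmd.flat, Bool.and_eq_true] at hc
    obtain ⟨t₁, h₁, e₁⟩ := ihc hc.1 s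
    obtain ⟨t₂, h₂, e₂⟩ := ihd hc.2 (c.eff s)
    exact ⟨_, Nat.add_le_add h₁ h₂, .seq e₁ e₂⟩
  | ite b c d ihc ihd =>
    simp only [Cmd.flat, Bool.and_eq_true] at hc
    by_cases hb : b.holds s
    · obtain ⟨t₁, h₁, e₁⟩ := ihc hc.1 s
      refine ⟨_, ?_, by simpa [hb] using Exec.iteTrue hb e₁⟩
      simp only [Cmd.time]
      omega
    · obtain ⟨t₁, h₁, e₁⟩ := ihd hc.2 s
      refine ⟨_, ?_, by simpa [hb] using Exec.iteFalse hb e₁⟩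
      simp only [Cmd.time]
      omega
  | loop b c _ => simp [Cmd.flat] at hc
  | call p => simp [Cmd.flat] at hc

theorem Within.flat {procs : List Cmd} {c : Cmd} {s : Store} {t : ℕ} {Q : Store → Prop}
    (hc : c.flat = true) (ht : c.time ≤ t) (hQ : Q (c.eff s)) : Within procs c s t Q := by
  obtain ⟨t', ht', he⟩ := c.exec_flat procs hc s
  exact ⟨_, _, he, ht'.trans ht, hQ⟩

/-! ### Blocks and counting loops -/

/-- Sequential composition of a list of commands. -/
@[simp] def block : List Cmd → Cmd
  | [] => .skip
  | [c] => c
  | c :: cs => .seq c (block cs)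

/-- `for i in 0, …, b - 1 do body`, where `i` and `b` are variables. -/
def forUp (i b : ℕ) (body : Cmd) : Cmd :=
  .seq (.setNat i (.lit 0)) (.loop (.natLt (.var i) (.var b))
    (.seq body (.setNat i (.add (.var i) (.lit 1)))))

/-- `Inv k` describes the store at the loop test when the counter is `k`; hence the body has to
establish the next instance for the store after the increment. The hypotheses on `i` and `b` keep
the body away from the counter and the whole loop away from the bound. A round costs 4 for test and
branching and 4 for the increment; the remaining 6 are the initialization and the last test. -/
theorem Within.forUp {procs : List Cmd} {P : Footprint}
    (hP : ∀ c ∈ procs, (c.footprint P).Le P) {i b : ℕ} {body : Cmd} {s : Store} {n t : ℕ}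
    (Inv : ℕ → Store → Prop) (hb : s.natVar b = n)
    (hi : i ∉ (body.footprint P).natVar) (hbF : b ∉ ((forUp i b body).footprint P).natVar)
    (h0 : Inv 0 (s.setNat i 0))
    (step : ∀ k s', k < n → s'.natVar i = k → EqOff ((RealRAM.forUp i b body).footprint P) s s' →
      Inv k s' → Within procs body s' t fun s'' => Inv (k + 1) (s''.setNat i (k + 1))) :
    Within procs (RealRAM.forUp i b body) s (n * (t + 8) + 6)
      fun s' => EqOff ((RealRAM.forUp i b body).footprint P) s s' ∧ Inv n s' := by
  refine Within.frame hP ?_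
  have hfp : ((RealRAM.forUp i b body).footprint P)
      = (Footprint.mk [i] [] [] []).union ((body.footprint P).union ⟨[i], [], [], []⟩) := rfl
  refine Within.seq (t₁ := 2) (t₂ := n * (t + 8) + 4)
    (Q₁ := fun s' => s' = s.setNat i 0) ?_ ?_ (by omega)
  · exact .flat rfl le_rfl rfl
  rintro _ rfl
  have key := Within.loop (procs := procs) (t := t + 4) (b := .natLt (.var i) (.var b))
    (body := .seq body (.setNat i (.add (.var i) (.lit 1))))
    (Inv := fun f s' => s'.natVar i + f = n ∧
      EqOff ((RealRAM.forUp i b body).footprint P) s s' ∧ Inv (s'.natVar i) s') ?_ n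
      (s.setNat i 0) ⟨by simp, ?_, by simpa using h0⟩
  · refine key.mono ?_ ?_
    · simp only [BExp.cost, NExp.cost]
      ring_nf
      omega
    · rintro s' ⟨hn, f, hf, hE, hI⟩
      have : s'.natVar b = n := by rw [hE.natVar b hbF, hb]
      simp only [BExp.holds, NExp.eval] at hn
      have : s'.natVar i = n := by omega
      rwa [this] at hI
  · rintro f s' ⟨hf, hE, hI⟩ hlt
    have hbn : s'.natVar b = n := by rw [hE.natVar b hbF, hb]
    simp only [BExp.holds, NExp.eval] at hlt
    refine ⟨f - 1, by omega, ?_⟩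
    refine Within.seq (t₂ := 4) ((step _ s' (by omega) rfl hE hI).frame hP) ?_ le_rfl
    rintro s'' ⟨hE', hI'⟩
    have hi' : s''.natVar i = s'.natVar i := hE'.natVar i hi
    refine .flat rfl le_rfl ?_
    simp only [Cmd.eff, NExp.eval, Store.setNat_natVar, if_true, hi']
    refine ⟨by omega, ?_, hI'⟩
    refine hE.trans ((hE'.mono ?_).trans ?_)
    · rw [hfp]; constructor <;> simp +contextual [Footprint.union]
    · rw [hfp]; constructor <;> simp +contextual [Footprint.union]
  · rw [hfp]; constructor <;> simp +contextual [Footprint.union]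

end RealRAM

/-! ### Segments of arrays -/

/-- The entries `f b, …, f (b + l - 1)`. -/
def seg (f : ℕ → ℝ) (b l : ℕ) : List ℝ := (List.range l).map fun i => f (b + i)

@[simp] theorem seg_zero (f : ℕ → ℝ) (b : ℕ) : seg f b 0 = [] := rfl

@[simp] theorem length_seg (f : ℕ → ℝ) (b l : ℕ) : (seg f b l).length = l := by simp [seg]

theorem seg_succ (f : ℕ → ℝ) (b l : ℕ) : seg f b (l + 1) = seg f b l ++ [f (b + l)] := by
  simp [seg, List.range_succ]

theorem seg_congr {f g : ℕ → ℝ} {b l : ℕ} (h : ∀ i < l, f (b + i) = g (b + i)) :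
    seg f b l = seg g b l := by
  simpa [seg] using h

theorem seg_add (f : ℕ → ℝ) (b l k : ℕ) : seg f b (l + k) = seg f b l ++ seg f (b + l) k := by
  induction k with
  | zero => simp
  | succ k ih => rw [← add_assoc, seg_succ, ih, seg_succ, add_assoc, List.append_assoc]

theorem mem_seg {f : ℕ → ℝ} {b l : ℕ} {x : ℝ} : x ∈ seg f b l ↔ ∃ i < l, f (b + i) = x := by
  simp [seg]

/-! ### Thresholds of lists -/

section Split
variable {p q r : ℝ → Prop} [DecidablePred p] [DecidablePred q] [DecidablePred r] {l : List ℝ}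

/-- Additivity over a disjoint union. It is used to transfer the candidates up to a pivot to the
known lower side. -/
theorem filter_split (h : ∀ x ∈ l, (p x ↔ q x ∨ r x)) (hd : ∀ x ∈ l, q x → ¬ r x) :
    (l.filter (p ·)).length = (l.filter (q ·)).length + (l.filter (r ·)).length ∧
    (l.filter (p ·)).sum = (l.filter (q ·)).sum + (l.filter (r ·)).sum := by
  induction l with
  | nil => simp
  | cons x l ih =>
    obtain ⟨h₁, h₂⟩ := ih (fun y hy => h y (by simp [hy])) (fun y hy => hd y (by simp [hy]))
    have hx := h x (by simp)
    have hdx := hd x (by simp)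
    by_cases hq : q x
    · have hr := hdx hq
      have hp := hx.2 (.inl hq)
      simp [hq, hr, hp, h₁, h₂]
      constructor <;> ring
    · by_cases hr : r x
      · have hp := hx.2 (.inr hr)
        simp [hq, hr, hp, h₁, h₂]
        constructor <;> ring
      · have hp : ¬ p x := by tauto
        simp [hq, hr, hp, h₁, h₂]

end Split

/-- The sublist of the entries up to `p`. -/
noncomputable def below (l : List ℝ) (p : ℝ) : List ℝ := l.filter (· ≤ p)

/-- A combination of `∑ x, max (p - x) 0` and of the number of entries up to `p`. -/
noncomputable def level (α β : ℝ) (l : List ℝ) (p : ℝ) : ℝ :=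
  α * ((below l p).length * p - (below l p).sum) + β * (below l p).length

/-- The left-hand side is what a program can accumulate, namely a count and a sum; the right-hand
side is visibly monotone in `p` and is the quantity in water-filling. -/
theorem below_excess (l : List ℝ) (p : ℝ) :
    (below l p).length * p - (below l p).sum = (l.map fun x => max (p - x) 0).sum := by
  induction l with
  | nil => simp [below]
  | cons x l ih =>
    simp only [below] at ih
    by_cases h : x ≤ p
    · simp only [below, h, decide_true, List.filter_cons_of_pos, List.length_cons, List.sum_cons,
        List.map_cons, max_eq_left (sub_nonneg.2 h), ← ih]
      push_cast
      ring
    · simp only [below, h, decide_false, Bool.false_eq_true, not_false_eq_true,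
        List.filter_cons_of_neg, List.map_cons, List.sum_cons,
        max_eq_right (sub_nonpos.2 (not_le.1 h).le), ← ih, zero_add]

theorem excess_mono (l : List ℝ) : Monotone fun p : ℝ => (l.map fun x => max (p - x) 0).sum := by
  intro p q hpq
  refine List.sum_le_sum fun x _ => ?_
  exact max_le_max (by linarith) le_rfl

theorem length_below_mono (l : List ℝ) {p q : ℝ} (hpq : p ≤ q) :
    (below l p).length ≤ (below l q).length := by
  simp only [below, ← List.countP_eq_length_filter]
  refine List.countP_mono_left fun x _ hx => ?_
  simp only [decide_eq_true_eq] at hx ⊢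
  exact hx.trans hpq

/-- This makes `T ≤ level α β l ·` an up-closed predicate, so that one comparison at a pivot decides
for all entries on one side of it. -/
theorem level_mono {α β : ℝ} (hα : 0 ≤ α) (hβ : 0 ≤ β) (l : List ℝ) : Monotone (level α β l) := by
  intro p q hpq
  simp only [level, below_excess]
  have h₁ := excess_mono l hpq
  have h₂ : ((below l p).length : ℝ) ≤ (below l q).length := by
    exact_mod_cast length_below_mono l hpq
  simp only at h₁
  gcongr

open Classical in
/-- State of a search for the boundary of the up-closed predicate `D` in the list `l`: the list
`C` of candidates, the number `n₀` and the sum `S₀` of those entries that are known to be on the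
lower side, and the least entry `o` that is known to be on the upper side. -/
structure Boundary (D : ℝ → Prop) (l C : List ℝ) (n₀ : ℕ) (S₀ o : ℝ) : Prop where
  length : (l.filter (¬ D ·)).length = n₀ + (C.filter (¬ D ·)).length
  sum : (l.filter (¬ D ·)).sum = S₀ + (C.filter (¬ D ·)).sum
  below_length : ∀ p, (∃ x ∈ C, x ≤ p) → (∃ x ∈ C, p ≤ x) →
    (below l p).length = n₀ + (below C p).length
  below_sum : ∀ p, (∃ x ∈ C, x ≤ p) → (∃ x ∈ C, p ≤ x) →
    (below l p).sum = S₀ + (below C p).sum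
  upper : ∀ x ∈ l, D x → x ∈ C ∨ (D o ∧ o ≤ x ∧ ∀ c ∈ C, c < o)

namespace Boundary
variable {D : ℝ → Prop} {l C : List ℝ} {n₀ : ℕ} {S₀ o p : ℝ}

theorem init (D : ℝ → Prop) (l : List ℝ) (o : ℝ) : Boundary D l l 0 0 o := by
  constructor <;> simp +contextual

/-- The pivot is below the boundary, hence so are all candidates up to `p`; their number and sum are
added to what is known. -/
theorem right (h : Boundary D l C n₀ S₀ o) (hD : ∀ x y, x ≤ y → D x → D y) (hp : ¬ D p) :
    Boundary D l (C.filter (p < ·)) (n₀ + (below C p).length) (S₀ + (below C p).sum) o := by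
  classical
  have h₁ := filter_split (l := C) (p := (¬ D ·)) (q := (· ≤ p)) (r := fun x => ¬ D x ∧ p < x)
    (fun x _ => by
      constructor
      · intro hx
        by_cases hxp : x ≤ p
        · exact .inl hxp
        · exact .inr ⟨hx, not_le.1 hxp⟩
      · rintro (hx | hx)
        · exact fun hDx => hp (hD _ _ hx hDx)
        · exact hx.1)
    (fun x _ hx hx' => absurd hx'.2 (not_lt.2 hx))
  -- Later thresholds lie above some remaining candidate, hence above `p`, and the dropped
  -- candidates all count for them.
  have h₂ : ∀ p', p < p' → _ := fun p' hpp' =>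
    filter_split (l := C) (p := (· ≤ p')) (q := (· ≤ p)) (r := fun x => x ≤ p' ∧ p < x)
    (fun x _ => by
      constructor
      · intro hx
        by_cases hxp : x ≤ p
        · exact .inl hxp
        · exact .inr ⟨hx, not_le.1 hxp⟩
      · rintro (hx | hx)
        · exact hx.trans hpp'.le
        · exact hx.1)
    (fun x _ hx hx' => absurd hx'.2 (not_lt.2 hx))
  constructor
  · rw [h.length, h₁.1]
    simp [below, List.filter_filter, add_assoc]
  · rw [h.sum, h₁.2]
    simp [below, List.filter_filter, add_assoc]
  · rintro q ⟨x, hx, hxq⟩ ⟨y, hy, hqy⟩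
    simp only [List.mem_filter, decide_eq_true_eq] at hx hy
    rw [h.below_length q ⟨x, hx.1, hxq⟩ ⟨y, hy.1, hqy⟩, below, (h₂ q (hx.2.trans_le hxq)).1]
    simp [below, List.filter_filter, add_assoc]
  · rintro q ⟨x, hx, hxq⟩ ⟨y, hy, hqy⟩
    simp only [List.mem_filter, decide_eq_true_eq] at hx hy
    rw [h.below_sum q ⟨x, hx.1, hxq⟩ ⟨y, hy.1, hqy⟩, below, (h₂ q (hx.2.trans_le hxq)).2]
    simp [below, List.filter_filter, add_assoc]
  · intro x hx hDx
    rcases h.upper x hx hDx with hC | ⟨h₁, h₂, h₃⟩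
    · left
      simp only [List.mem_filter, decide_eq_true_eq]
      exact ⟨hC, not_le.1 fun hxp => hp (hD _ _ hxp hDx)⟩
    · exact .inr ⟨h₁, h₂, fun c hc => h₃ c (List.mem_filter.1 hc).1⟩

/-- The candidates from `p` on satisfy `D` and drop out, and `p` takes the place of `o`. This is an
improvement because the old `o`, if it matters, exceeds all candidates, in particular the one from
`hC`. -/
theorem left (h : Boundary D l C n₀ S₀ o) (hD : ∀ x y, x ≤ y → D x → D y) (hp : D p)
    (hC : ∃ c ∈ C, p ≤ c) : Boundary D l (C.filter (· < p)) n₀ S₀ p := by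
  classical
  have h₁ : (C.filter (· < p)).filter (¬ D ·) = C.filter (¬ D ·) := by
    rw [List.filter_filter]
    refine List.filter_congr fun x _ => ?_
    simp only [decide_not, Bool.and_eq_left_iff_imp, Bool.not_eq_eq_eq_not, Bool.not_true,
      decide_eq_false_iff_not, decide_eq_true_eq]
    exact fun hx => not_le.1 fun hxp => hx (hD _ _ hxp hp)
  have h₂ : ∀ p', p' < p → below (C.filter (· < p)) p' = below C p' := by
    intro p' hp'
    rw [below, below, List.filter_filter]
    refine List.filter_congr fun x _ => ?_
    simp only [Bool.and_eq_left_iff_imp, decide_eq_true_eq]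
    exact fun hx => hx.trans_lt hp'
  constructor
  · rw [h.length, h₁]
  · rw [h.sum, h₁]
  · rintro q ⟨x, hx, hxq⟩ ⟨y, hy, hqy⟩
    simp only [List.mem_filter, decide_eq_true_eq] at hx hy
    rw [h.below_length q ⟨x, hx.1, hxq⟩ ⟨y, hy.1, hqy⟩, h₂ q (hqy.trans_lt hy.2)]
  · rintro q ⟨x, hx, hxq⟩ ⟨y, hy, hqy⟩
    simp only [List.mem_filter, decide_eq_true_eq] at hx hy
    rw [h.below_sum q ⟨x, hx.1, hxq⟩ ⟨y, hy.1, hqy⟩, h₂ q (hqy.trans_lt hy.2)]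
  · intro x hx hDx
    by_cases hxp : x < p
    · rcases h.upper x hx hDx with hxC | ⟨h₁, h₂, h₃⟩
      · exact .inl (by simp [hxC, hxp])
      · obtain ⟨c, hc, hpc⟩ := hC
        have := h₃ c hc
        exact absurd hxp (by linarith)
    · exact .inr ⟨hp, not_lt.1 hxp, fun c hc => by simpa using (List.mem_filter.1 hc).2⟩

end Boundary

open Classical in
/-- The result of a search for the boundary of the up-closed predicate `D` in the list `l`. -/
structure IsBoundary (D : ℝ → Prop) (l : List ℝ) (n₀ : ℕ) (S₀ o : ℝ) : Prop where
  length : (l.filter (¬ D ·)).length = n₀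
  sum : (l.filter (¬ D ·)).sum = S₀
  upper : ∀ x ∈ l, D x → D o ∧ o ≤ x

theorem Boundary.isBoundary {D : ℝ → Prop} {l : List ℝ} {n₀ : ℕ} {S₀ o : ℝ}
    (h : Boundary D l [] n₀ S₀ o) : IsBoundary D l n₀ S₀ o where
  length := by simpa using h.length
  sum := by simpa using h.sum
  upper x hx hDx := by simpa using h.upper x hx hDx

/-- The search with `α = 0` and `β = 1` selects the median. -/
theorem IsBoundary.median {l : List ℝ} {n₀ : ℕ} {S₀ o : ℝ} (hl : l ≠ [])
    (h : IsBoundary (fun p => (l.length : ℝ) / 2 ≤ level 0 1 l p) l n₀ S₀ o) :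
    l.length ≤ 2 * l.countP (· ≤ o) ∧ l.length ≤ 2 * l.countP (o ≤ ·) := by
  classical
  have hpos : 0 < l.length := List.length_pos_iff.2 hl
  simp only [level, below, zero_mul, one_mul, zero_add, ← List.countP_eq_length_filter] at h
  set D : ℝ → Prop := fun p => (l.length : ℝ) / 2 ≤ ((l.countP (· ≤ p) : ℕ) : ℝ) with hDdef
  have hmono : ∀ x y, x ≤ y → D x → D y := by
    intro x y hxy hx
    refine hx.trans ?_
    exact_mod_cast List.countP_mono_left fun z _ hz => by
      simp only [decide_eq_true_eq] at hz ⊢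
      exact hz.trans hxy
  -- All entries are at most the maximum, so the upper side is non-empty and `o` is meaningful.
  obtain ⟨m, hm, hmax⟩ := l.toFinset.exists_max_image id (by simpa using hl)
  have hDm : D m := by
    have : l.countP (· ≤ m) = l.length := by
      rw [List.countP_eq_length]
      intro x hx
      simpa using hmax x (by simpa using hx)
    simp only [hDdef, this]
    have : (0 : ℝ) < l.length := by exact_mod_cast hpos
    linarith
  obtain ⟨hDo, -⟩ := h.upper m (by simpa using hm) hDm
  constructor
  · have : (l.length : ℝ) ≤ 2 * (l.countP (· ≤ o) : ℕ) := by
      have : (l.length : ℝ) / 2 ≤ (l.countP (· ≤ o) : ℕ) := hDo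
      linarith
    exact_mod_cast this
  · have h₁ : l.countP (D ·) ≤ l.countP (o ≤ ·) := List.countP_mono_left fun x hx hDx => by
      simp only [decide_eq_true_eq] at hDx ⊢
      exact (h.upper x hx hDx).2
    have h₂ : l.length = l.countP (D ·) + l.countP (¬ D ·) := by
      refine (List.length_eq_countP_add_countP (D ·)).trans ?_
      congr 2
      ext x
      simp
    -- All entries on the lower side are at most its largest element `y`, and since `D y` fails,
    -- fewer than half of all entries are at most `y`.
    have h₃ : 2 * l.countP (¬ D ·) ≤ l.length := by
      by_cases hne : l.filter (¬ D ·) = []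
      · rw [List.countP_eq_length_filter, hne]
        simp
      obtain ⟨y, hy, hymax⟩ := (l.filter (¬ D ·)).toFinset.exists_max_image id
        (List.toFinset_nonempty_iff _ |>.2 hne)
      have hyD : ¬ D y := by
        have := List.mem_filter.1 (List.mem_toFinset.1 hy)
        simpa using this.2
      have h₄ : l.countP (¬ D ·) ≤ l.countP (· ≤ y) := List.countP_mono_left fun x hx hDx => by
        simp only [decide_eq_true_eq] at hDx ⊢
        exact hymax x (by simpa [hx] using hDx)
      have h₅ : ((l.countP (· ≤ y) : ℕ) : ℝ) < (l.length : ℝ) / 2 := not_le.1 hyD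
      have h₆ : 2 * ((l.countP (· ≤ y) : ℕ) : ℝ) < (l.length : ℝ) := by linarith
      have h₇ : 2 * (l.countP (· ≤ y)) < l.length := by exact_mod_cast h₆
      omega
    omega

/-- Between the two sides exactly the lower entries contribute, so there the excess is an affine
function of `q`, with slope and intercept given by count and sum. -/
theorem excess_eq (D : ℝ → Prop) [DecidablePred D] (l : List ℝ) (q : ℝ)
    (h₁ : ∀ x ∈ l, ¬ D x → x ≤ q) (h₂ : ∀ x ∈ l, D x → q ≤ x) :
    (l.map fun x => max (q - x) 0).sum
      = (l.filter (¬ D ·)).length * q - (l.filter (¬ D ·)).sum := by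
  induction l with
  | nil => simp
  | cons x l ih =>
    have ih := ih (fun y hy => h₁ y (by simp [hy])) (fun y hy => h₂ y (by simp [hy]))
    by_cases hx : D x
    · have := h₂ x (by simp) hx
      simp only [List.map_cons, List.sum_cons, ih, hx, not_true, decide_false, Bool.false_eq_true,
        not_false_eq_true, List.filter_cons_of_neg, max_eq_right (sub_nonpos.2 this), zero_add]
    · have := h₁ x (by simp) hx
      simp only [List.map_cons, List.sum_cons, ih, hx, not_false_eq_true, decide_true,
        List.filter_cons_of_pos, List.length_cons, max_eq_left (sub_nonneg.2 this)]
      push_cast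
      ring

/-- The search with `α = 1` and `β = 0` finds the water level. -/
theorem IsBoundary.excess_level {l : List ℝ} {n₀ : ℕ} {S₀ o T : ℝ} (hl : l ≠ []) (hT : 0 < T)
    (h : IsBoundary (fun p => T ≤ level 1 0 l p) l n₀ S₀ o) :
    (l.map fun x => max ((T + S₀) / n₀ - x) 0).sum = T := by
  classical
  simp only [level, below_excess, one_mul, zero_mul, add_zero] at h
  set D : ℝ → Prop := fun p => T ≤ (l.map fun x => max (p - x) 0).sum with hDdef
  have hmono : ∀ x y, x ≤ y → D x → D y := fun x y hxy hx => hx.trans (excess_mono l hxy)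
  have hlen := h.length
  have hsum := h.sum
  -- At the least entry the excess is zero and hence smaller than `T`. So `n₀` is positive and the
  -- quotient in `μ` is a genuine one.
  have hne : l.filter (¬ D ·) ≠ [] := by
    obtain ⟨m, hm, hmin⟩ := l.toFinset.exists_min_image id (by simpa using hl)
    have hDm : ¬ D m := by
      have : (l.map fun x => max (m - x) 0).sum = 0 := by
        refine List.sum_eq_zero fun y hy => ?_
        obtain ⟨x, hx, rfl⟩ := List.mem_map.1 hy
        have : m ≤ x := hmin x (by simpa using hx)
        exact max_eq_right (by linarith)
      simp only [hDdef, this, not_le, hT]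
    exact List.ne_nil_of_mem (a := m) (by simpa [hDm] using hm)
  have hn : (0 : ℝ) < n₀ := by
    rw [← hlen]
    exact_mod_cast List.length_pos_iff.2 hne
  set μ := (T + S₀) / n₀ with hμ
  have hμ' : n₀ * μ - S₀ = T := by
    rw [hμ]
    field_simp
    ring
  -- It remains to place `μ` between the two sides. The affine function `n₀ * q - S₀` is below `T`
  -- at the largest lower entry and at least `T` at `o`, and it equals `T` at `μ`.
  rw [excess_eq D l μ, hlen, hsum, hμ']
  · obtain ⟨y, hy, hymax⟩ := (l.filter (¬ D ·)).toFinset.exists_max_image id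
      (List.toFinset_nonempty_iff _ |>.2 hne)
    have hy' := List.mem_filter.1 (List.mem_toFinset.1 hy)
    have hyD : ¬ D y := by simpa using hy'.2
    have hle : ∀ x ∈ l, ¬ D x → x ≤ y := fun x hx hDx => hymax x (by simpa [hx] using hDx)
    have hF := excess_eq D l y hle fun x hx hDx =>
      (le_total y x).resolve_right fun hxy => hyD (hmono _ _ hxy hDx)
    rw [hlen, hsum] at hF
    have : n₀ * y - S₀ < T := by
      rw [← hF]
      exact not_le.1 hyD
    have : y ≤ μ := by
      by_contra hlt
      nlinarith [not_le.1 hlt]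
    exact fun x hx hDx => (hle x hx hDx).trans this
  · intro x hx hDx
    obtain ⟨hDo, hox⟩ := h.upper x hx hDx
    have hF := excess_eq D l o
      (fun x hx hDx => (le_total x o).resolve_right fun hxy => hDx (hmono _ _ hxy hDo))
      (fun x hx hDx => (h.upper x hx hDx).2)
    rw [hlen, hsum] at hF
    have : T ≤ n₀ * o - S₀ := by
      rw [← hF]
      exact hDo
    have : μ ≤ o := by
      by_contra hlt
      nlinarith [not_le.1 hlt]
    exact this.trans hox

/-! ### Water-filling -/

/-- Water-filling powers reach the rate target and have the least sum. -/
theorem waterfill {ι : Type*} (s : Finset ι) (g : ι → ℝ) (hg : ∀ i ∈ s, 0 < g i) {μ T : ℝ}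
    (h : ∑ i ∈ s, max (μ - -Real.log (g i)) 0 = T) :
    T ≤ ∑ i ∈ s, Real.log (1 + max (Real.exp μ - 1 / g i) 0 * g i) ∧
    ∀ P : ι → ℝ, (∀ i ∈ s, 0 ≤ P i) → T ≤ ∑ i ∈ s, Real.log (1 + P i * g i) →
      ∑ i ∈ s, max (Real.exp μ - 1 / g i) 0 ≤ ∑ i ∈ s, P i := by
  have hexp : ∀ i ∈ s, 1 / g i = Real.exp (-Real.log (g i)) := fun i hi => by
    rw [Real.exp_neg, Real.exp_log (hg i hi), one_div]
  have key : ∀ i ∈ s, Real.log (1 + max (Real.exp μ - 1 / g i) 0 * g i)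
      = max (μ - -Real.log (g i)) 0 := by
    intro i hi
    have hgi := hg i hi
    rcases le_total μ (-Real.log (g i)) with hle | hle
    · have : Real.exp μ - 1 / g i ≤ 0 := by
        rw [hexp i hi, sub_nonpos, Real.exp_le_exp]
        exact hle
      rw [max_eq_right this, max_eq_right (by linarith)]
      simp
    · have : 0 ≤ Real.exp μ - 1 / g i := by
        rw [hexp i hi, sub_nonneg, Real.exp_le_exp]
        exact hle
      rw [max_eq_left this, max_eq_left (by linarith)]
      have : 1 + (Real.exp μ - 1 / g i) * g i = Real.exp μ * g i := by
        field_simp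
        ring
      rw [this, Real.log_mul (Real.exp_ne_zero _) hgi.ne', Real.log_exp]
      ring
  refine ⟨by rw [Finset.sum_congr rfl key, h], fun P hP hT => ?_⟩
  have hν := Real.exp_pos μ
  -- The tangent at the water-filling power `Q` bounds the rate. Its slope is `1 / exp μ` where the
  -- channel is active and at most that where `Q = 0`; in the latter case `P i - Q` is non-negative,
  -- so the slope may be enlarged. With one multiplier for all channels, summation compares the
  -- total powers.
  have hle : ∀ i ∈ s, Real.log (1 + P i * g i) ≤ max (μ - -Real.log (g i)) 0
      + (P i - max (Real.exp μ - 1 / g i) 0) / Real.exp μ := by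
    intro i hi
    have hgi := hg i hi
    have hPi := hP i hi
    rw [← key i hi]
    set Q := max (Real.exp μ - 1 / g i) 0 with hQ
    have hQ0 : 0 ≤ Q := le_max_right _ _
    have h1Q : 0 < 1 + Q * g i := by positivity
    have h1P : 0 < 1 + P i * g i := by positivity
    have h₁ := Real.log_le_sub_one_of_pos (div_pos h1P h1Q)
    rw [Real.log_div h1P.ne' h1Q.ne'] at h₁
    have h₂ : (1 + P i * g i) / (1 + Q * g i) - 1 = (P i - Q) * (g i / (1 + Q * g i)) := by
      field_simp
      ring
    have h₃ : (P i - Q) * (g i / (1 + Q * g i)) ≤ (P i - Q) / Real.exp μ := by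
      rcases le_total (Real.exp μ - 1 / g i) 0 with hle | hle
      · have hQ' : Q = 0 := by rw [hQ, max_eq_right hle]
        rw [hQ', sub_zero, zero_mul, add_zero, div_one, div_eq_mul_inv]
        refine mul_le_mul_of_nonneg_left ?_ hPi
        rw [le_inv_comm₀ hgi hν, ← one_div]
        linarith
      · have hQ' : 1 + Q * g i = Real.exp μ * g i := by
          rw [hQ, max_eq_left hle]
          field_simp
          ring
        rw [hQ']
        refine le_of_eq ?_
        field_simp
    linarith
  have := hT.trans (Finset.sum_le_sum hle)
  rw [Finset.sum_add_distrib, h, ← Finset.sum_div, Finset.sum_sub_distrib] at this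
  by_contra hlt
  have := div_neg_of_neg_of_pos (sub_neg.2 (not_le.1 hlt)) hν
  linarith

/-! ### Medians of three -/

/-- The median of three real numbers. -/
noncomputable def med (a b c : ℝ) : ℝ :=
  if a < b then (if b < c then b else if a < c then c else a)
  else (if a < c then a else if b < c then c else b)

/-- If the median is at most `p`, so is a second one of the three numbers. Together with its mirror
image this carries rank information from medians to the original entries. -/
theorem countP_med_le (a b c p : ℝ) :
    2 * [med a b c].countP (· ≤ p) ≤ [a, b, c].countP (· ≤ p) := by
  simp only [med, List.countP_cons, List.countP_nil, decide_eq_true_eq]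
  split_ifs <;> first | omega | (exfalso; linarith)

theorem countP_le_med (a b c p : ℝ) :
    2 * [med a b c].countP (p ≤ ·) ≤ [a, b, c].countP (p ≤ ·) := by
  simp only [med, List.countP_cons, List.countP_nil, decide_eq_true_eq]
  split_ifs <;> first | omega | (exfalso; linarith)

namespace RealRAM

/-! ### Search by pruning

The procedure works on the natural variables `2, …, 8`, among them the recursion depth in
variable `2`, and on the real variables `0, …, 4`. The locals of the incarnation at depth `d` are
the cells `d` of the natural arrays `1` (base), `2` (length), `3` (`n₀`) and of the real arrays
`4` (`S₀`), `5` (`α`), `6` (`β`), `7` (threshold) and `8` (least entry above the boundary). The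
candidates are kept in the real array `3`. -/

/-- Store the median of the real variables `1`, `2`, `3` in the real variable `4`. -/
def medCmd : Cmd :=
  .ite (.realLt (.var 1) (.var 2))
    (.ite (.realLt (.var 2) (.var 3)) (.setReal 4 (.var 2))
      (.ite (.realLt (.var 1) (.var 3)) (.setReal 4 (.var 3)) (.setReal 4 (.var 1))))
    (.ite (.realLt (.var 1) (.var 3)) (.setReal 4 (.var 1))
      (.ite (.realLt (.var 2) (.var 3)) (.setReal 4 (.var 3)) (.setReal 4 (.var 2))))

/-- One median of three. -/
def thinBody : Cmd := block [
  .setReal 1 (.get 3 (.add (.var 3) (.add (.var 5) (.add (.var 5) (.var 5))))),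
  .setReal 2 (.get 3 (.add (.add (.var 3) (.add (.var 5) (.add (.var 5) (.var 5)))) (.lit 1))),
  .setReal 3 (.get 3 (.add (.add (.var 3) (.add (.var 5) (.add (.var 5) (.var 5)))) (.lit 2))),
  medCmd,
  .putReal 3 (.add (.var 8) (.var 5)) (.var 4),
  .setNat 5 (.add (.var 5) (.lit 1))]

/-- Write the medians of consecutive triples of the segment of length `4` from `3` to `8`. -/
def thin : Cmd := .seq (.setNat 5 (.lit 0))
  (.loop (.natLt (.add (.add (.var 5) (.add (.var 5) (.var 5))) (.lit 2)) (.var 4)) thinBody)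

/-- Number and sum of the candidates that are at most the pivot. -/
def countCmd : Cmd := block [
  .setNat 7 (.lit 0),
  .setReal 2 (.ofNat (.lit 0)),
  forUp 5 4 (.ite (.not (.realLt (.var 0) (.get 3 (.add (.var 3) (.var 5)))))
    (.seq (.setNat 7 (.add (.var 7) (.lit 1)))
      (.setReal 2 (.add (.var 2) (.get 3 (.add (.var 3) (.var 5))))))
    .skip)]

/-- Keep the candidates on one side of the pivot. -/
def compactCmd : Cmd := .seq (.setNat 6 (.lit 0))
  (forUp 5 4 (.ite (.realLt (.mul (.var 3) (.var 0))
      (.mul (.var 3) (.get 3 (.add (.var 3) (.var 5)))))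
    (.seq (.putReal 3 (.add (.var 3) (.var 6)) (.get 3 (.add (.var 3) (.var 5))))
      (.setNat 6 (.add (.var 6) (.lit 1))))
    .skip))

/-- Prepare the recursive call. -/
def pushCmd : Cmd := block [
  .putNat 1 (.add (.var 2) (.lit 1)) (.var 8),
  .putNat 2 (.add (.var 2) (.lit 1)) (.var 5),
  .putReal 5 (.add (.var 2) (.lit 1)) (.ofNat (.lit 0)),
  .putReal 6 (.add (.var 2) (.lit 1)) (.ofNat (.lit 1)),
  .putReal 7 (.add (.var 2) (.lit 1)) (.div (.ofNat (.var 5)) (.ofNat (.lit 2))),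
  .setNat 2 (.add (.var 2) (.lit 1))]

/-- Fetch the result of the recursive call. -/
def popCmd : Cmd := block [
  .setReal 0 (.get 8 (.var 2)),
  .setNat 2 (.sub (.var 2) (.lit 1)),
  .setNat 3 (.get 1 (.var 2)),
  .setNat 4 (.get 2 (.var 2))]

/-- Choose the pivot. -/
def pivotCmd : Cmd :=
  .ite (.natLt (.var 4) (.lit 9)) (.setReal 0 (.get 3 (.var 3))) (block [
    .setNat 8 (.add (.var 3) (.var 4)),
    thin,
    block [.setNat 3 (.var 8), .setNat 4 (.var 5), .setNat 8 (.add (.var 3) (.var 4))],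
    thin,
    pushCmd,
    .call 0,
    popCmd])

/-- Decide on which side of the boundary the pivot lies. -/
def decideCmd : Cmd :=
  .ite (.realLt
      (.add
        (.mul (.get 5 (.var 2))
          (.sub (.mul (.ofNat (.add (.get 3 (.var 2)) (.var 7))) (.var 0))
            (.add (.get 4 (.var 2)) (.var 2))))
        (.mul (.get 6 (.var 2)) (.ofNat (.add (.get 3 (.var 2)) (.var 7)))))
      (.get 7 (.var 2)))
    (block [
      .putNat 3 (.var 2) (.add (.get 3 (.var 2)) (.var 7)),
      .putReal 4 (.var 2) (.add (.get 4 (.var 2)) (.var 2)),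
      .setReal 3 (.ofNat (.lit 1))])
    (block [
      .putReal 8 (.var 2) (.var 0),
      .setReal 3 (.sub (.ofNat (.lit 0)) (.ofNat (.lit 1)))])

/-- One round of pruning. -/
def pruneCmd : Cmd := block [
  .seq (.setNat 3 (.get 1 (.var 2))) (.setNat 4 (.get 2 (.var 2))),
  pivotCmd,
  countCmd,
  decideCmd,
  compactCmd,
  .putNat 2 (.var 2) (.var 6)]

/-- The test whether there are candidates left. -/
def candidatesLeft : BExp := .natLt (.lit 0) (.get 2 (.var 2))

/-- The search procedure. -/
def searchCmd : Cmd := block [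
  .seq (.putNat 3 (.var 2) (.lit 0)) (.putReal 4 (.var 2) (.ofNat (.lit 0))),
  .loop candidatesLeft pruneCmd]

/-- What the search procedure writes to. -/
def searchFootprint : Footprint :=
  ⟨[2, 3, 4, 5, 6, 7, 8], [0, 1, 2, 3, 4], [1, 2, 3], [3, 4, 5, 6, 7, 8]⟩

/-- The list of procedures. -/
abbrev procs : List Cmd := [searchCmd]

/-! ### Specifications of the commands without recursion. -/

instance (F G : Footprint) : Decidable (F.Le G) :=
  decidable_of_iff (F.natVar ⊆ G.natVar ∧ F.realVar ⊆ G.realVar ∧ F.natArr ⊆ G.natArr ∧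
    F.realArr ⊆ G.realArr) ⟨fun h => ⟨h.1, h.2.1, h.2.2.1, h.2.2.2⟩,
      fun h => ⟨h.1, h.2, h.3, h.4⟩⟩

/-- `searchFootprint` is closed under the recursive call, as the frame rule requires. The
containment is between finite lists of names. -/
theorem procs_footprint : ∀ c ∈ procs, (c.footprint searchFootprint).Le searchFootprint := by
  decide

theorem medCmd_eff (s : Store) :
    medCmd.eff s = s.setReal 4 (med (s.realVar 1) (s.realVar 2) (s.realVar 3)) := by
  by_cases h₁ : s.realVar 1 < s.realVar 2 <;> by_cases h₂ : s.realVar 2 < s.realVar 3 <;>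
    by_cases h₃ : s.realVar 1 < s.realVar 3 <;> simp [medCmd, med, h₁, h₂, h₃]

/-- Every median on one side of `p` accounts for two entries of its triple on the same side. The at
most two entries outside of all triples can only enlarge the right-hand counts. The medians are
written behind the segment, so the candidates survive. -/
theorem thin_within (s : Store) (h : s.natVar 3 + s.natVar 4 ≤ s.natVar 8) :
    Within procs thin s (s.natVar 4 * 80 + 80) fun s' =>
      EqOff (thin.footprint searchFootprint) s s' ∧ s'.natVar 5 = s.natVar 4 / 3 ∧
      (∀ j < s.natVar 8, s'.realArr 3 j = s.realArr 3 j) ∧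
      (∀ p, 2 * (seg (s'.realArr 3) (s.natVar 8) (s.natVar 4 / 3)).countP (· ≤ p) ≤
        (seg (s.realArr 3) (s.natVar 3) (s.natVar 4)).countP (· ≤ p)) ∧
      ∀ p, 2 * (seg (s'.realArr 3) (s.natVar 8) (s.natVar 4 / 3)).countP (p ≤ ·) ≤
        (seg (s.realArr 3) (s.natVar 3) (s.natVar 4)).countP (p ≤ ·) := by
  refine Within.frame procs_footprint ?_
  refine Within.seq (t₁ := 2) (t₂ := s.natVar 4 * 80 + 78)
    (Q₁ := fun s' => s' = s.setNat 5 0) (.flat rfl le_rfl rfl) ?_ (by omega)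
  rintro _ rfl
  set l := s.natVar 4
  set d := s.natVar 8
  set b := s.natVar 3
  have key := Within.loop (procs := procs) (t := 66)
    (b := .natLt (.add (.add (.var 5) (.add (.var 5) (.var 5))) (.lit 2)) (.var 4))
    (body := thinBody)
    (Inv := fun f s' => s'.natVar 5 + f = l / 3 ∧ s'.natVar 3 = b ∧ s'.natVar 4 = l ∧
      s'.natVar 8 = d ∧ (∀ j < d, s'.realArr 3 j = s.realArr 3 j) ∧
      (∀ p, 2 * (seg (s'.realArr 3) d (s'.natVar 5)).countP (· ≤ p) ≤
        (seg (s.realArr 3) b (3 * s'.natVar 5)).countP (· ≤ p)) ∧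
      ∀ p, 2 * (seg (s'.realArr 3) d (s'.natVar 5)).countP (p ≤ ·) ≤
        (seg (s.realArr 3) b (3 * s'.natVar 5)).countP (p ≤ ·)) ?_ (l / 3) (s.setNat 5 0)
        ⟨by simp, by simp [b], by simp [l], by simp [d], by simp, by simp, by simp⟩
  · refine key.mono ?_ ?_
    · simp only [BExp.cost, NExp.cost]
      omega
    · rintro s' ⟨hn, f, hf, h3, h4, h8, hW, hc₁, hc₂⟩
      simp only [BExp.holds, NExp.eval, h4] at hn
      have h5 : s'.natVar 5 = l / 3 := by omega
      rw [h5] at hc₁ hc₂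
      have hsplit : seg (s.realArr 3) b l
          = seg (s.realArr 3) b (3 * (l / 3)) ++ seg (s.realArr 3) (b + 3 * (l / 3)) (l % 3) := by
        rw [← seg_add, Nat.div_add_mod]
      refine ⟨h5, hW, fun p => (hc₁ p).trans ?_, fun p => (hc₂ p).trans ?_⟩ <;>
      · rw [hsplit, List.countP_append]
        exact Nat.le_add_right _ _
  · rintro f s' ⟨hf, h3, h4, h8, hW, hc₁, hc₂⟩ hlt
    simp only [BExp.holds, NExp.eval, h4] at hlt
    refine ⟨f - 1, by omega, .flat rfl (by decide) ?_⟩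
    set i := s'.natVar 5 with hi
    have hread : ∀ k < 3, s'.realArr 3 (b + 3 * i + k) = s.realArr 3 (b + 3 * i + k) :=
      fun k hk => hW _ (by omega)
    have e0 : b + (i + (i + i)) = b + 3 * i + 0 := by ring
    simp only [thinBody, block, Cmd.eff, medCmd_eff, RExp.eval, NExp.eval, Store.setReal_realVar,
      Store.setReal_natVar, Store.setReal_realArr, Store.putReal_natVar,
      Store.putReal_realArr, Store.setNat_natVar, Store.setNat_realArr, h3, h4, h8, ← hi,
      e0, hread 0 (by norm_num), hread 1 (by norm_num), hread 2 (by norm_num)]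
    norm_num
    set m := med (s.realArr 3 (b + 3 * i)) (s.realArr 3 (b + 3 * i + 1))
      (s.realArr 3 (b + 3 * i + 2)) with hm
    have hseg : seg (Function.update (s'.realArr 3) (d + i) m) d (i + 1)
        = seg (s'.realArr 3) d i ++ [m] := by
      rw [seg_succ, Function.update_self]
      congr 1
      exact seg_congr fun j hj => Function.update_of_ne (by omega) _ _
    have hseg' : seg (s.realArr 3) b (3 * (i + 1)) = seg (s.realArr 3) b (3 * i) ++
        [s.realArr 3 (b + 3 * i), s.realArr 3 (b + 3 * i + 1), s.realArr 3 (b + 3 * i + 2)] := by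
      rw [show 3 * (i + 1) = 3 * i + 1 + 1 + 1 by ring, seg_succ, seg_succ, seg_succ]
      simp [add_assoc]
    rw [hseg, hseg']
    refine ⟨by omega, fun j hj => ?_, fun p => ?_, fun p => ?_⟩
    · rw [Function.update_of_ne (by omega), hW j hj]
    · rw [List.countP_append, List.countP_append, mul_add]
      exact Nat.add_le_add (hc₁ p) (countP_med_le _ _ _ p)
    · rw [List.countP_append, List.countP_append, mul_add]
      exact Nat.add_le_add (hc₂ p) (countP_le_med _ _ _ p)

theorem countCmd_within (s : Store) :
    Within procs countCmd s (s.natVar 4 * 40 + 40) fun s' =>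
      EqOff (countCmd.footprint searchFootprint) s s' ∧
      s'.natVar 7
        = (below (seg (s.realArr 3) (s.natVar 3) (s.natVar 4)) (s.realVar 0)).length ∧
      s'.realVar 2 = (below (seg (s.realArr 3) (s.natVar 3) (s.natVar 4)) (s.realVar 0)).sum := by
  refine Within.frame procs_footprint ?_
  refine Within.seq (t₁ := 2) (t₂ := s.natVar 4 * 40 + 36) (.flat rfl le_rfl rfl) ?_ (by omega)
    (Q₁ := fun s' => s' = s.setNat 7 0)
  rintro _ rfl
  refine Within.seq (t₁ := 3) (t₂ := s.natVar 4 * 40 + 30) (.flat rfl le_rfl (by simp)) ?_ (by omega)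
    (Q₁ := fun s' => s' = (s.setNat 7 0).setReal 2 0)
  rintro _ rfl
  refine (Within.forUp procs_footprint (t := 30) (n := s.natVar 4) (fun i s' =>
    s'.natVar 7 = (below (seg (s.realArr 3) (s.natVar 3) i) (s.realVar 0)).length ∧
    s'.realVar 2 = (below (seg (s.realArr 3) (s.natVar 3) i) (s.realVar 0)).sum)
    (by simp) (by decide) (by decide) (by simp [below]) ?_).mono (by omega) fun s' h => h.2
  intro k s' hk hi hE ⟨h7, h2⟩
  have h3 := hE.natVar 3 (by decide)
  have h0 := hE.realVar 0 (by decide)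
  have hW := hE.realArr 3 (by decide)
  simp only [Store.setReal_natVar, Store.setNat_natVar, Store.setReal_realVar,
    Store.setNat_realVar, Store.setReal_realArr, Store.setNat_realArr] at h3 h0 hW
  norm_num at h3 h0
  refine .flat rfl (by decide) ?_
  simp only [Cmd.eff, BExp.holds, RExp.eval, NExp.eval, h3, hi, h0, hW, seg_succ]
  split_ifs with hlt
  · simp [h7, h2, below, not_le.2 hlt]
  · rw [not_lt] at hlt
    simp [h7, h2, h3, hi, hW, below, hlt]

/-- The real variable `3` holds a sign, which lets one comparison serve for keeping either side of
the pivot. Working in place is safe because the write position never overtakes the read position;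
the last clause of the invariant records that the unread entries are intact. -/
theorem compactCmd_within (s : Store) (P : ℝ → Prop) [DecidablePred P]
    (hP : ∀ x, s.realVar 3 * s.realVar 0 < s.realVar 3 * x ↔ P x) :
    Within procs compactCmd s (s.natVar 4 * 40 + 40) fun s' =>
      EqOff (compactCmd.footprint searchFootprint) s s' ∧
      s'.natVar 6 = ((seg (s.realArr 3) (s.natVar 3) (s.natVar 4)).filter (P ·)).length ∧
      seg (s'.realArr 3) (s.natVar 3) (s'.natVar 6)
        = (seg (s.realArr 3) (s.natVar 3) (s.natVar 4)).filter (P ·) ∧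
      ∀ j < s.natVar 3, s'.realArr 3 j = s.realArr 3 j := by
  refine Within.frame procs_footprint ?_
  refine Within.seq (t₁ := 2) (t₂ := s.natVar 4 * 40 + 36) (.flat rfl le_rfl rfl) ?_ (by omega)
    (Q₁ := fun s' => s' = s.setNat 6 0)
  rintro _ rfl
  refine (Within.forUp procs_footprint (t := 30) (n := s.natVar 4) (fun i s' =>
    s'.natVar 6 ≤ i ∧
    s'.natVar 6 = ((seg (s.realArr 3) (s.natVar 3) i).filter (P ·)).length ∧
    seg (s'.realArr 3) (s.natVar 3) (s'.natVar 6)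
        = (seg (s.realArr 3) (s.natVar 3) i).filter (P ·) ∧
    (∀ j < s.natVar 3, s'.realArr 3 j = s.realArr 3 j) ∧
    ∀ j ≥ i, s'.realArr 3 (s.natVar 3 + j) = s.realArr 3 (s.natVar 3 + j))
    (by simp) (by decide) (by decide) (by simp) ?_).mono (by omega) fun s' h => h.2.2.imp_right
      fun h => ⟨h.1, h.2.1⟩
  intro k s' hk hi hE ⟨hle, h6, hseg, hlo, hhi⟩
  have h3 := hE.natVar 3 (by decide)
  have h0 := hE.realVar 0 (by decide)
  have h3' := hE.realVar 3 (by decide)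
  simp only [Store.setNat_natVar, Store.setNat_realVar] at h3 h0 h3'
  norm_num at h3
  refine .flat rfl (by decide) ?_
  simp only [Cmd.eff, BExp.holds, RExp.eval, NExp.eval, h3, hi, h0, h3', hhi k le_rfl, hP,
    seg_succ]
  split_ifs with hPx
  · simp [hPx, seg_succ, ← h6]
    refine ⟨hle, ?_, fun j hj => ?_, fun j hj => ?_⟩
    · rw [← hseg]
      exact seg_congr fun j hj => Function.update_of_ne (by omega) _ _
    · rw [Function.update_of_ne (by omega), hlo j hj]
    · rw [Function.update_of_ne (by omega), hhi j (by omega)]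
  · simp [hPx, ← h6, hseg]
    exact ⟨by omega, hlo, fun j hj => hhi j (by omega)⟩

end RealRAM

/-! ### Correctness and linear running time of the search. -/

namespace RealRAM

/-- The incarnations below depth `d` and the work array below `B` are the same in both stores. -/
structure KeepBelow (d B : ℕ) (s s' : Store) : Prop where
  depth : s'.natVar 2 = s.natVar 2
  natArr : ∀ a, ∀ e < d, s'.natArr a e = s.natArr a e
  realArr : ∀ a, a ≠ 3 → ∀ e < d, s'.realArr a e = s.realArr a e
  work : ∀ j < B, s'.realArr 3 j = s.realArr 3 j

/-- The search procedure, started in `s`, has computed its result in `s'`. -/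
structure Searched (s s' : Store) : Prop where
  keep : KeepBelow (s.natVar 2) (s.natArr 1 (s.natVar 2)) s s'
  result : IsBoundary
    (fun p => s.realArr 7 (s.natVar 2) ≤ level (s.realArr 5 (s.natVar 2))
      (s.realArr 6 (s.natVar 2))
      (seg (s.realArr 3) (s.natArr 1 (s.natVar 2)) (s.natArr 2 (s.natVar 2))) p)
    (seg (s.realArr 3) (s.natArr 1 (s.natVar 2)) (s.natArr 2 (s.natVar 2)))
    (s'.natArr 3 (s.natVar 2)) (s'.realArr 4 (s.natVar 2)) (s'.realArr 8 (s.natVar 2))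

/-- The search procedure works in time `t` on segments of length `l`. -/
def SearchWithin (l t : ℕ) : Prop :=
  ∀ s : Store, s.natArr 2 (s.natVar 2) = l → 0 ≤ s.realArr 5 (s.natVar 2) →
    0 ≤ s.realArr 6 (s.natVar 2) → Within procs (.call 0) s t (Searched s)

theorem pushCmd_eff (s : Store) :
    (pushCmd.eff s).natVar 2 = s.natVar 2 + 1 ∧
    (pushCmd.eff s).natArr 1 (s.natVar 2 + 1) = s.natVar 8 ∧
    (pushCmd.eff s).natArr 2 (s.natVar 2 + 1) = s.natVar 5 ∧
    (pushCmd.eff s).realArr 5 (s.natVar 2 + 1) = 0 ∧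
    (pushCmd.eff s).realArr 6 (s.natVar 2 + 1) = 1 ∧
    (pushCmd.eff s).realArr 7 (s.natVar 2 + 1) = s.natVar 5 / 2 ∧
    (pushCmd.eff s).realArr 3 = s.realArr 3 ∧
    (∀ a, ∀ e < s.natVar 2 + 1, (pushCmd.eff s).natArr a e = s.natArr a e) ∧
    ∀ a, ∀ e < s.natVar 2 + 1, (pushCmd.eff s).realArr a e = s.realArr a e := by
  simp [pushCmd]
  constructor
  · intro a e he
    split_ifs <;> simp_all [Function.update_of_ne (show e ≠ s.natVar 2 + 1 by omega)]
  · intro a e he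
    split_ifs <;> simp_all [Function.update_of_ne (show e ≠ s.natVar 2 + 1 by omega)]

theorem popCmd_eff (s : Store) (d : ℕ) (h : s.natVar 2 = d + 1) :
    (popCmd.eff s).natVar 2 = d ∧ (popCmd.eff s).realVar 0 = s.realArr 8 (d + 1) ∧
    (popCmd.eff s).natVar 3 = s.natArr 1 d ∧ (popCmd.eff s).natVar 4 = s.natArr 2 d ∧
    (popCmd.eff s).natArr = s.natArr ∧ (popCmd.eff s).realArr = s.realArr := by
  simp [popCmd, h]

/-- At least half of the `l / 9` twice-thinned medians lie weakly on each side of their median, and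
each of them stands for four candidates; this gives `2 * (l / 9)`. For `l < 9` that bound is void
and any candidate serves as the pivot. The recursive call uses the next depth and the work array
behind the candidates, so nothing that is still needed is lost. -/
theorem pivotCmd_within (s : Store) {l t : ℕ} (hl : 0 < l)
    (h3 : s.natVar 3 = s.natArr 1 (s.natVar 2)) (h4 : s.natVar 4 = l)
    (hl' : s.natArr 2 (s.natVar 2) = l) (ht : 9 ≤ l → SearchWithin (l / 9) t) :
    Within procs pivotCmd s (160 * l + 300 + t) fun s' =>
      KeepBelow (s.natVar 2 + 1) (s.natVar 3 + l) s s' ∧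
      s'.natVar 3 = s.natVar 3 ∧ s'.natVar 4 = l ∧
      (1 ≤ (seg (s.realArr 3) (s.natVar 3) l).countP (· ≤ s'.realVar 0) ∧
        2 * (l / 9) ≤ (seg (s.realArr 3) (s.natVar 3) l).countP (· ≤ s'.realVar 0)) ∧
      (1 ≤ (seg (s.realArr 3) (s.natVar 3) l).countP (s'.realVar 0 ≤ ·) ∧
        2 * (l / 9) ≤ (seg (s.realArr 3) (s.natVar 3) l).countP (s'.realVar 0 ≤ ·)) := by
  refine Within.ite (t₁ := 160 * l + 290 + t) ?_ ?_ (by simp only [BExp.cost, NExp.cost]; omega)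
  · intro hlt
    simp only [BExp.holds, NExp.eval, h4] at hlt
    refine .flat rfl (by simp only [Cmd.time, RExp.cost, NExp.cost]; omega) ?_
    have hmem : s.realArr 3 (s.natVar 3) ∈ seg (s.realArr 3) (s.natVar 3) l :=
      mem_seg.2 ⟨0, hl, rfl⟩
    simp only [Cmd.eff, RExp.eval, NExp.eval, Store.setReal_natVar, Store.setReal_realVar, if_true,
      h4, Nat.div_eq_of_lt hlt, mul_zero, zero_le, and_true, true_and, Nat.one_le_iff_ne_zero,
      ← Nat.pos_iff_ne_zero, List.countP_pos_iff]
    exact ⟨⟨rfl, fun _ _ _ => rfl, fun _ _ _ _ => rfl, fun _ _ => rfl⟩, ⟨_, hmem, by simp⟩,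
      ⟨_, hmem, by simp⟩⟩
  · intro hge
    simp only [BExp.holds, NExp.eval, h4, not_lt] at hge
    have ht := ht hge
    have hq : l / 3 / 3 = l / 9 := Nat.div_div_eq_div_mul _ _ _
    set b := s.natVar 3 with hb
    set d := s.natVar 2 with hd
    simp only [block]
    refine Within.seq (t₁ := 4) (Q₁ := fun s₁ => s₁ = s.setNat 8 (b + l))
      (.flat rfl le_rfl (by simp [← hb, h4])) ?_ (t₂ := 160 * l + 286 + t) (by omega)
    rintro _ rfl
    refine (thin_within _ (by simp [← hb, h4])).seq (t₂ := 80 * l + 206 + t) ?_ (by simp [h4]; omega)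
    rintro s₁ ⟨hE, h5₁, hW₁, hle₁, hge₁⟩
    simp [h4, ← hb] at h5₁ hW₁ hle₁ hge₁
    have hd₁ : s₁.natVar 2 = d := by rw [hE.natVar 2 (by decide)]; simp [← hd]
    have h8₁ : s₁.natVar 8 = b + l := by rw [hE.natVar 8 (by decide)]; simp
    have hn₁ : s₁.natArr = s.natArr := funext fun a => hE.natArr a (by simp [thin, thinBody,
      medCmd, Cmd.footprint, Footprint.union])
    have hr₁ : ∀ a, a ≠ 3 → s₁.realArr a = s.realArr a := fun a ha => hE.realArr a (by
      simpa [thin, thinBody, medCmd, Cmd.footprint, Footprint.union] using ha)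
    refine Within.seq (t₁ := 8) (t₂ := 80 * l + 198 + t) (Q₁ := fun s₂ => s₂.natVar 2 = d ∧
        s₂.natVar 3 = b + l ∧ s₂.natVar 4 = l / 3 ∧ s₂.natVar 8 = b + l + l / 3 ∧
        s₂.natArr = s₁.natArr ∧ s₂.realArr = s₁.realArr)
      (.flat rfl le_rfl (by simp [hd₁, h8₁, h5₁])) ?_ (by omega)
    rintro s₂ ⟨hd₂, h3₂, h4₂, h8₂, hn₂, hr₂⟩
    refine (thin_within s₂ (by omega)).seq (t₂ := 118 + t) ?_ (by omega)
    rintro s₃ ⟨hE', h5₃, hW₃, hle₃, hge₃⟩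
    rw [h3₂, h4₂, h8₂, hq, hr₂] at hle₃ hge₃
    rw [h4₂, hq] at h5₃
    rw [h8₂, hr₂] at hW₃
    have hd₃ : s₃.natVar 2 = d := by rw [hE'.natVar 2 (by decide), hd₂]
    have h8₃ : s₃.natVar 8 = b + l + l / 3 := by rw [hE'.natVar 8 (by decide), h8₂]
    have hn₃ : s₃.natArr = s.natArr := (funext fun a => hE'.natArr a (by simp [thin, thinBody,
      medCmd, Cmd.footprint, Footprint.union])).trans (hn₂.trans hn₁)
    have hr₃ : ∀ a, a ≠ 3 → s₃.realArr a = s.realArr a := fun a ha => (hE'.realArr a (by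
      simpa [thin, thinBody, medCmd, Cmd.footprint, Footprint.union] using ha)).trans
      (by rw [hr₂, hr₁ a ha])
    refine Within.seq (t₁ := pushCmd.time) (t₂ := 80 + t)
      (Q₁ := fun s₄ => s₄ = pushCmd.eff s₃) (.flat rfl le_rfl rfl) ?_
      (by have : pushCmd.time ≤ 38 := by decide
          omega)
    rintro _ rfl
    obtain ⟨p2, pB, pL, pα, pβ, pT, pW, pn, pr⟩ := pushCmd_eff s₃
    rw [hd₃] at p2 pB pL pα pβ pT pn pr
    set s₄ := pushCmd.eff s₃
    rw [h8₃] at pB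
    rw [h5₃] at pL pT
    refine (ht s₄ (by rw [p2, pL]) (by rw [p2, pα]) (by rw [p2, pβ]; exact zero_le_one)).seq
      (t₂ := 80) ?_ (by omega)
    rintro s₅ ⟨hK, hR⟩
    rw [p2, pB] at hK
    rw [p2, pB, pL, pα, pβ, pT, pW] at hR
    obtain ⟨q2, q0, q3, q4, qn, qr⟩ := popCmd_eff s₅ d (by rw [hK.depth, p2])
    refine .flat rfl (by decide) ?_
    set s₆ := popCmd.eff s₅
    set med9 := seg (s₃.realArr 3) (b + l + l / 3) (l / 9) with hmed9
    have hlen : med9.length = l / 9 := length_seg _ _ _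
    have hmed := IsBoundary.median (l := med9) (fun h => by
      rw [h] at hlen
      simp at hlen
      omega) (by rw [hlen]; exact hR)
    rw [hlen] at hmed
    -- Each of the two rounds of thinning contributes a factor 2, and the median property a factor
    -- 1/2.
    have c₁ := hle₁ (s₅.realArr 8 (d + 1))
    have c₂ := hge₁ (s₅.realArr 8 (d + 1))
    have c₃ := hle₃ (s₅.realArr 8 (d + 1))
    have c₄ := hge₃ (s₅.realArr 8 (d + 1))
    refine ⟨⟨by rw [q2], fun a e he => ?_, fun a ha e he => ?_, fun j hj => ?_⟩, ?_, ?_, ?_⟩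
    · rw [qn, hK.natArr a e he, pn a e he, hn₃]
    · rw [qr, hK.realArr a ha e he, pr a e he, hr₃ a ha]
    · rw [qr, hK.work j (by omega), pW, hW₃ j (by omega), hW₁ j (by omega)]
    · rw [q3, hK.natArr 1 d (by omega), pn 1 d (by omega), hn₃, h3]
    · rw [q4, hK.natArr 2 d (by omega), pn 2 d (by omega), hn₃, hl']
    · rw [q0]
      constructor <;> constructor <;> omega

/-- The quantity that is compared with the threshold is the `level` of the whole list at the pivot:
`Boundary.below_length` and `Boundary.below_sum` recover it from the recorded values and the
remaining candidates. -/
theorem decideCmd_within (s : Store) :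
    Within procs decideCmd s 100 fun s' =>
      s'.natVar = s.natVar ∧ s'.realVar 0 = s.realVar 0 ∧
      (∀ a e, (a = 3 → e ≠ s.natVar 2) → s'.natArr a e = s.natArr a e) ∧
      (∀ a e, (a = 4 ∨ a = 8 → e ≠ s.natVar 2) → s'.realArr a e = s.realArr a e) ∧
      ((s.realArr 5 (s.natVar 2) * (((s.natArr 3 (s.natVar 2) + s.natVar 7 : ℕ) : ℝ) * s.realVar 0
            - (s.realArr 4 (s.natVar 2) + s.realVar 2))
          + s.realArr 6 (s.natVar 2) * ((s.natArr 3 (s.natVar 2) + s.natVar 7 : ℕ) : ℝ)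
          < s.realArr 7 (s.natVar 2) ∧ s'.realVar 3 = 1 ∧
        s'.natArr 3 (s.natVar 2) = s.natArr 3 (s.natVar 2) + s.natVar 7 ∧
        s'.realArr 4 (s.natVar 2) = s.realArr 4 (s.natVar 2) + s.realVar 2 ∧
        s'.realArr 8 (s.natVar 2) = s.realArr 8 (s.natVar 2)) ∨
      (s.realArr 7 (s.natVar 2) ≤
          s.realArr 5 (s.natVar 2) * (((s.natArr 3 (s.natVar 2) + s.natVar 7 : ℕ) : ℝ) * s.realVar 0
            - (s.realArr 4 (s.natVar 2) + s.realVar 2))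
          + s.realArr 6 (s.natVar 2) * ((s.natArr 3 (s.natVar 2) + s.natVar 7 : ℕ) : ℝ) ∧
        s'.realVar 3 = -1 ∧
        s'.natArr 3 (s.natVar 2) = s.natArr 3 (s.natVar 2) ∧
        s'.realArr 4 (s.natVar 2) = s.realArr 4 (s.natVar 2) ∧
        s'.realArr 8 (s.natVar 2) = s.realVar 0)) := by
  refine .flat rfl (by decide) ?_
  rw [decideCmd, Cmd.eff]
  split_ifs with h
  · refine ⟨rfl, rfl, fun a e h => ?_, fun a e h => ?_, .inl ⟨h, ?_⟩⟩
    · by_cases ha : a = 3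
      · simp [ha, h ha]
      · simp [ha]
    · by_cases ha : a = 4
      · simp [ha, h (.inl ha)]
      · simp [ha]
    · simp
  · refine ⟨rfl, rfl, fun a e h => ?_, fun a e h => ?_, .inr ⟨not_lt.1 h, ?_⟩⟩
    · simp
    · by_cases ha : a = 8
      · simp [ha, h (.inr ha)]
      · simp [ha]
    · simp

/-- The invariant of the pruning loop; `s₀` is the store in which it was started. -/
structure Pruning (s₀ s : Store) : Prop where
  keep : KeepBelow (s₀.natVar 2) (s₀.natArr 1 (s₀.natVar 2)) s₀ s
  base : s.natArr 1 (s₀.natVar 2) = s₀.natArr 1 (s₀.natVar 2)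
  weight₁ : s.realArr 5 (s₀.natVar 2) = s₀.realArr 5 (s₀.natVar 2)
  weight₂ : s.realArr 6 (s₀.natVar 2) = s₀.realArr 6 (s₀.natVar 2)
  threshold : s.realArr 7 (s₀.natVar 2) = s₀.realArr 7 (s₀.natVar 2)
  boundary : Boundary
    (fun p => s₀.realArr 7 (s₀.natVar 2) ≤ level (s₀.realArr 5 (s₀.natVar 2))
      (s₀.realArr 6 (s₀.natVar 2))
      (seg (s₀.realArr 3) (s₀.natArr 1 (s₀.natVar 2)) (s₀.natArr 2 (s₀.natVar 2))) p)
    (seg (s₀.realArr 3) (s₀.natArr 1 (s₀.natVar 2)) (s₀.natArr 2 (s₀.natVar 2)))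
    (seg (s.realArr 3) (s₀.natArr 1 (s₀.natVar 2)) (s.natArr 2 (s₀.natVar 2)))
    (s.natArr 3 (s₀.natVar 2)) (s.realArr 4 (s₀.natVar 2)) (s.realArr 8 (s₀.natVar 2))

theorem length_filter_add_countP (l : List ℝ) (p q : ℝ → Prop) [DecidablePred p]
    [DecidablePred q] (h : ∀ x, p x ↔ ¬ q x) :
    (l.filter (p ·)).length + l.countP (q ·) = l.length := by
  induction l with
  | nil => rfl
  | cons x l ih =>
    by_cases hx : q x
    · simp [h, hx] at ih ⊢
      omega
    · simp [h, hx] at ih ⊢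
      omega

/-- There are candidates weakly on both sides of the pivot, which is what allows its level to be
computed from the candidates alone. The discarded side includes ties with the pivot, so the counts
of `pivotCmd_within` bound the progress from below in either case. -/
theorem pruneCmd_within {s₀ s : Store} (hα : 0 ≤ s₀.realArr 5 (s₀.natVar 2))
    (hβ : 0 ≤ s₀.realArr 6 (s₀.natVar 2)) (h : Pruning s₀ s) {l t : ℕ} (hl : 0 < l)
    (hl' : s.natArr 2 (s₀.natVar 2) = l) (ht : 9 ≤ l → SearchWithin (l / 9) t) :
    Within procs pruneCmd s (240 * l + 500 + t) fun s' => Pruning s₀ s' ∧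
      s'.natArr 2 (s₀.natVar 2) + 1 ≤ l ∧ s'.natArr 2 (s₀.natVar 2) + 2 * (l / 9) ≤ l := by
  obtain ⟨hK, hb, h5, h6, h7, hB⟩ := h
  have hd := hK.depth
  set d := s₀.natVar 2 with hd0
  set b := s₀.natArr 1 d with hb0
  set L := seg (s₀.realArr 3) b (s₀.natArr 2 d) with hL
  set C := seg (s.realArr 3) b l with hC
  rw [hl'] at hB
  have hmono : ∀ x y, x ≤ y →
      s₀.realArr 7 d ≤ level (s₀.realArr 5 d) (s₀.realArr 6 d) L x →
      s₀.realArr 7 d ≤ level (s₀.realArr 5 d) (s₀.realArr 6 d) L y :=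
    fun x y hxy hx => hx.trans (level_mono hα hβ L hxy)
  simp only [pruneCmd, block]
  refine Within.seq (t₁ := 8) (Q₁ := fun s₁ => s₁ = (s.setNat 3 b).setNat 4 l)
    (.flat rfl (by decide) (by simp [hd, hb, hl'])) ?_ (t₂ := 240 * l + 490 + t) (by omega)
  rintro _ rfl
  refine (pivotCmd_within (l := l) (t := t) _ hl (by simp [hd, hb]) (by simp) (by simp [hd, hl'])
    ht).seq (t₂ := 80 * l + 190) ?_ (by omega)
  rintro s₁ ⟨hK₁, h3₁, h4₁, hle, hge⟩
  simp [hd, ← hC] at hK₁ h3₁ hle hge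
  have hn₁ : ∀ a, s₁.natArr a d = s.natArr a d := fun a => hK₁.natArr a d (by omega)
  have hr₁ : ∀ a, a ≠ 3 → s₁.realArr a d = s.realArr a d :=
    fun a ha => hK₁.realArr a ha d (by omega)
  have hd₁ : s₁.natVar 2 = d := by simpa [hd] using hK₁.depth
  have hC₁ : seg (s₁.realArr 3) b l = C := seg_congr fun i hi => hK₁.work _ (by omega)
  set p := s₁.realVar 0 with hp
  refine (countCmd_within s₁).seq (t₂ := 40 * l + 150) ?_ (by rw [h4₁]; omega)
  rintro s₂ ⟨hE₂, h7₂, hσ₂⟩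
  rw [h3₁, h4₁, hC₁, ← hp] at h7₂ hσ₂
  have hd₂ : s₂.natVar 2 = d := by rw [hE₂.natVar 2 (by decide), hd₁]
  have h3₂ : s₂.natVar 3 = b := by rw [hE₂.natVar 3 (by decide), h3₁]
  have h4₂ : s₂.natVar 4 = l := by rw [hE₂.natVar 4 (by decide), h4₁]
  have h0₂ : s₂.realVar 0 = p := by rw [hE₂.realVar 0 (by decide)]
  have hn₂ : s₂.natArr = s₁.natArr := funext fun a => hE₂.natArr a (by
    simp [countCmd, forUp, Cmd.footprint, Footprint.union])
  have hr₂ : s₂.realArr = s₁.realArr := funext fun a => hE₂.realArr a (by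
    simp [countCmd, forUp, Cmd.footprint, Footprint.union])
  refine (decideCmd_within s₂).seq (t₂ := 40 * l + 50) ?_ (by omega)
  rintro s₃ ⟨hv₃, h0₃, hn₃, hr₃, hdec⟩
  rw [h0₂] at h0₃
  rw [hd₂] at hn₃ hr₃
  rw [hd₂, h0₂, hn₂, hr₂, hn₁, hr₁ 4 (by norm_num), hr₁ 5 (by norm_num), hr₁ 6 (by norm_num),
    hr₁ 7 (by norm_num), hr₁ 8 (by norm_num), h7₂, hσ₂, h5, h6, h7] at hdec
  obtain ⟨x, hx, hxp⟩ := hle.1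
  obtain ⟨y, hy, hpy⟩ := hge.1
  have hpos₁ : 0 < C.countP (· ≤ p) := List.countP_pos_iff.2 ⟨x, hx, by simpa using hxp⟩
  have hpos₂ : 0 < C.countP (p ≤ ·) := List.countP_pos_iff.2 ⟨y, hy, by simpa using hpy⟩
  have hlen := hB.below_length p ⟨x, hx, hxp⟩ ⟨y, hy, hpy⟩
  have hsum := hB.below_sum p ⟨x, hx, hxp⟩ ⟨y, hy, hpy⟩
  have hC₃ : seg (s₃.realArr 3) b l = C := by
    rw [← hC₁]
    exact seg_congr fun i hi => by rw [hr₃ _ _ (by simp), hr₂]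
  have hlenC : C.length = l := length_seg _ _ _
  -- The end of the round is the same in both cases, with `P` the strict side of the pivot that is
  -- kept.
  have finish : ∀ (P : ℝ → Prop) [DecidablePred P],
      (∀ x, s₃.realVar 3 * s₃.realVar 0 < s₃.realVar 3 * x ↔ P x) →
      Boundary (fun p => s₀.realArr 7 d ≤ level (s₀.realArr 5 d) (s₀.realArr 6 d) L p) L
        (C.filter (P ·)) (s₃.natArr 3 d) (s₃.realArr 4 d) (s₃.realArr 8 d) →
      (C.filter (P ·)).length + 1 ≤ l → (C.filter (P ·)).length + 2 * (l / 9) ≤ l →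
      Within procs (.seq compactCmd (.putNat 2 (.var 2) (.var 6))) s₃ (40 * l + 50) fun s' =>
        Pruning s₀ s' ∧ s'.natArr 2 d + 1 ≤ l ∧ s'.natArr 2 d + 2 * (l / 9) ≤ l := by
    intro P _ hP hBP hl₁ hl₂
    refine (compactCmd_within s₃ P hP).seq (t₂ := 5) ?_ (by rw [hv₃, h4₂]; omega)
    rintro s₄ ⟨hE₄, h6₄, hseg, hW₄⟩
    rw [hv₃, h3₂, h4₂, hC₃] at h6₄ hseg
    rw [hv₃, h3₂] at hW₄
    have hd₄ : s₄.natVar 2 = d := by rw [hE₄.natVar 2 (by decide), hv₃, hd₂]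
    have hn₄ : s₄.natArr = s₃.natArr := funext fun a => hE₄.natArr a (by
      simp [compactCmd, forUp, Cmd.footprint, Footprint.union])
    have hr₄ : ∀ a, a ≠ 3 → s₄.realArr a = s₃.realArr a := fun a ha => hE₄.realArr a (by
      simpa [compactCmd, forUp, Cmd.footprint, Footprint.union] using ha)
    refine .flat rfl (by decide) ?_
    have e₁ : ∀ a, ∀ e < d, s₃.natArr a e = s₀.natArr a e := fun a e he => by
      rw [hn₃ a e (by omega), hn₂, hK₁.natArr a e (by omega)]
      exact hK.natArr a e he
    have e₂ : ∀ a, a ≠ 3 → ∀ e < d, s₃.realArr a e = s₀.realArr a e := fun a ha e he => by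
      rw [hr₃ a e (by omega), hr₂, hK₁.realArr a ha e (by omega)]
      exact hK.realArr a ha e he
    simp only [Cmd.eff, NExp.eval, hd₄, h6₄]
    refine ⟨⟨⟨by simp [hd₄, hd0], fun a e he => ?_, fun a ha e he => ?_, fun j hj => ?_⟩, ?_, ?_,
      ?_, ?_, ?_⟩, ?_, ?_⟩
    · simp only [Store.putNat_natArr, hn₄]
      split_ifs
      · rw [Function.update_of_ne (by omega), e₁ a e he]
      · exact e₁ a e he
    · simp only [Store.putNat_realArr, hr₄ a ha, e₂ a ha e he]
    · simp only [Store.putNat_realArr]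
      rw [hW₄ j hj, hr₃ _ _ (by simp), hr₂, hK₁.work j (Nat.lt_add_right l hj)]
      exact hK.work j hj
    · simp only [Store.putNat_natArr, hn₄]
      rw [if_neg (by norm_num), hn₃ _ _ (by simp), hn₂, hn₁, hb]
    · simp only [Store.putNat_realArr]
      rw [hr₄ _ (by norm_num), hr₃ _ _ (by simp), hr₂, hr₁ _ (by norm_num), h5]
    · simp only [Store.putNat_realArr]
      rw [hr₄ _ (by norm_num), hr₃ _ _ (by simp), hr₂, hr₁ _ (by norm_num), h6]
    · simp only [Store.putNat_realArr]
      rw [hr₄ _ (by norm_num), hr₃ _ _ (by simp), hr₂, hr₁ _ (by norm_num), h7]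
    · simp [hn₄, hr₄, ← hd0, ← hb0, ← h6₄, hseg]
      exact hBP
    · simpa using hl₁
    · simpa using hl₂
  rcases hdec with ⟨hlt, h3₃, hn, hS, ho⟩ | ⟨hge', h3₃, hn, hS, ho⟩
  · have := length_filter_add_countP C (p < ·) (· ≤ p) (fun x => not_le.symm)
    refine finish (p < ·) (fun x => by rw [h3₃, h0₃, one_mul, one_mul]) ?_ (by omega) (by omega)
    rw [hn, hS, ho]
    rw [← hlen, ← hsum] at hlt
    exact hB.right hmono (not_le.2 hlt)
  · have := length_filter_add_countP C (· < p) (p ≤ ·) (fun x => not_le.symm)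
    refine finish (· < p) (fun x => by rw [h3₃, h0₃]; constructor <;> intro h <;> linarith) ?_
      (by omega) (by omega)
    rw [hn, hS, ho]
    rw [← hlen, ← hsum] at hge'
    exact hB.left hmono hge' ⟨y, hy, hpy⟩

/-- A round on `l` candidates removes at least `max 1 (2 * (l / 9))` of them. At 5000 steps per
removed candidate, half of `2 * (l / 9)` pays for the recursive call on `l / 9` entries and the
other half for the `240 * l + 500` steps of the round. For `l < 9` a single removed candidate
suffices. Since rounds have different costs, the induction is on `l`. -/
theorem pruneLoop_within {l : ℕ} {s₀ s : Store} (hα : 0 ≤ s₀.realArr 5 (s₀.natVar 2))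
    (hβ : 0 ≤ s₀.realArr 6 (s₀.natVar 2)) (h : Pruning s₀ s)
    (hl : s.natArr 2 (s₀.natVar 2) = l)
    (ht : ∀ q, 9 * q ≤ l → 0 < q → SearchWithin q (5000 * q + 20)) :
    Within procs (.loop candidatesLeft pruneCmd) s (5000 * l + 10) (Searched s₀) := by
  induction l using Nat.strong_induction_on generalizing s with
  | _ l ih =>
    have hd := h.keep.depth
    rcases Nat.eq_zero_or_pos l with rfl | hpos
    · refine .loop_done (by simp [candidatesLeft, hd, hl])
        ⟨h.keep, ?_⟩ (by simp [candidatesLeft, BExp.cost, NExp.cost])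
      refine Boundary.isBoundary ?_
      have := h.boundary
      rwa [hl, seg_zero] at this
    · refine .loop_step (t₂ := 5000 * (l - max 1 (2 * (l / 9))) + 10)
        (by simp [candidatesLeft, hd, hl, hpos])
        (pruneCmd_within (t := 5000 * (l / 9) + 20) hα hβ h hpos hl
          fun h9 => ht _ (by omega) (by omega)) ?_ ?_
      · rintro s' ⟨h', h₁, h₂⟩
        refine (ih _ (by omega) h' rfl fun q hq => ht q (by omega)).mono ?_ fun _ h => h
        omega
      · simp only [candidatesLeft, BExp.cost, NExp.cost]
        omega

/-- The search procedure takes linear time. -/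
theorem searchWithin (l : ℕ) : SearchWithin l (5000 * l + 20) := by
  induction l using Nat.strong_induction_on with
  | _ l ih =>
    intro s hl hα hβ
    refine Within.call (c := searchCmd) rfl (t₁ := 5000 * l + 19) ?_ le_rfl
    refine Within.seq (t₁ := 8) (t₂ := 5000 * l + 10)
      (Q₁ := fun s₁ => s₁ = (s.putNat 3 (s.natVar 2) 0).putReal 4 (s.natVar 2) 0)
      (.flat rfl (by decide) (by simp)) ?_ (by omega)
    rintro _ rfl
    refine pruneLoop_within (s₀ := s) hα hβ ?_ (by simp [hl])
      fun q hq hpos => ih q (by omega)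
    constructor
    · constructor
      · simp
      · intro a e he
        simp only [Store.putReal_natArr, Store.putNat_natArr]
        split_ifs <;> simp [Function.update_of_ne he.ne]
      · intro a ha e he
        simp only [Store.putReal_realArr, Store.putNat_realArr]
        split_ifs <;> simp [Function.update_of_ne he.ne]
      · simp
    · simp
    · simp
    · simp
    · simp
    · simpa using Boundary.init _ _ _

end RealRAM

namespace RealRAM

/-! ### The table of block costs

Natural variables `0`, `1`, `10` hold `M`, `N` and the block length, `12` points to the gains of
the block, `13` to the table cell, and `14`, `15` are the user and the block. The costs are
written to the real array `9`, the water levels to the real array `10`. -/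

/-- Prepare the search for the water level. -/
def levelInput : Cmd := block [
  .setNat 2 (.lit 0),
  .putNat 1 (.lit 0) (.lit 0),
  .putNat 2 (.lit 0) (.var 10),
  .putReal 5 (.lit 0) (.ofNat (.lit 1)),
  .putReal 6 (.lit 0) (.ofNat (.lit 0)),
  .putReal 7 (.lit 0) (.mul (.get 1 (.var 14)) (.log (.ofNat (.lit 2))))]

/-- Copy the negative logarithms of the gains of a block to the work array. -/
def copyCmd : Cmd :=
  forUp 16 10 (.putReal 3 (.var 16)
    (.sub (.ofNat (.lit 0)) (.log (.get 0 (.add (.var 12) (.var 16))))))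

/-- Add up the powers for a block. -/
def blockCost : Cmd :=
  forUp 16 10 (.seq
    (.setReal 7 (.sub (.var 5) (.div (.ofNat (.lit 1)) (.get 0 (.add (.var 12) (.var 16))))))
    (.ite (.realLt (.ofNat (.lit 0)) (.var 7)) (.setReal 6 (.add (.var 6) (.var 7))) .skip))

/-- Compute one entry of the table. -/
def cellCmd : Cmd := block [
  copyCmd,
  levelInput,
  .call 0,
  .seq (.setReal 5 (.exp (.div
      (.add (.mul (.get 1 (.var 14)) (.log (.ofNat (.lit 2)))) (.get 4 (.lit 0)))
      (.ofNat (.get 3 (.lit 0))))))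
    (.setReal 6 (.ofNat (.lit 0))),
  blockCost,
  block [
    .putReal 9 (.var 13) (.var 6),
    .putReal 10 (.var 13) (.var 5),
    .setNat 12 (.add (.var 12) (.var 10)),
    .setNat 13 (.add (.var 13) (.lit 1))]]

/-- Compute the table. -/
def tableCmd : Cmd := block [
  .setNat 12 (.lit 0),
  .setNat 13 (.add (.var 0) (.lit 1)),
  forUp 14 0 (forUp 15 0 cellCmd)]

/-- The least power for a block at water level `ν`. -/
noncomputable def fillPower (g : ℕ → ℝ) (b K : ℕ) (ν : ℝ) : ℝ :=
  ∑ i ∈ Finset.range K, max (ν - 1 / g (b + i)) 0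

/-- The water level `ν` gives the rate `T` on the channels `b, …, b + K - 1`. -/
def IsLevel (g : ℕ → ℝ) (b K : ℕ) (T ν : ℝ) : Prop :=
  ∃ μ, ν = Real.exp μ ∧ ∑ i ∈ Finset.range K, max (μ - -Real.log (g (b + i))) 0 = T

/-! ### Correctness of the table of block costs. -/

theorem sum_map_seg (f h : ℕ → ℝ) (F : ℝ → ℝ) (b l : ℕ) (hf : ∀ i < l, f (b + i) = h i) :
    ((seg f b l).map F).sum = ∑ i ∈ Finset.range l, F (h i) := by
  induction l with
  | zero => simp
  | succ l ih =>
    rw [seg_succ, List.map_append, List.sum_append, ih fun i hi => hf i (by omega),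
      Finset.sum_range_succ]
    simp [hf l (by omega)]

theorem copyCmd_within (s : Store) :
    Within procs copyCmd s (s.natVar 10 * 28 + 6) fun s' =>
      EqOff (copyCmd.footprint searchFootprint) s s' ∧
      ∀ i < s.natVar 10, s'.realArr 3 i = -Real.log (s.realArr 0 (s.natVar 12 + i)) := by
  refine (Within.forUp procs_footprint (t := 20) (n := s.natVar 10) (fun i s' =>
    ∀ i' < i, s'.realArr 3 i' = -Real.log (s.realArr 0 (s.natVar 12 + i')))
    rfl (by decide) (by decide) (by simp) ?_).mono le_rfl fun s' h => h
  intro k s' hk hi hE hI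
  have h12 := hE.natVar 12 (by decide)
  have h0 := hE.realArr 0 (by decide)
  refine .flat rfl (by decide) ?_
  intro i' hi'
  simp [hi, h12, h0, Function.update_apply]
  split_ifs with hik
  · rw [hik]
  · exact hI i' (by omega)

theorem blockCost_within (s : Store) (h6 : s.realVar 6 = 0) :
    Within procs blockCost s (s.natVar 10 * 38 + 6) fun s' =>
      EqOff (blockCost.footprint searchFootprint) s s' ∧
      s'.realVar 6 = fillPower (s.realArr 0) (s.natVar 12) (s.natVar 10) (s.realVar 5) := by
  refine (Within.forUp procs_footprint (t := 30) (n := s.natVar 10) (fun i s' =>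
    s'.realVar 6 = fillPower (s.realArr 0) (s.natVar 12) i (s.realVar 5))
    rfl (by decide) (by decide) (by simp [fillPower, h6]) ?_).mono le_rfl fun s' h => h
  intro k s' hk hi hE hI
  have h12 := hE.natVar 12 (by decide)
  have h0 := hE.realArr 0 (by decide)
  have h5 := hE.realVar 5 (by decide)
  refine .flat rfl (by decide) ?_
  simp only [Cmd.eff, BExp.holds, RExp.eval, NExp.eval, Store.setReal_realVar, if_true, hi, h12,
    h0, h5, Nat.cast_zero, Nat.cast_one, fillPower, Finset.sum_range_succ] at hI ⊢
  rcases lt_or_ge 0 (s.realVar 5 - 1 / s.realArr 0 (s.natVar 12 + k)) with h | h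
  · rw [if_pos h, max_eq_left h.le]
    simp [hI]
  · rw [if_neg (not_lt.2 h), max_eq_right h]
    simp [hI]

/-- The search runs at depth 0 on the values `-log g` with weights `(1, 0)` and threshold `R log 2`.
From its count and sum, `IsBoundary.excess_level` yields `μ`, and the stored level is `exp μ`; no
iteration on real numbers is involved. -/
theorem cellCmd_within (s : Store) (hK : 0 < s.natVar 10)
    (hT : 0 < s.realArr 1 (s.natVar 14)) :
    Within procs cellCmd s (5500 * s.natVar 10) fun s' =>
      EqOff (cellCmd.footprint searchFootprint) s s' ∧
      s'.natVar 12 = s.natVar 12 + s.natVar 10 ∧ s'.natVar 13 = s.natVar 13 + 1 ∧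
      ∃ ν, IsLevel (s.realArr 0) (s.natVar 12) (s.natVar 10)
          (s.realArr 1 (s.natVar 14) * Real.log 2) ν ∧
        s'.realArr 10 = Function.update (s.realArr 10) (s.natVar 13) ν ∧
        s'.realArr 9 = Function.update (s.realArr 9) (s.natVar 13)
          (fillPower (s.realArr 0) (s.natVar 12) (s.natVar 10) ν) := by
  refine Within.frame procs_footprint ?_
  set K := s.natVar 10 with hK0
  set b := s.natVar 12 with hb0
  set c := s.natVar 13 with hc0
  set T := s.realArr 1 (s.natVar 14) * Real.log 2 with hT0
  have hTpos : 0 < T := mul_pos hT (Real.log_pos one_lt_two)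
  simp only [cellCmd, block]
  refine (copyCmd_within s).seq (t₂ := 5060 * K + 200) ?_ (by omega)
  rintro s₁ ⟨hE₁, hW₁⟩
  rw [← hK0, ← hb0] at hW₁
  have a₁ : s₁.natVar 10 = K := hE₁.natVar 10 (by decide)
  have b₁ : s₁.natVar 12 = b := hE₁.natVar 12 (by decide)
  have c₁ : s₁.natVar 13 = c := hE₁.natVar 13 (by decide)
  have d₁ : s₁.natVar 14 = s.natVar 14 := hE₁.natVar 14 (by decide)
  have r0₁ : s₁.realArr 0 = s.realArr 0 := hE₁.realArr 0 (by decide)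
  have r1₁ : s₁.realArr 1 = s.realArr 1 := hE₁.realArr 1 (by decide)
  have r9₁ : s₁.realArr 9 = s.realArr 9 := hE₁.realArr 9 (by decide)
  have r10₁ : s₁.realArr 10 = s.realArr 10 := hE₁.realArr 10 (by decide)
  refine Within.seq (t₁ := 40) (t₂ := 5060 * K + 160) (Q₁ := fun s₂ => s₂ = levelInput.eff s₁)
    (.flat rfl (by decide) rfl) ?_ (by omega)
  rintro _ rfl
  set s₂ := levelInput.eff s₁ with hs₂
  have a₂ : s₂.natVar 10 = K := by simp [hs₂, levelInput, a₁]
  have b₂ : s₂.natVar 12 = b := by simp [hs₂, levelInput, b₁]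
  have c₂ : s₂.natVar 13 = c := by simp [hs₂, levelInput, c₁]
  have d₂ : s₂.natVar 14 = s.natVar 14 := by simp [hs₂, levelInput, d₁]
  have r0₂ : s₂.realArr 0 = s.realArr 0 := by simp [hs₂, levelInput, r0₁]
  have r1₂ : s₂.realArr 1 = s.realArr 1 := by simp [hs₂, levelInput, r1₁]
  have r9₂ : s₂.realArr 9 = s.realArr 9 := by simp [hs₂, levelInput, r9₁]
  have r10₂ : s₂.realArr 10 = s.realArr 10 := by simp [hs₂, levelInput, r10₁]
  have n2₂ : s₂.natVar 2 = 0 := by simp [hs₂, levelInput]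
  have base₂ : s₂.natArr 1 0 = 0 := by simp [hs₂, levelInput]
  have len₂ : s₂.natArr 2 0 = K := by simp [hs₂, levelInput, a₁]
  have α₂ : s₂.realArr 5 0 = 1 := by simp [hs₂, levelInput]
  have β₂ : s₂.realArr 6 0 = 0 := by simp [hs₂, levelInput]
  have T₂ : s₂.realArr 7 0 = T := by simp [hs₂, levelInput, d₁, r1₁, hT0]
  have W₂ : s₂.realArr 3 = s₁.realArr 3 := by simp [hs₂, levelInput]
  refine ((searchWithin K s₂ (by rw [n2₂, len₂]) (by rw [n2₂, α₂]; exact zero_le_one)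
    (by rw [n2₂, β₂])).frame procs_footprint).seq (t₂ := 60 * K + 140) ?_ (by omega)
  rintro s₃ ⟨hE₃, -, hR⟩
  rw [n2₂, base₂, len₂, α₂, β₂, T₂, W₂] at hR
  have hlevel := hR.excess_level (fun h => by
    have := length_seg (s₁.realArr 3) 0 K
    rw [h] at this
    simp at this
    omega) hTpos
  rw [sum_map_seg _ (fun i => -Real.log (s.realArr 0 (b + i))) _ _ _
    fun i hi => by rw [zero_add]; exact hW₁ i hi] at hlevel
  have a₃ : s₃.natVar 10 = K := by rw [hE₃.natVar 10 (by decide), a₂]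
  have b₃ : s₃.natVar 12 = b := by rw [hE₃.natVar 12 (by decide), b₂]
  have c₃ : s₃.natVar 13 = c := by rw [hE₃.natVar 13 (by decide), c₂]
  have d₃ : s₃.natVar 14 = s.natVar 14 := by rw [hE₃.natVar 14 (by decide), d₂]
  have r0₃ : s₃.realArr 0 = s.realArr 0 := by rw [hE₃.realArr 0 (by decide), r0₂]
  have r1₃ : s₃.realArr 1 = s.realArr 1 := by rw [hE₃.realArr 1 (by decide), r1₂]
  have r9₃ : s₃.realArr 9 = s.realArr 9 := by rw [hE₃.realArr 9 (by decide), r9₂]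
  have r10₃ : s₃.realArr 10 = s.realArr 10 := by rw [hE₃.realArr 10 (by decide), r10₂]
  set ν := Real.exp ((T + s₃.realArr 4 0) / (s₃.natArr 3 0 : ℝ)) with hν
  refine Within.seq (t₁ := 30) (t₂ := 60 * K + 100)
    (Q₁ := fun s₄ => s₄ = (s₃.setReal 5 ν).setReal 6 0)
    (.flat rfl (by decide) (by simp [hν, hT0, d₃, r1₃])) ?_ (by omega)
  rintro _ rfl
  refine (blockCost_within _ (by simp)).seq (t₂ := 60) ?_ (by simp [a₃]; omega)
  rintro s₅ ⟨hE₅, h6₅⟩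
  simp [r0₃, a₃, b₃] at h6₅
  have a₅ : s₅.natVar 10 = K := by rw [hE₅.natVar 10 (by decide)]; exact a₃
  have b₅ : s₅.natVar 12 = b := by rw [hE₅.natVar 12 (by decide)]; exact b₃
  have c₅ : s₅.natVar 13 = c := by rw [hE₅.natVar 13 (by decide)]; exact c₃
  have r9₅ : s₅.realArr 9 = s.realArr 9 := by rw [hE₅.realArr 9 (by decide)]; exact r9₃
  have r10₅ : s₅.realArr 10 = s.realArr 10 := by rw [hE₅.realArr 10 (by decide)]; exact r10₃
  have r5₅ : s₅.realVar 5 = ν := by rw [hE₅.realVar 5 (by decide)]; simp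
  refine .flat rfl (by decide) ?_
  refine ⟨by simp [a₅, b₅], by simp [c₅], ν, ⟨_, hν, hlevel⟩, ?_, ?_⟩
  · simp [c₅, r10₅, r5₅]
  · simp [c₅, r9₅, h6₅]

/-- Cells are numbered `c = m * M + j`. When `N = M * K`, the gains of user `m` on tile `j` start at
`m * N + j * K = c * K`, so the pointer just advances by `K` from cell to cell. The offset `M + 1`
places cell `c` at `(m + 1) * M + (j + 1)`, as the one-based indices of the Hungarian method demand.
-/
theorem tableCmd_within (s : Store) {M K : ℕ} (hM : s.natVar 0 = M) (hK : s.natVar 10 = K)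
    (hpos : 0 < K) (hT : ∀ m < M, 0 < s.realArr 1 m) :
    Within procs tableCmd s (6000 * (M * M * K) + 100 * M + 100) fun s' =>
      EqOff (tableCmd.footprint searchFootprint) s s' ∧
      ∀ c < M * M,
        IsLevel (s.realArr 0) (c * K) K (s.realArr 1 (c / M) * Real.log 2)
          (s'.realArr 10 (M + 1 + c)) ∧
        s'.realArr 9 (M + 1 + c)
          = fillPower (s.realArr 0) (c * K) K (s'.realArr 10 (M + 1 + c)) := by
  refine Within.frame procs_footprint ?_
  set I : ℕ → Store → Prop := fun c s' => s'.natVar 12 = c * K ∧ s'.natVar 13 = M + 1 + c ∧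
      ∀ c' < c, IsLevel (s.realArr 0) (c' * K) K (s.realArr 1 (c' / M) * Real.log 2)
          (s'.realArr 10 (M + 1 + c')) ∧
        s'.realArr 9 (M + 1 + c')
          = fillPower (s.realArr 0) (c' * K) K (s'.realArr 10 (M + 1 + c')) with hI
  simp only [tableCmd, block]
  refine Within.seq (t₁ := 2) (t₂ := 6000 * (M * M * K) + 100 * M + 90)
    (Q₁ := fun s' => s' = s.setNat 12 0)
    (.flat rfl (by decide) (by simp)) ?_ (by omega)
  rintro _ rfl
  refine Within.seq (t₁ := 4) (t₂ := 6000 * (M * M * K) + 100 * M + 80)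
    (Q₁ := fun s' => s' = (s.setNat 12 0).setNat 13 (M + 1))
    (.flat rfl (by decide) (by simp [hM])) ?_ (by omega)
  rintro _ rfl
  refine (Within.forUp procs_footprint (n := M) (fun m => I (m * M)) (by simp [hM]) (by decide)
    (by decide) (by simp [hI]) ?_ (t := M * (5500 * K + 8) + 6)).mono ?_ fun s' h => h.2.2.2
  · intro m s₁ hm hi hE hI₁
    have M₁ : s₁.natVar 0 = M := by rw [hE.natVar 0 (by decide)]; simp [hM]
    have K₁ : s₁.natVar 10 = K := by rw [hE.natVar 10 (by decide)]; simp [hK]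
    have r0₁ : s₁.realArr 0 = s.realArr 0 := by rw [hE.realArr 0 (by decide)]; rfl
    have r1₁ : s₁.realArr 1 = s.realArr 1 := by rw [hE.realArr 1 (by decide)]; rfl
    refine (Within.forUp procs_footprint (n := M) (fun j => I (m * M + j)) M₁ (by decide)
      (by decide) (by simpa [hI] using hI₁) ?_ (t := 5500 * K)).mono le_rfl fun s' h => ?_
    · intro j s₂ hj hi₂ hE₂ ⟨h12, h13, hG⟩
      have K₂ : s₂.natVar 10 = K := by rw [hE₂.natVar 10 (by decide), K₁]
      have m₂ : s₂.natVar 14 = m := by rw [hE₂.natVar 14 (by decide), hi]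
      have r0₂ : s₂.realArr 0 = s.realArr 0 := by rw [hE₂.realArr 0 (by decide), r0₁]
      have r1₂ : s₂.realArr 1 = s.realArr 1 := by rw [hE₂.realArr 1 (by decide), r1₁]
      refine (cellCmd_within s₂ (by omega) (by rw [m₂, r1₂]; exact hT m hm)).mono (by rw [K₂]) ?_
      rintro s₃ ⟨hE₃, h12₃, h13₃, ν, hν, h10, h9⟩
      rw [r0₂, r1₂, m₂, h12, K₂] at hν
      rw [h13] at h10
      rw [r0₂, h12, h13, K₂] at h9
      have hdiv : (m * M + j) / M = m := by
        rw [mul_comm, Nat.mul_add_div (by omega), Nat.div_eq_of_lt hj, add_zero]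
      refine ⟨?_, ?_, fun c hc => ?_⟩
      · simp [h12₃, h12, K₂]
        ring
      · simp [h13₃, h13]
        ring
      · simp only [Store.setNat_realArr, h9, h10]
        rcases (by omega : c < m * M + j ∨ c = m * M + j) with hc | rfl
        · rw [Function.update_of_ne (by omega), Function.update_of_ne (by omega)]
          exact hG c hc
        · rw [Function.update_self, Function.update_self, hdiv]
          exact ⟨hν, rfl⟩
    · have h2 := h.2
      rw [← Nat.succ_mul] at h2
      simpa [hI] using h2
  · have : M ≤ M * M * K := by
      rcases Nat.eq_zero_or_pos M with rfl | hM'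
      · simp
      · nlinarith [Nat.mul_le_mul hM' hpos, Nat.mul_le_mul_left M (Nat.mul_le_mul hM' hpos)]
    have h8 : M * M ≤ M * M * K := Nat.le_mul_of_pos_right _ hpos
    nlinarith

end RealRAM

/-! ### The assignment problem

Rows and columns are numbered from `1` to `n`. Column `0` is an auxiliary column that holds the
row that is being inserted. `p j` is the row matched to column `j`, or `0`. -/

namespace Assignment

variable {n : ℕ} {a : ℕ → ℕ → ℝ} {u v w : ℕ → ℝ} {p way used : ℕ → ℕ}

/-- The potentials are dual feasible. -/
def Dual (n : ℕ) (a : ℕ → ℕ → ℝ) (u v : ℕ → ℝ) : Prop :=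
  ∀ r j, 1 ≤ r → r ≤ n → 1 ≤ j → j ≤ n → u r + v j ≤ a r j

/-- The rows `1, …, k` are matched along tight edges. -/
structure Partial (n : ℕ) (a : ℕ → ℕ → ℝ) (k : ℕ) (u v : ℕ → ℝ) (p : ℕ → ℕ) : Prop where
  dual : Dual n a u v
  tight : ∀ j, 1 ≤ j → j ≤ n → p j ≠ 0 → u (p j) + v j = a (p j) j
  inj : ∀ i j, 1 ≤ i → i ≤ n → 1 ≤ j → j ≤ n → p i ≠ 0 → p i = p j → i = j
  range : ∀ j, 1 ≤ j → j ≤ n → p j ≤ k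
  surj : ∀ r, 1 ≤ r → r ≤ k → ∃ j, 1 ≤ j ∧ j ≤ n ∧ p j = r

/-- State of the search for an augmenting path for row `k`. The column `j` was visited as number
`used j`; `w j` is the least slack between the visited rows and the unvisited column `j`. -/
structure Path (n : ℕ) (a : ℕ → ℕ → ℝ) (k : ℕ) (u v w : ℕ → ℝ) (p way used : ℕ → ℕ)
    (cnt : ℕ) : Prop where
  dual : Dual n a u v
  le : k ≤ n
  root : p 0 = k
  pos : 1 ≤ k
  tight : ∀ j, 1 ≤ j → j ≤ n → p j ≠ 0 → u (p j) + v j = a (p j) j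
  inj : ∀ i j, i ≤ n → j ≤ n → p i ≠ 0 → p i = p j → i = j
  range : ∀ j, j ≤ n → p j ≤ k
  surj : ∀ r, 1 ≤ r → r ≤ k → ∃ j, j ≤ n ∧ p j = r
  used_root : used 0 = 1
  card : ((Finset.range (n + 1)).filter (used · ≠ 0)).card = cnt
  used_le : ∀ j, j ≤ n → used j ≤ cnt
  matched : ∀ j, j ≤ n → used j ≠ 0 → p j ≠ 0
  way_le : ∀ j, 1 ≤ j → j ≤ n → way j ≤ n
  way_used : ∀ j, 1 ≤ j → j ≤ n → used (way j) ≠ 0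
  way_lt : ∀ j, 1 ≤ j → j ≤ n → used j ≠ 0 → used (way j) < used j
  way_tight : ∀ j, 1 ≤ j → j ≤ n → used j ≠ 0 → u (p (way j)) + v j = a (p (way j)) j
  slack : ∀ j, 1 ≤ j → j ≤ n → used j = 0 → w j = a (p (way j)) j - u (p (way j)) - v j
  slack_le : ∀ j, 1 ≤ j → j ≤ n → used j = 0 → ∀ i, i ≤ n → used i ≠ 0 →
    w j ≤ a (p i) j - u (p i) - v j

/-- The visited columns, the auxiliary one included, hold distinct rows among `1, …, k`. This bounds
the number of rounds of the path search. -/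
theorem Path.cnt_le {k cnt : ℕ} (h : Path n a k u v w p way used cnt) : cnt ≤ k := by
  have : cnt ≤ (Finset.Icc 1 k).card := by
    rw [← h.card]
    refine Finset.card_le_card_of_injOn p (fun j hj => ?_) fun i hi j hj e => ?_
    · simp only [Finset.coe_filter, Finset.mem_range, Set.mem_ofPred_eq] at hj
      have := h.matched j (by omega) hj.2
      simp only [Finset.coe_Icc, Set.mem_Icc]
      exact ⟨by omega, h.range j (by omega)⟩
    · simp only [Finset.coe_filter, Finset.mem_range, Set.mem_ofPred_eq] at hi hj
      exact h.inj i j (by omega) (by omega) (h.matched i (by omega) hi.2) e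
  simpa using this

/-- There is an unvisited column. -/
theorem Path.exists_unused {k cnt : ℕ} (h : Path n a k u v w p way used cnt) :
    ∃ j, 1 ≤ j ∧ j ≤ n ∧ used j = 0 := by
  by_contra hne
  push Not at hne
  have h₁ := h.cnt_le
  have h₂ := h.card
  rw [Finset.filter_true_of_mem, Finset.card_range] at h₂
  · have := h.le
    omega
  · intro j hj
    rcases Nat.eq_zero_or_pos j with rfl | hpos
    · rw [h.used_root]; exact one_ne_zero
    · exact hne j hpos (by simpa [Nat.lt_succ_iff] using hj)

open Classical in
/-- Change of the potentials by the least slack. -/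
theorem Path.update {k cnt : ℕ} (h : Path n a k u v w p way used cnt) {δ : ℝ} {j₁ : ℕ}
    (h₁ : 1 ≤ j₁) (h₁' : j₁ ≤ n) (hu : used j₁ = 0) (hδ : δ = w j₁)
    (hle : ∀ j, 1 ≤ j → j ≤ n → used j = 0 → δ ≤ w j) {u' v' w' : ℕ → ℝ}
    (hu' : ∀ r, u' r = if ∃ j ≤ n, used j ≠ 0 ∧ p j = r then u r + δ else u r)
    (hv' : ∀ j, 1 ≤ j → j ≤ n → v' j = if used j ≠ 0 then v j - δ else v j)
    (hw' : ∀ j, 1 ≤ j → j ≤ n → w' j = if used j ≠ 0 then w j else w j - δ) :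
    Path n a k u' v' w' p way used cnt ∧ w' j₁ = 0 := by
  have hur : ∀ j ≤ n, used j ≠ 0 → u' (p j) = u (p j) + δ := fun j hj hj' => by
    rw [hu', if_pos ⟨j, hj, hj', rfl⟩]
  have hun : ∀ j ≤ n, used j = 0 → p j ≠ 0 → u' (p j) = u (p j) := fun j hj hj' hp => by
    rw [hu', if_neg]
    rintro ⟨i, hi, hi', hij⟩
    obtain rfl := h.inj j i hj hi hp hij.symm
    exact hi' hj'
  -- The least slack is the reduced cost of an actual pair of a row and a column, hence non-negative
  -- by dual feasibility.
  have hδ0 : 0 ≤ δ := by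
    rw [hδ, h.slack j₁ h₁ h₁' hu]
    have hway := h.matched _ (h.way_le j₁ h₁ h₁') (h.way_used j₁ h₁ h₁')
    have := h.dual (p (way j₁)) j₁ (by omega)
      ((h.range _ (h.way_le j₁ h₁ h₁')).trans h.le) h₁ h₁'
    linarith
  refine ⟨{ h with
    dual := ?_
    tight := ?_
    way_tight := ?_
    slack := ?_
    slack_le := ?_ }, ?_⟩
  · intro r j hr hr' hj hj'
    have hd := h.dual r j hr hr' hj hj'
    rw [hu', hv' j hj hj']
    split_ifs with hex hju hju
    · linarith
    -- A visited row and an unvisited column: the only case where the sum of the potentials grows.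
    -- It grows by `δ`, which does not exceed the slack of the pair.
    · obtain ⟨i, hi, hi', rfl⟩ := hex
      have := hle j hj hj' (not_not.1 hju)
      have := h.slack_le j hj hj' (not_not.1 hju) i hi hi'
      linarith
    · linarith
    · linarith
  · intro j hj hj' hp
    have := h.tight j hj hj' hp
    rw [hv' j hj hj']
    split_ifs with hju
    · rw [hur j hj' hju]; linarith
    · rw [hun j hj' (not_not.1 hju) hp]; linarith
  · intro j hj hj' hju
    have := h.way_tight j hj hj' hju
    rw [hv' j hj hj', if_pos hju, hur _ (h.way_le j hj hj') (h.way_used j hj hj')]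
    linarith
  · intro j hj hj' hju
    have := h.slack j hj hj' hju
    rw [hv' j hj hj', if_neg (not_not.2 hju), hw' j hj hj', if_neg (not_not.2 hju),
      hur _ (h.way_le j hj hj') (h.way_used j hj hj')]
    linarith
  · intro j hj hj' hju i hi hi'
    have := h.slack_le j hj hj' hju i hi hi'
    rw [hv' j hj hj', if_neg (not_not.2 hju), hw' j hj hj', if_neg (not_not.2 hju), hur _ hi hi']
    linarith
  · rw [hw' j₁ h₁ h₁', if_neg (not_not.2 hu), hδ, sub_self]

/-- Visit of a column that can be reached along a tight edge. -/
theorem Path.visit {k cnt : ℕ} (h : Path n a k u v w p way used cnt) {j₁ : ℕ}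
    (h₁ : 1 ≤ j₁) (h₁' : j₁ ≤ n) (hu : used j₁ = 0) (hw : w j₁ = 0) (hp : p j₁ ≠ 0)
    {w' : ℕ → ℝ} {way' used' : ℕ → ℕ}
    (hused : ∀ j, used' j = if j = j₁ then cnt + 1 else used j)
    (hscan : ∀ j, 1 ≤ j → j ≤ n → used' j = 0 →
      (a (p j₁) j - u (p j₁) - v j < w j ∧ w' j = a (p j₁) j - u (p j₁) - v j ∧ way' j = j₁) ∨
      (w j ≤ a (p j₁) j - u (p j₁) - v j ∧ w' j = w j ∧ way' j = way j))
    (hkeep : ∀ j, 1 ≤ j → j ≤ n → used' j ≠ 0 → way' j = way j) :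
    Path n a k u v w' p way' used' (cnt + 1) := by
  have hself : used' j₁ = cnt + 1 := by rw [hused, if_pos rfl]
  have hother : ∀ j, used j ≠ 0 → used' j = used j := fun j hj => by
    rw [hused, if_neg]
    rintro rfl
    exact hj hu
  have hzero : ∀ j, used' j = 0 → used j = 0 := fun j hj => by
    by_contra hne
    exact hne (hother j hne ▸ hj)
  have hcase : ∀ j, used' j ≠ 0 → j = j₁ ∨ used j ≠ 0 := fun j hj => by
    by_contra! hne
    rw [hused, if_neg hne.1] at hj
    exact hj hne.2
  refine { h with
    used_root := ?_
    card := ?_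
    used_le := ?_
    matched := ?_
    way_le := ?_
    way_used := ?_
    way_lt := ?_
    way_tight := ?_
    slack := ?_
    slack_le := ?_ }
  · rw [hother 0 (by rw [h.used_root]; exact one_ne_zero), h.used_root]
  · rw [← h.card, show (Finset.range (n + 1)).filter (used' · ≠ 0)
      = insert j₁ ((Finset.range (n + 1)).filter (used · ≠ 0)) by
        ext j
        simp only [Finset.mem_filter, Finset.mem_range, Finset.mem_insert]
        constructor
        · rintro ⟨hj, hj'⟩
          exact (hcase j hj').imp_right fun hh => ⟨hj, hh⟩
        · rintro (rfl | ⟨hj, hj'⟩)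
          · exact ⟨by omega, by omega⟩
          · exact ⟨hj, by rwa [hother j hj']⟩,
      Finset.card_insert_of_notMem (by simp [hu])]
  · intro j hj
    have := h.used_le j hj
    rw [hused]
    split_ifs <;> omega
  · intro j hj hj'
    rcases hcase j hj' with rfl | hju
    · exact hp
    · exact h.matched j hj hju
  · intro j hj hj'
    by_cases hju : used' j = 0
    · rcases hscan j hj hj' hju with ⟨-, -, e⟩ | ⟨-, -, e⟩ <;> rw [e]
      · exact h₁'
      · exact h.way_le j hj hj'
    · rw [hkeep j hj hj' hju]
      exact h.way_le j hj hj'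
  · intro j hj hj'
    by_cases hju : used' j = 0
    · rcases hscan j hj hj' hju with ⟨-, -, e⟩ | ⟨-, -, e⟩ <;> rw [e]
      · omega
      · rw [hother _ (h.way_used j hj hj')]
        exact h.way_used j hj hj'
    · rw [hkeep j hj hj' hju, hother _ (h.way_used j hj hj')]
      exact h.way_used j hj hj'
  · intro j hj hj' hju
    rw [hkeep j hj hj' hju, hother _ (h.way_used j hj hj')]
    rcases hcase j hju with rfl | hju'
    · have := h.used_le _ (h.way_le j hj hj')
      omega
    · rw [hother j hju']
      exact h.way_lt j hj hj' hju'
  · intro j hj hj' hju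
    rw [hkeep j hj hj' hju]
    rcases hcase j hju with rfl | hju'
    · have := h.slack j hj hj' hu
      linarith
    · exact h.way_tight j hj hj' hju'
  · intro j hj hj' hju
    rcases hscan j hj hj' hju with ⟨-, e, e'⟩ | ⟨-, e, e'⟩ <;> rw [e, e']
    exact h.slack j hj hj' (hzero j hju)
  · intro j hj hj' hju i hi hi'
    rcases hcase i hi' with rfl | hiu
    · rcases hscan j hj hj' hju with ⟨hlt, e, -⟩ | ⟨hle, e, -⟩ <;> rw [e]
      exact hle
    · have := h.slack_le j hj hj' (hzero j hju) i hi hiu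
      rcases hscan j hj hj' hju with ⟨hlt, e, -⟩ | ⟨hle, e, -⟩ <;> rw [e]
      · linarith
      · exact this

/-- State of the augmentation: the column `h` is free or holds an outdated row. -/
structure Augment (n : ℕ) (a : ℕ → ℕ → ℝ) (k : ℕ) (u v : ℕ → ℝ) (p way ord : ℕ → ℕ)
    (h : ℕ) : Prop where
  dual : Dual n a u v
  hole : h ≤ n
  tight : ∀ j, 1 ≤ j → j ≤ n → j ≠ h → p j ≠ 0 → u (p j) + v j = a (p j) j
  inj : ∀ i j, i ≤ n → j ≤ n → i ≠ h → j ≠ h → p i ≠ 0 → p i = p j → i = j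
  range : ∀ j, 1 ≤ j → j ≤ n → j ≠ h → p j ≤ k
  surj : ∀ r, 1 ≤ r → r ≤ k → ∃ j, j ≤ n ∧ j ≠ h ∧ p j = r
  way_le : ∀ j, 1 ≤ j → j ≤ n → ord j ≤ ord h → way j ≤ n
  way_lt : ∀ j, 1 ≤ j → j ≤ n → ord j ≤ ord h → ord (way j) < ord j
  way_tight : ∀ j, 1 ≤ j → j ≤ n → ord j ≤ ord h → u (p (way j)) + v j = a (p (way j)) j
  matched : ∀ j, j ≤ n → ord j < ord h → p j ≠ 0 ∧ p j ≤ k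

/-- The order extends the visiting times: the free column `j₁` comes after all visited columns and
the other unvisited columns come later still. The conditions up to `ord j₁` thus concern only
visited columns and `j₁` itself, for which zero slack means a tight edge. -/
theorem Path.augment {k cnt : ℕ} (h : Path n a k u v w p way used cnt) {j₁ : ℕ}
    (h₁ : 1 ≤ j₁) (h₁' : j₁ ≤ n) (hu : used j₁ = 0) (hw : w j₁ = 0) (hp : p j₁ = 0) :
    ∃ ord : ℕ → ℕ, ord j₁ = cnt + 1 ∧ Augment n a k u v p way ord j₁ := by
  refine ⟨fun j => if j = j₁ then cnt + 1 else if used j = 0 then cnt + 2 else used j,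
    if_pos rfl, ?_⟩
  have hother : ∀ j, j ≠ j₁ →
      (if j = j₁ then cnt + 1 else if used j = 0 then cnt + 2 else used j) ≤ cnt + 1 →
      used j ≠ 0 := by
    intro j hj hle hju
    rw [if_neg hj, if_pos hju] at hle
    omega
  have hway : ∀ j, 1 ≤ j → j ≤ n → way j ≠ j₁ := fun j hj hj' e =>
    h.way_used j hj hj' (e ▸ hu)
  constructor
  · exact h.dual
  · exact h₁'
  · exact fun j hj hj' _ => h.tight j hj hj'
  · exact fun i j hi hj _ _ => h.inj i j hi hj
  · exact fun j _ hj _ => h.range j hj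
  · intro r hr hr'
    obtain ⟨j, hj, e⟩ := h.surj r hr hr'
    refine ⟨j, hj, ?_, e⟩
    rintro rfl
    omega
  · exact fun j hj hj' _ => h.way_le j hj hj'
  · intro j hj hj' hle
    simp only [if_true] at hle
    simp only [hway j hj hj', if_false, h.way_used j hj hj']
    have := h.used_le _ (h.way_le j hj hj')
    split_ifs
    · omega
    · omega
    · exact h.way_lt j hj hj' ‹_›
  · intro j hj hj' hle
    simp only [if_true] at hle
    by_cases hjj : j = j₁
    · subst hjj
      have := h.slack j hj hj' hu
      linarith
    · exact h.way_tight j hj hj' (hother j hjj hle)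
  · intro j hj hlt
    simp only [if_true] at hlt
    have hne : j ≠ j₁ := by
      rintro rfl
      simp at hlt
    exact ⟨h.matched j hj (hother j hne hlt.le), h.range j hj⟩

/-- The row of the predecessor moves into the hole along a tight edge, and the predecessor becomes
the hole. The overwritten column has a larger order than every column whose row is read afterwards,
so the remaining path is unaffected. -/
theorem Augment.step {k j : ℕ} {ord : ℕ → ℕ} (h : Augment n a k u v p way ord j) (hj : 1 ≤ j)
    {p' : ℕ → ℕ} (hp' : ∀ i, p' i = if i = j then p (way j) else p i) :
    Augment n a k u v p' way ord (way j) := by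
  have hlt := h.way_lt j hj h.hole le_rfl
  have hne : way j ≠ j := fun e => by rw [e] at hlt; omega
  have hm := h.matched _ (h.way_le j hj h.hole le_rfl) hlt
  have hp₁ : p' j = p (way j) := by rw [hp', if_pos rfl]
  have hp₂ : ∀ i, i ≠ j → p' i = p i := fun i hi => by rw [hp', if_neg hi]
  have hp₃ : ∀ i, ord i < ord j → p' i = p i := fun i hi => hp₂ i (by rintro rfl; omega)
  constructor
  · exact h.dual
  · exact h.way_le j hj h.hole le_rfl
  · intro i hi hi' hiw hpi
    by_cases hij : i = j
    · subst hij
      rw [hp₁]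
      exact h.way_tight i hi hi' le_rfl
    · rw [hp₂ i hij] at hpi ⊢
      exact h.tight i hi hi' hij hpi
  · intro i i' hi hi' hiw hiw' hpi e
    by_cases hij : i = j <;> by_cases hij' : i' = j
    · rw [hij, hij']
    · rw [hij, hp₁, hp₂ i' hij'] at e
      exact absurd (h.inj _ i' (h.way_le j hj h.hole le_rfl) hi' hne hij' hm.1 e).symm hiw'
    · rw [hij', hp₁, hp₂ i hij] at e
      exact absurd (h.inj _ i (h.way_le j hj h.hole le_rfl) hi hne hij hm.1 e.symm).symm hiw
    · rw [hp₂ i hij] at hpi e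
      rw [hp₂ i' hij'] at e
      exact h.inj i i' hi hi' hij hij' hpi e
  · intro i hi hi' hiw
    by_cases hij : i = j
    · rw [hij, hp₁]
      exact hm.2
    · rw [hp₂ i hij]
      exact h.range i hi hi' hij
  · intro r hr hr'
    obtain ⟨i, hi, hij, e⟩ := h.surj r hr hr'
    by_cases hiw : i = way j
    · exact ⟨j, h.hole, hne.symm, by rw [hp₁, ← hiw, e]⟩
    · exact ⟨i, hi, hiw, by rw [hp₂ i hij, e]⟩
  · exact fun i hi hi' hle => h.way_le i hi hi' (by omega)
  · exact fun i hi hi' hle => h.way_lt i hi hi' (by omega)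
  · intro i hi hi' hle
    have := h.way_lt i hi hi' (by omega)
    rw [hp₃ _ (by omega)]
    exact h.way_tight i hi hi' (by omega)
  · intro i hi hlt'
    rw [hp₃ i (by omega)]
    exact h.matched i hi (by omega)

/-- When the hole has reached the auxiliary column, no exception is left among the genuine columns.
-/
theorem Augment.partial {k : ℕ} {ord : ℕ → ℕ} (h : Augment n a k u v p way ord 0) :
    Partial n a k u v p where
  dual := h.dual
  tight j hj hj' := h.tight j hj hj' (by omega)
  inj i j hi hi' hj hj' := h.inj i j hi' hj' (by omega) (by omega)
  range j hj hj' := h.range j hj hj' (by omega)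
  surj r hr hr' := by
    obtain ⟨j, hj, hj', e⟩ := h.surj r hr hr'
    exact ⟨j, by omega, hj, e⟩

/-- Start of the search for an augmenting path. -/
theorem Partial.path {k : ℕ} (h : Partial n a k u v p) (hk : k + 1 ≤ n) {p' : ℕ → ℕ}
    (hp' : ∀ j, p' j = if j = 0 then k + 1 else p j)
    (hway : ∀ j, 1 ≤ j → j ≤ n → way j = 0)
    (hused : used 0 = 1) (hused' : ∀ j, 1 ≤ j → j ≤ n → used j = 0)
    (hw : ∀ j, 1 ≤ j → j ≤ n → w j = a (k + 1) j - u (k + 1) - v j) :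
    Path n a (k + 1) u v w p' way used 1 := by
  have hp0 : p' 0 = k + 1 := by rw [hp', if_pos rfl]
  have hpj : ∀ j, 1 ≤ j → p' j = p j := fun j hj => by rw [hp', if_neg (by omega)]
  have hused0 : ∀ j, j ≤ n → used j ≠ 0 → j = 0 := fun j hj hju => by
    by_contra hne
    exact hju (hused' j (by omega) hj)
  constructor
  · exact h.dual
  · exact hk
  · exact hp0
  · omega
  · intro j hj hj' hp
    rw [hpj j hj] at hp ⊢
    exact h.tight j hj hj' hp
  · intro i j hi hj hp e
    rcases Nat.eq_zero_or_pos i with rfl | hi₀ <;> rcases Nat.eq_zero_or_pos j with rfl | hj₀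
    · rfl
    · have := h.range j hj₀ hj
      rw [hp0, hpj j hj₀] at e
      omega
    · have := h.range i hi₀ hi
      rw [hp0, hpj i hi₀] at e
      omega
    · rw [hpj i hi₀] at hp e
      rw [hpj j hj₀] at e
      exact h.inj i j hi₀ hi hj₀ hj hp e
  · intro j hj
    rcases Nat.eq_zero_or_pos j with rfl | hj₀
    · omega
    · have := h.range j hj₀ hj
      rw [hpj j hj₀]
      omega
  · intro r hr hr'
    rcases Nat.lt_succ_iff_lt_or_eq.1 (Nat.lt_succ_iff.2 hr') with hlt | rfl
    · obtain ⟨j, hj, hj', e⟩ := h.surj r hr (by omega)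
      exact ⟨j, hj', by rw [hpj j hj, e]⟩
    · exact ⟨0, by omega, hp0⟩
  · exact hused
  · rw [Finset.card_eq_one]
    refine ⟨0, ?_⟩
    ext j
    simp only [Finset.mem_filter, Finset.mem_range, Finset.mem_singleton]
    constructor
    · rintro ⟨hj, hju⟩
      exact hused0 j (by omega) hju
    · rintro rfl
      omega
  · intro j hj
    rcases Nat.eq_zero_or_pos j with rfl | hj₀
    · omega
    · rw [hused' j hj₀ hj]
      omega
  · intro j hj hju
    rw [hused0 j hj hju, hp0]
    omega
  · intro j hj hj'
    rw [hway j hj hj']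
    omega
  · intro j hj hj'
    rw [hway j hj hj', hused]
    omega
  · intro j hj hj' hju
    exact absurd (hused' j hj hj') hju
  · intro j hj hj' hju
    exact absurd (hused' j hj hj') hju
  · intro j hj hj' hju
    rw [hway j hj hj', hp0, hw j hj hj']
  · intro j hj hj' hju i hi hiu
    rw [hused0 i hi hiu, hp0, hw j hj hj']

/-- Zero potentials are dual feasible for non-negative costs, and powers are non-negative. -/
theorem Partial.empty (h : ∀ r j, 1 ≤ r → r ≤ n → 1 ≤ j → j ≤ n → 0 ≤ a r j)
    (hu : ∀ r, u r = 0) (hv : ∀ r, v r = 0) (hp : ∀ j, p j = 0) : Partial n a 0 u v p where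
  dual r j hr hr' hj hj' := by
    rw [hu, hv, add_zero]
    exact h r j hr hr' hj hj'
  tight j _ _ hpj := absurd (hp j) hpj
  inj i _ _ _ _ _ hpi := absurd (hp i) hpi
  range j _ _ := (hp j).le
  surj r hr hr' := by omega

/-- A complete matching is a bijection between columns and rows. -/
theorem Partial.bijective (h : Partial n a n u v p) :
    ∃ q : Fin n → Fin n, Function.Bijective q ∧ ∀ j : Fin n, (q j : ℕ) + 1 = p (j + 1) := by
  -- No column is free: choosing a column for every row gives an injection of `Fin n` into itself,
  -- hence a surjection.
  have hp : ∀ j : Fin n, 1 ≤ p (j + 1) := by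
    have hsurj : ∀ r : Fin n, ∃ j : Fin n, p (j + 1) = r + 1 := fun r => by
      obtain ⟨j, hj, hj', e⟩ := h.surj (r + 1) (by omega) (by omega)
      exact ⟨⟨j - 1, by omega⟩, by simpa [Nat.sub_add_cancel hj] using e⟩
    choose f hf using hsurj
    have hfi : Function.Injective f := fun r r' e => by
      have h₁ := hf r
      have h₂ := hf r'
      rw [e, h₂] at h₁
      exact Fin.ext (by omega)
    intro j
    obtain ⟨r, rfl⟩ := (Finite.injective_iff_surjective.1 hfi) j
    rw [hf]
    omega
  let q : Fin n → Fin n := fun j => ⟨p (j + 1) - 1, by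
    have := hp j
    have := h.range (j + 1) (by omega) (by omega)
    omega⟩
  have hq : ∀ j, (q j : ℕ) + 1 = p (j + 1) := fun j => Nat.sub_add_cancel (hp j)
  refine ⟨q, Finite.injective_iff_bijective.1 fun i j e => ?_, hq⟩
  have e' : p (i + 1) = p (j + 1) := by rw [← hq, ← hq, e]
  have := h.inj (i + 1) (j + 1) (by omega) (by omega) (by omega) (by omega)
    (by have := hp i; omega) e'
  exact Fin.ext (by omega)

/-- A complete matching along tight edges has the least cost. -/
theorem Partial.optimal (h : Partial n a n u v p) (σ : Fin n → Fin n)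
    (hσ : Function.Bijective σ) :
    ∑ j : Fin n, a (p (j + 1)) (j + 1) ≤ ∑ r : Fin n, a (r + 1) (σ r + 1) := by
  obtain ⟨q, hqb, hq⟩ := h.bijective
  -- Weak duality: the sum of all potentials equals the cost of the tight matching and bounds that
  -- of any other one from below.
  calc ∑ j : Fin n, a (p (j + 1)) (j + 1)
      = ∑ j : Fin n, (u (q j + 1) + v (j + 1)) := by
        refine Finset.sum_congr rfl fun j _ => ?_
        rw [hq]
        exact (h.tight _ (by omega) (by omega) (by have := hq j; omega)).symm
    _ = ∑ r : Fin n, u (r + 1) + ∑ j : Fin n, v (j + 1) := by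
        rw [Finset.sum_add_distrib, hqb.sum_comp fun r : Fin n => u (r + 1)]
    _ = ∑ r : Fin n, (u (r + 1) + v (σ r + 1)) := by
        rw [Finset.sum_add_distrib, hσ.sum_comp fun j : Fin n => v (j + 1)]
    _ ≤ _ := Finset.sum_le_sum fun r _ =>
        h.dual _ _ (by omega) (by omega) (by omega) (by omega)

end Assignment

namespace RealRAM
open Assignment

/-! ### The Hungarian method

The natural variables `0` and `28` hold `M` and `M + 1`. The natural arrays `4`, `5`, `6` are the
matching, the predecessors and the visiting times of columns, and `7` holds the multiples of `M`.
The real arrays `9`, `11`, `12`, `13` are the costs, the potentials of rows and of columns, and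
the slacks. -/

/-- The column `c + 1`, where `c` is the counter of the current loop. -/
def col : NExp := .add (.var 24) (.lit 1)

/-- Initialize the search for a path from row `k + 1`, where `k` is in variable `20`. -/
def initPath : Cmd := .seq
  (block [
    .setNat 21 (.add (.var 20) (.lit 1)),
    .putNat 4 (.lit 0) (.var 21),
    .putNat 6 (.lit 0) (.lit 1),
    .setNat 26 (.get 7 (.var 21)),
    .setNat 22 (.lit 0),
    .setNat 25 (.lit 1)])
  (forUp 24 0 (block [
    .putReal 13 col (.sub (.sub (.get 9 (.add (.var 26) col)) (.get 11 (.var 21))) (.get 12 col)),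
    .putNat 5 col (.lit 0),
    .putNat 6 col (.lit 0)]))

/-- Find an unvisited column of least slack. -/
def leastSlack : Cmd := .seq (.setNat 23 (.lit 0))
  (forUp 24 0 (.ite (.and (.natLt (.get 6 col) (.lit 1))
      (.not (.and (.natLt (.lit 0) (.var 23)) (.not (.realLt (.get 13 col) (.var 8))))))
    (.seq (.setNat 23 col) (.setReal 8 (.get 13 col)))
    .skip))

/-- Change the potentials. -/
def changePotentials : Cmd :=
  forUp 24 28 (.ite (.natLt (.lit 0) (.get 6 (.var 24)))
    (.seq
      (.putReal 11 (.get 4 (.var 24)) (.add (.get 11 (.get 4 (.var 24))) (.var 8)))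
      (.putReal 12 (.var 24) (.sub (.get 12 (.var 24)) (.var 8))))
    (.putReal 13 (.var 24) (.sub (.get 13 (.var 24)) (.var 8))))

/-- Visit a column. -/
def visitCmd : Cmd := .seq
  (block [
    .setNat 25 (.add (.var 25) (.lit 1)),
    .putNat 6 (.var 22) (.var 25),
    .setNat 27 (.get 4 (.var 22)),
    .setNat 26 (.get 7 (.var 27))])
  (forUp 24 0 (.seq
    (.setReal 9 (.sub (.sub (.get 9 (.add (.var 26) col)) (.get 11 (.var 27))) (.get 12 col)))
    (.ite (.and (.natLt (.get 6 col) (.lit 1)) (.realLt (.var 9) (.get 13 col)))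
      (.seq (.putReal 13 col (.var 9)) (.putNat 5 col (.var 22)))
      .skip)))

/-- Search for an augmenting path. -/
def pathLoop : Cmd := .loop (.natLt (.lit 0) (.get 4 (.var 22))) (block [
  leastSlack,
  changePotentials,
  .setNat 22 (.var 23),
  .ite (.natLt (.lit 0) (.get 4 (.var 22))) visitCmd .skip])

/-- Augment the matching. -/
def augmentLoop : Cmd := .loop (.natLt (.lit 0) (.var 22)) (.seq
  (.putNat 4 (.var 22) (.get 4 (.get 5 (.var 22))))
  (.setNat 22 (.get 5 (.var 22))))

/-- Tabulate the multiples of `M`. -/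
def multiplesCmd : Cmd := .seq (.setNat 28 (.add (.var 0) (.lit 1)))
  (forUp 24 0 (.putNat 7 col (.add (.get 7 (.var 24)) (.var 0))))

/-- The Hungarian method. -/
def hungarianCmd : Cmd := .seq multiplesCmd
  (forUp 20 0 (block [initPath, pathLoop, augmentLoop]))

/-- The parts of the store that are constant during the Hungarian method. -/
structure Setting (M : ℕ) (A : ℕ → ℝ) (s : Store) : Prop where
  size : s.natVar 0 = M
  size_succ : s.natVar 28 = M + 1
  cost : s.realArr 9 = A
  mult : ∀ r ≤ M, s.natArr 7 r = r * M

theorem Setting.of_eqOff {M : ℕ} {A : ℕ → ℝ} {s s' : Store} {F : Footprint}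
    (h : Setting M A s) (hE : EqOff F s s')
    (hF : 0 ∉ F.natVar ∧ 28 ∉ F.natVar ∧ 9 ∉ F.realArr ∧ 7 ∉ F.natArr) : Setting M A s' where
  size := (hE.natVar 0 hF.1).trans h.size
  size_succ := (hE.natVar 28 hF.2.1).trans h.size_succ
  cost := (hE.realArr 9 hF.2.2.1).trans h.cost
  mult r hr := by rw [hE.natArr 7 hF.2.2.2, h.mult r hr]

/-- The cost matrix that is stored in an array. -/
def matrix (M : ℕ) (A : ℕ → ℝ) (r j : ℕ) : ℝ := A (r * M + j)

/-- `Path` for the contents of the store. -/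
def StorePath (M : ℕ) (A : ℕ → ℝ) (k : ℕ) (s : Store) (cnt : ℕ) : Prop :=
  Path M (matrix M A) k (s.realArr 11) (s.realArr 12) (s.realArr 13) (s.natArr 4) (s.natArr 5)
    (s.natArr 6) cnt

/-! ### Correctness and running time of the Hungarian method. -/

variable {M k cnt : ℕ} {A : ℕ → ℝ} {s : Store}

theorem initPath_within (h : Setting M A s) (h20 : s.natVar 20 = k) (hk : k < M)
    (hP : Partial M (matrix M A) k (s.realArr 11) (s.realArr 12) (s.natArr 4)) :
    Within procs initPath s (100 * M + 100) fun s' =>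
      EqOff (initPath.footprint searchFootprint) s s' ∧
      s'.natVar 22 = 0 ∧ s'.natVar 25 = 1 ∧ StorePath M A (k + 1) s' 1 := by
  refine Within.frame procs_footprint ?_
  refine Within.seq (t₁ := 40) (t₂ := 100 * M + 60) (Q₁ := fun s₁ => s₁.natVar 0 = M ∧
    s₁.natVar 21 = k + 1 ∧ s₁.natVar 22 = 0 ∧ s₁.natVar 25 = 1 ∧ s₁.natVar 26 = (k + 1) * M ∧
    s₁.natArr 4 = Function.update (s.natArr 4) 0 (k + 1) ∧ s₁.natArr 6 0 = 1 ∧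
    s₁.realArr = s.realArr)
    (.flat rfl (by decide) (by simp [h20, h.size, h.mult (k + 1) hk])) ?_ (by omega)
  rintro s₁ ⟨h0₁, h21₁, h22₁, h25₁, h26₁, hp₁, hu₁, hr₁⟩
  refine (Within.forUp procs_footprint (t := 80) (fun c s' => s'.natArr 6 0 = 1 ∧
    ∀ j, 1 ≤ j → j ≤ c → s'.natArr 5 j = 0 ∧ s'.natArr 6 j = 0 ∧
      s'.realArr 13 j = matrix M A (k + 1) j - s.realArr 11 (k + 1) - s.realArr 12 j)
    h0₁ (by decide) (by decide) ⟨hu₁, by simp; omega⟩ ?_).mono (by omega) ?_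
  · intro c s₂ hc hi hE ⟨h6, hI⟩
    have h21 := (hE.natVar 21 (by decide)).trans h21₁
    have h26 := (hE.natVar 26 (by decide)).trans h26₁
    have r9 : s₂.realArr 9 = A := by rw [hE.realArr 9 (by decide), hr₁, h.cost]
    have r11 : s₂.realArr 11 = s.realArr 11 := by rw [hE.realArr 11 (by decide), hr₁]
    have r12 : s₂.realArr 12 = s.realArr 12 := by rw [hE.realArr 12 (by decide), hr₁]
    refine .flat rfl (by decide) ⟨?_, fun j hj hj' => ?_⟩
    · simp [col, hi, h6]
    · rcases (by omega : j ≤ c ∨ j = c + 1) with hj' | rfl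
      · obtain ⟨e₁, e₂, e₃⟩ := hI j hj hj'
        have : j ≠ c + 1 := by omega
        simp [col, hi, Function.update_of_ne this, e₁, e₂, e₃]
      · simp [col, hi, h21, h26, r9, r11, r12, matrix]
  · rintro s' ⟨hE, h6, hI⟩
    have hp : s'.natArr 4 = Function.update (s.natArr 4) 0 (k + 1) := by
      rw [hE.natArr 4 (by decide), hp₁]
    have r11 : s'.realArr 11 = s.realArr 11 := by rw [hE.realArr 11 (by decide), hr₁]
    have r12 : s'.realArr 12 = s.realArr 12 := by rw [hE.realArr 12 (by decide), hr₁]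
    refine ⟨(hE.natVar 22 (by decide)).trans h22₁, (hE.natVar 25 (by decide)).trans h25₁, ?_⟩
    rw [StorePath, hp, r11, r12]
    exact hP.path hk (fun j => by rw [Function.update_apply]) (fun j hj hj' => (hI j hj hj').1) h6
      (fun j hj hj' => (hI j hj hj').2.1) (fun j hj hj' => (hI j hj hj').2.2)

/-- Index 0 stands for "none found yet", which is unambiguous because the scan starts at column 1.
At the end it is excluded by `Path.exists_unused`. -/
theorem leastSlack_within (h : Setting M A s) (hP : StorePath M A k s cnt) :
    Within procs leastSlack s (60 * M + 20) fun s' =>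
      EqOff (leastSlack.footprint searchFootprint) s s' ∧
      1 ≤ s'.natVar 23 ∧ s'.natVar 23 ≤ M ∧ s.natArr 6 (s'.natVar 23) = 0 ∧
      s'.realVar 8 = s.realArr 13 (s'.natVar 23) ∧
      ∀ j, 1 ≤ j → j ≤ M → s.natArr 6 j = 0 → s'.realVar 8 ≤ s.realArr 13 j := by
  refine Within.frame procs_footprint ?_
  refine Within.seq (t₁ := 2) (t₂ := 60 * M + 10) (Q₁ := fun s₁ => s₁ = s.setNat 23 0)
    (.flat rfl le_rfl rfl) ?_ (by omega)
  rintro _ rfl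
  refine (Within.forUp procs_footprint (t := 50) (fun c s' =>
    (s'.natVar 23 = 0 ∧ ∀ j, 1 ≤ j → j ≤ c → s.natArr 6 j ≠ 0) ∨
    (1 ≤ s'.natVar 23 ∧ s'.natVar 23 ≤ c ∧ s.natArr 6 (s'.natVar 23) = 0 ∧
      s'.realVar 8 = s.realArr 13 (s'.natVar 23) ∧
      ∀ j, 1 ≤ j → j ≤ c → s.natArr 6 j = 0 → s'.realVar 8 ≤ s.realArr 13 j))
    (n := M) (by simp [h.size]) (by decide) (by decide)
    (.inl ⟨by simp, fun j hj hj' => by omega⟩) ?_).mono (by omega) ?_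
  · intro c s₁ hc hi hE hI
    have hu : s₁.natArr 6 = s.natArr 6 := hE.natArr 6 (by decide)
    have hw : s₁.realArr 13 = s.realArr 13 := hE.realArr 13 (by decide)
    refine .flat rfl (by decide) ?_
    have split : ∀ {P : ℕ → Prop}, (∀ j, 1 ≤ j → j ≤ c → P j) → P (c + 1) →
        ∀ j, 1 ≤ j → j ≤ c + 1 → P j := fun h₁ h₂ j hj hj' => by
      rcases (by omega : j ≤ c ∨ j = c + 1) with hj' | rfl
      · exact h₁ j hj hj'
      · exact h₂
    rw [Cmd.eff]
    split_ifs with hb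
    · simp [col, hi, hu, hw] at hb
      refine .inr ?_
      simp only [Cmd.eff, col, NExp.eval, RExp.eval, hi, hw, Store.setNat_natVar, Store.setNat_realArr,
        Store.setReal_natVar, Store.setNat_realVar,
        Store.setReal_realVar]
      norm_num
      refine ⟨hb.1, split (fun j hj hj' hju => ?_) fun _ => le_rfl⟩
      rcases hI with ⟨-, hI⟩ | ⟨h₁, -, -, -, hI⟩
      · exact absurd hju (hI j hj hj')
      · exact (hb.2 h₁).le.trans (hI j hj hj' hju)
    · simp [col, hi, hu, hw] at hb
      rcases hI with ⟨h0, hI⟩ | ⟨h₁, h₂, h₃, h₄, hI⟩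
      · left
        refine ⟨by simpa using h0, split hI fun h6 => ?_⟩
        have := (hb h6).1
        omega
      · right
        refine ⟨by simpa using h₁, by simp; omega, by simpa using h₃, by simpa using h₄, ?_⟩
        exact split (by simpa using hI) fun h6 => by simpa using (hb h6).2
  · rintro s' ⟨-, ⟨-, hI⟩ | hI⟩
    · obtain ⟨j, hj, hj', hju⟩ := hP.exists_unused
      exact absurd hju (hI j hj hj')
    · exact hI

/-- Visited rows are reached through their columns, so the scan includes column 0, which holds the
row being inserted. By injectivity of `p` on the visited columns, no row potential is raised twice.
-/
theorem changePotentials_within (h : Setting M A s) (hP : StorePath M A k s cnt) {j₁ : ℕ}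
    (h₁ : 1 ≤ j₁) (h₁' : j₁ ≤ M) (hu : s.natArr 6 j₁ = 0) (hδ : s.realVar 8 = s.realArr 13 j₁)
    (hle : ∀ j, 1 ≤ j → j ≤ M → s.natArr 6 j = 0 → s.realVar 8 ≤ s.realArr 13 j) :
    Within procs changePotentials s (60 * M + 100) fun s' =>
      EqOff (changePotentials.footprint searchFootprint) s s' ∧
      StorePath M A k s' cnt ∧ s'.realArr 13 j₁ = 0 := by
  classical
  set δ := s.realVar 8 with hδ0
  refine (Within.forUp procs_footprint (t := 50) (fun c s' =>
    (∀ r, s'.realArr 11 r = if ∃ j < c, s.natArr 6 j ≠ 0 ∧ s.natArr 4 j = r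
      then s.realArr 11 r + δ else s.realArr 11 r) ∧
    (∀ j, s'.realArr 12 j = if j < c ∧ s.natArr 6 j ≠ 0 then s.realArr 12 j - δ
      else s.realArr 12 j) ∧
    ∀ j, s'.realArr 13 j = if j < c ∧ s.natArr 6 j = 0 then s.realArr 13 j - δ
      else s.realArr 13 j)
    h.size_succ (by decide) (by decide) (by simp) ?_).mono (by omega) ?_
  · intro c s₁ hc hi hE ⟨hIu, hIv, hIw⟩
    have hused : s₁.natArr 6 = s.natArr 6 := hE.natArr 6 (by decide)
    have hp : s₁.natArr 4 = s.natArr 4 := hE.natArr 4 (by decide)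
    have hδ₁ : s₁.realVar 8 = δ := hE.realVar 8 (by decide)
    refine .flat rfl (by decide) ?_
    rw [Cmd.eff]
    split_ifs with hb
    · simp [hi, hused] at hb
      have hcu : s.natArr 6 c ≠ 0 := by omega
      simp [hi, hp, hδ₁]
      refine ⟨fun r => ?_, fun j => ?_, fun j => ?_⟩
      · by_cases hr : r = s.natArr 4 c
        · subst hr
          rw [Function.update_self, hIu, if_neg, if_pos ⟨c, by omega, hcu, rfl⟩]
          rintro ⟨j, hj, hju, e⟩
          have := hP.inj j c (by omega) (by omega) (hP.matched j (by omega) hju) e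
          omega
        · rw [Function.update_of_ne hr, hIu]
          refine if_congr ⟨?_, ?_⟩ rfl rfl
          · rintro ⟨j, hj, hju, e⟩
            exact ⟨j, by omega, hju, e⟩
          · rintro ⟨j, hj, hju, rfl⟩
            refine ⟨j, ?_, hju, rfl⟩
            rcases (by omega : j < c ∨ j = c) with hj | rfl
            · exact hj
            · exact absurd rfl hr
      · by_cases hj : j = c
        · subst hj
          rw [Function.update_self, hIv, if_neg (by omega), if_pos ⟨by omega, hcu⟩]
        · rw [Function.update_of_ne hj, hIv]
          exact if_congr (by constructor <;> rintro ⟨h, h'⟩ <;> exact ⟨by omega, h'⟩) rfl rfl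
      · rw [hIw]
        refine if_congr ⟨fun ⟨h, h'⟩ => ⟨by omega, h'⟩, fun ⟨h, h'⟩ => ⟨?_, h'⟩⟩ rfl rfl
        rcases (by omega : j < c ∨ j = c) with hj | rfl
        · exact hj
        · exact absurd h' hcu
    · simp [hi, hused] at hb
      simp [hi, hδ₁]
      have aux : ∀ j, s.natArr 6 j ≠ 0 → (j ≤ c ↔ j < c) := fun j hju => by
        constructor
        · intro hj
          rcases (by omega : j < c ∨ j = c) with hj | rfl
          · exact hj
          · exact absurd hb hju
        · omega
      refine ⟨fun r => ?_, fun j => ?_, fun j => ?_⟩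
      · rw [hIu]
        refine if_congr ⟨?_, ?_⟩ rfl rfl
        · rintro ⟨j, hj, hju, e⟩
          exact ⟨j, (aux j hju).2 hj, hju, e⟩
        · rintro ⟨j, hj, hju, e⟩
          exact ⟨j, (aux j hju).1 hj, hju, e⟩
      · rw [hIv]
        exact if_congr ⟨fun ⟨h, h'⟩ => ⟨(aux j h').2 h, h'⟩, fun ⟨h, h'⟩ => ⟨(aux j h').1 h, h'⟩⟩
          rfl rfl
      · by_cases hj : j = c
        · subst hj
          rw [Function.update_self, hIw, if_neg (by omega), if_pos ⟨by omega, hb⟩]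
        · rw [Function.update_of_ne hj, hIw]
          exact if_congr (by constructor <;> rintro ⟨h, h'⟩ <;> exact ⟨by omega, h'⟩) rfl rfl
  · rintro s' ⟨hE, hIu, hIv, hIw⟩
    refine ⟨hE, ?_⟩
    have hused : s'.natArr 6 = s.natArr 6 := hE.natArr 6 (by decide)
    have hp : s'.natArr 4 = s.natArr 4 := hE.natArr 4 (by decide)
    have hway : s'.natArr 5 = s.natArr 5 := hE.natArr 5 (by decide)
    rw [StorePath, hused, hp, hway]
    refine Path.update hP h₁ h₁' hu hδ hle (fun r => ?_) (fun j hj hj' => ?_) fun j hj hj' => ?_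
    · rw [hIu]
      simp only [Nat.lt_succ_iff]
    · rw [hIv]
      simp [hj']
    · rw [hIw]
      by_cases hju : s.natArr 6 j = 0 <;> simp [hj', hju]

/-- The column is marked before the scan, so its own predecessor is preserved. The invariant also
says that entries not yet scanned, or belonging to visited columns, are the old ones; this is the
form that `Path.visit` needs. -/
theorem visitCmd_within (h : Setting M A s) (hP : StorePath M A k s cnt)
    (h₁ : 1 ≤ s.natVar 22) (h₁' : s.natVar 22 ≤ M) (hu : s.natArr 6 (s.natVar 22) = 0)
    (hw : s.realArr 13 (s.natVar 22) = 0) (hp : s.natArr 4 (s.natVar 22) ≠ 0)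
    (hc : s.natVar 25 = cnt) :
    Within procs visitCmd s (80 * M + 60) fun s' =>
      EqOff (visitCmd.footprint searchFootprint) s s' ∧
      s'.natVar 25 = cnt + 1 ∧ StorePath M A k s' (cnt + 1) := by
  refine Within.frame procs_footprint ?_
  set j₁ := s.natVar 22 with hj₁
  set r := s.natArr 4 j₁ with hr
  have hrM : r ≤ M := (hP.range j₁ h₁').trans hP.le
  refine Within.seq (t₁ := 40) (t₂ := 80 * M + 20) (Q₁ := fun s₁ => s₁.natVar 0 = M ∧
    s₁.natVar 22 = j₁ ∧ s₁.natVar 25 = cnt + 1 ∧ s₁.natVar 26 = r * M ∧ s₁.natVar 27 = r ∧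
    s₁.natArr 4 = s.natArr 4 ∧ s₁.natArr 5 = s.natArr 5 ∧
    s₁.natArr 6 = Function.update (s.natArr 6) j₁ (cnt + 1) ∧
    s₁.realArr = s.realArr)
    (.flat rfl (by decide) (by simp [← hj₁, h.size, hc, ← hr, h.mult r hrM])) ?_ (by omega)
  rintro s₁ ⟨a₁, b₁, c₁, d₁, e₁, f₁, g₁, i₁, k₁⟩
  refine (Within.forUp procs_footprint (t := 70) (fun c s' =>
    (∀ j, 1 ≤ j → j ≤ c → s₁.natArr 6 j = 0 →
      (matrix M A r j - s.realArr 11 r - s.realArr 12 j < s.realArr 13 j ∧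
        s'.realArr 13 j = matrix M A r j - s.realArr 11 r - s.realArr 12 j ∧ s'.natArr 5 j = j₁) ∨
      (s.realArr 13 j ≤ matrix M A r j - s.realArr 11 r - s.realArr 12 j ∧
        s'.realArr 13 j = s.realArr 13 j ∧ s'.natArr 5 j = s.natArr 5 j)) ∧
    ∀ j, (c < j ∨ s₁.natArr 6 j ≠ 0) →
      s'.natArr 5 j = s.natArr 5 j ∧ s'.realArr 13 j = s.realArr 13 j)
    a₁ (by decide) (by decide) ?_ ?_).mono (by omega) ?_
  · refine ⟨fun j hj hj' => by omega, fun j _ => ?_⟩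
    simp [g₁, k₁]
  · intro c s₂ hc hi hE ⟨hI, hJ⟩
    have b₂ := (hE.natVar 22 (by decide)).trans b₁
    have d₂ := (hE.natVar 26 (by decide)).trans d₁
    have e₂ := (hE.natVar 27 (by decide)).trans e₁
    have i₂ : s₂.natArr 6 = s₁.natArr 6 := hE.natArr 6 (by decide)
    have r9 : s₂.realArr 9 = A := by rw [hE.realArr 9 (by decide), k₁, h.cost]
    have r11 : s₂.realArr 11 = s.realArr 11 := by rw [hE.realArr 11 (by decide), k₁]
    have r12 : s₂.realArr 12 = s.realArr 12 := by rw [hE.realArr 12 (by decide), k₁]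
    obtain ⟨hc₁, hc₂⟩ := hJ (c + 1) (.inl (by omega))
    refine .flat rfl (by decide) ?_
    rw [Cmd.eff, Cmd.eff, Cmd.eff]
    split_ifs with hb
    · simp [col, hi, d₂, e₂, i₂, r9, r11, r12, hc₂] at hb
      refine ⟨fun j hj hj' hju => ?_, fun j hj => ?_⟩
      · rcases (by omega : j ≤ c ∨ j = c + 1) with hj' | rfl
        · have : j ≠ c + 1 := by omega
          simpa [col, hi, d₂, e₂, r9, r11, r12, b₂, Function.update_of_ne this] using
            hI j hj hj' hju
        · left
          simp [col, hi, d₂, e₂, r9, r11, r12, b₂, matrix, hb.2]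
      · have : j ≠ c + 1 := by
          rintro rfl
          rcases hj with hj | hj
          · omega
          · exact hj hb.1
        simpa [col, hi, d₂, e₂, r9, r11, r12, b₂, Function.update_of_ne this] using
          hJ j (hj.imp_left fun hj => by omega)
    · simp [col, hi, d₂, e₂, i₂, r9, r11, r12, hc₂] at hb
      refine ⟨fun j hj hj' hju => ?_, fun j hj => ?_⟩
      · rcases (by omega : j ≤ c ∨ j = c + 1) with hj' | rfl
        · simpa using hI j hj hj' hju
        · right
          simpa [matrix, hc₁, hc₂] using hb hju
      · simpa using hJ j (hj.imp_left fun hj => by omega)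
  · rintro s' ⟨hE, hI, hJ⟩
    refine ⟨(hE.natVar 25 (by decide)).trans c₁, ?_⟩
    have hused : s'.natArr 6 = s₁.natArr 6 := hE.natArr 6 (by decide)
    have hp' : s'.natArr 4 = s.natArr 4 := by rw [hE.natArr 4 (by decide), f₁]
    have r11 : s'.realArr 11 = s.realArr 11 := by rw [hE.realArr 11 (by decide), k₁]
    have r12 : s'.realArr 12 = s.realArr 12 := by rw [hE.realArr 12 (by decide), k₁]
    rw [StorePath, hused, hp', r11, r12]
    exact Path.visit hP h₁ h₁' hu hw hp (fun j => by rw [i₁, Function.update_apply]) hI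
      fun j _ _ hju => (hJ j (.inr hju)).1

/-- Every round either reaches a free column or visits a new one. As long as the search goes on,
`cnt + f = M + 1` counts the rounds left; it starts with `cnt = 1` and `f = M`, and `Path.cnt_le`
keeps it from running out. -/
theorem pathLoop_within (h : Setting M A s) (h22 : s.natVar 22 = 0) (h25 : s.natVar 25 = 1)
    (hP : StorePath M A k s 1) :
    Within procs pathLoop s ((M + 1) * (200 * M + 220)) fun s' =>
      EqOff (pathLoop.footprint searchFootprint) s s' ∧
      ∃ cnt, StorePath M A k s' cnt ∧ cnt ≤ M ∧ 1 ≤ s'.natVar 22 ∧ s'.natVar 22 ≤ M ∧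
        s'.natArr 6 (s'.natVar 22) = 0 ∧ s'.realArr 13 (s'.natVar 22) = 0 ∧
        s'.natArr 4 (s'.natVar 22) = 0 := by
  refine Within.frame procs_footprint ?_
  have key := Within.loop (procs := procs) (t := 200 * M + 200)
    (b := .natLt (.lit 0) (.get 4 (.var 22)))
    (body := block [leastSlack, changePotentials, .setNat 22 (.var 23),
      .ite (.natLt (.lit 0) (.get 4 (.var 22))) visitCmd .skip])
    (Inv := fun f s' => Setting M A s' ∧ ∃ cnt, StorePath M A k s' cnt ∧ s'.natVar 25 = cnt ∧
      (s'.natArr 4 (s'.natVar 22) ≠ 0 → cnt + f = M + 1) ∧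
      (s'.natArr 4 (s'.natVar 22) = 0 → 1 ≤ s'.natVar 22 ∧ s'.natVar 22 ≤ M ∧
        s'.natArr 6 (s'.natVar 22) = 0 ∧ s'.realArr 13 (s'.natVar 22) = 0)) ?_ M s
    ⟨h, 1, hP, h25, fun _ => by omega, fun h0 => ?_⟩
  · refine key.mono ?_ ?_
    · simp only [BExp.cost, NExp.cost]
      ring_nf
      omega
    · rintro s' ⟨hb, f, -, cnt, hP', -, -, hI⟩
      simp only [BExp.holds, NExp.eval] at hb
      have h0 : s'.natArr 4 (s'.natVar 22) = 0 := by omega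
      obtain ⟨h₁, h₂, h₃, h₄⟩ := hI h0
      have hle := hP'.cnt_le
      have hle' := hP'.le
      exact ⟨cnt, hP', by omega, h₁, h₂, h₃, h₄, h0⟩
  · rintro f s₁ ⟨hS, cnt, hP₁, h25₁, hf, -⟩ hb
    simp only [BExp.holds, NExp.eval] at hb
    have hf := hf (by omega)
    have hcnt := hP₁.cnt_le
    have hkM := hP₁.le
    refine ⟨f - 1, by omega, ?_⟩
    simp only [block]
    refine (leastSlack_within hS hP₁).seq (t₂ := 140 * M + 180) ?_ (by omega)
    rintro s₂ ⟨hE₂, hj, hj', hju, hδ, hle⟩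
    have u₂ : s₂.natArr 6 = s₁.natArr 6 := hE₂.natArr 6 (by decide)
    have w₂ : s₂.realArr 13 = s₁.realArr 13 := hE₂.realArr 13 (by decide)
    have hP₂ : StorePath M A k s₂ cnt := by
      rw [StorePath, u₂, w₂, hE₂.natArr 4 (by decide), hE₂.natArr 5 (by decide),
        hE₂.realArr 11 (by decide), hE₂.realArr 12 (by decide)]
      exact hP₁
    have hS₂ := hS.of_eqOff hE₂ (by decide)
    rw [← u₂] at hju hle
    rw [← w₂] at hδ hle
    refine (changePotentials_within hS₂ hP₂ hj hj' hju hδ hle).seq (t₂ := 80 * M + 80) ?_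
      (by omega)
    rintro s₃ ⟨hE₃, hP₃, hw₃⟩
    have hS₃ := hS₂.of_eqOff hE₃ (by decide)
    have j₃ : s₃.natVar 23 = s₂.natVar 23 := hE₃.natVar 23 (by decide)
    have c₃ : s₃.natVar 25 = cnt := by
      rw [hE₃.natVar 25 (by decide), hE₂.natVar 25 (by decide), h25₁]
    have u₃ : s₃.natArr 6 = s₂.natArr 6 := hE₃.natArr 6 (by decide)
    rw [← j₃] at hj hj' hju hw₃
    rw [← u₃] at hju
    refine Within.seq (t₁ := 2) (t₂ := 80 * M + 70)
      (Q₁ := fun s₄ => s₄ = s₃.setNat 22 (s₃.natVar 23)) (.flat rfl (by decide) rfl) ?_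
      (by omega)
    rintro _ rfl
    have hS₄ : Setting M A (s₃.setNat 22 (s₃.natVar 23)) :=
      ⟨by simpa using hS₃.size, by simpa using hS₃.size_succ, hS₃.cost, hS₃.mult⟩
    refine Within.ite (t₁ := 80 * M + 60) (fun hb' => ?_) (fun hb' => ?_)
      (by simp only [BExp.cost, NExp.cost]; omega)
    · simp at hb'
      refine (visitCmd_within hS₄ (cnt := cnt) (k := k) hP₃ (by simpa using hj)
        (by simpa using hj') (by simpa using hju) (by simpa using hw₃) (by simp; omega)
        (by simpa using c₃)).mono le_rfl ?_
      rintro s₅ ⟨hE₅, h25₅, hP₅⟩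
      refine ⟨hS₄.of_eqOff hE₅ (by decide), cnt + 1, hP₅, h25₅, fun _ => by omega, fun h0 => ?_⟩
      rw [hE₅.natVar 22 (by decide), hE₅.natArr 4 (by decide)] at h0
      simp at h0
      omega
    · simp at hb'
      refine .flat rfl (by simp only [Cmd.time]; omega) ?_
      refine ⟨hS₄, cnt, hP₃, by simpa using c₃, fun hne => ?_, fun _ => ?_⟩
      · simp [hb'] at hne
      · simpa using ⟨hj, hj', hju, hw₃⟩
  · have := hP.root
    have := hP.pos
    rw [h22] at h0
    omega

/-- The order of the hole decreases strictly, so it bounds the number of rounds. -/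
theorem augmentLoop_within {ord : ℕ → ℕ} {f : ℕ} (hord : ord (s.natVar 22) ≤ f)
    (hA : Augment M (matrix M A) k (s.realArr 11) (s.realArr 12) (s.natArr 4) (s.natArr 5) ord
      (s.natVar 22)) :
    Within procs augmentLoop s (f * 20 + 20) fun s' =>
      EqOff (augmentLoop.footprint searchFootprint) s s' ∧
      Partial M (matrix M A) k (s'.realArr 11) (s'.realArr 12) (s'.natArr 4) := by
  refine Within.frame procs_footprint ?_
  have key := Within.loop (procs := procs) (t := 10)
    (b := .natLt (.lit 0) (.var 22))
    (body := .seq (.putNat 4 (.var 22) (.get 4 (.get 5 (.var 22))))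
      (.setNat 22 (.get 5 (.var 22))))
    (Inv := fun f s' => ord (s'.natVar 22) ≤ f ∧
      Augment M (matrix M A) k (s'.realArr 11) (s'.realArr 12) (s'.natArr 4) (s'.natArr 5) ord
        (s'.natVar 22)) ?_ f s ⟨hord, hA⟩
  · refine key.mono ?_ ?_
    · simp only [BExp.cost, NExp.cost]
      omega
    · rintro s' ⟨hb, f, -, hA'⟩
      simp only [BExp.holds, NExp.eval, not_lt, Nat.le_zero] at hb
      rw [hb] at hA'
      exact hA'.partial
  · rintro f s₁ ⟨hf, hA₁⟩ hb
    simp only [BExp.holds, NExp.eval] at hb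
    have hlt := hA₁.way_lt _ hb hA₁.hole le_rfl
    refine ⟨f - 1, by omega, .flat rfl (by decide) ?_⟩
    have := hA₁.step hb (p' := Function.update (s₁.natArr 4) (s₁.natVar 22)
      (s₁.natArr 4 (s₁.natArr 5 (s₁.natVar 22)))) fun i => by rw [Function.update_apply]
    refine ⟨?_, ?_⟩
    · simp
      omega
    · simpa using this

theorem multiplesCmd_within (s : Store) (h0 : s.natArr 7 0 = 0) :
    Within procs multiplesCmd s (50 * s.natVar 0 + 20) fun s' =>
      EqOff (multiplesCmd.footprint searchFootprint) s s' ∧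
      s'.natVar 28 = s.natVar 0 + 1 ∧ ∀ r ≤ s.natVar 0, s'.natArr 7 r = r * s.natVar 0 := by
  refine Within.frame procs_footprint ?_
  refine Within.seq (t₁ := 4) (t₂ := 50 * s.natVar 0 + 10)
    (Q₁ := fun s₁ => s₁ = s.setNat 28 (s.natVar 0 + 1)) (.flat rfl (by decide) (by simp)) ?_
    (by omega)
  rintro _ rfl
  refine (Within.forUp procs_footprint (t := 20) (n := s.natVar 0)
    (fun c s' => ∀ r ≤ c, s'.natArr 7 r = r * s.natVar 0) (by simp)
    (by decide) (by decide) (by simpa using h0) ?_).mono (by omega) ?_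
  · intro c s₁ hc hi hE hI
    have h0₁ : s₁.natVar 0 = s.natVar 0 := by rw [hE.natVar 0 (by decide)]; simp
    refine .flat rfl (by decide) fun r hr => ?_
    rcases (by omega : r ≤ c ∨ r = c + 1) with hr' | rfl
    · have : r ≠ c + 1 := by omega
      simp [col, hi, Function.update_of_ne this, hI r hr']
    · simp [col, hi, hI c le_rfl, h0₁]
      ring
  · rintro s' ⟨hE, hI⟩
    exact ⟨by rw [hE.natVar 28 (by decide)]; simp, hI⟩

/-- The invariant is a partial matching of the rows inserted so far. An insertion consists of at
most `M` search rounds of cost `O(M)` and a path of length `O(M)`, and there are `M` insertions. -/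
theorem hungarianCmd_within (s : Store) (hM : s.natVar 0 = M) (hpos : 0 < M)
    (hA : ∀ r j, 1 ≤ r → r ≤ M → 1 ≤ j → j ≤ M → 0 ≤ matrix M (s.realArr 9) r j)
    (h7 : s.natArr 7 0 = 0) (hp : ∀ j, s.natArr 4 j = 0) (hu : ∀ r, s.realArr 11 r = 0)
    (hv : ∀ j, s.realArr 12 j = 0) :
    Within procs hungarianCmd s (3000 * M ^ 3) fun s' =>
      EqOff (hungarianCmd.footprint searchFootprint) s s' ∧
      (∀ r ≤ M, s'.natArr 7 r = r * M) ∧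
      Partial M (matrix M (s.realArr 9)) M (s'.realArr 11) (s'.realArr 12) (s'.natArr 4) := by
  refine Within.frame procs_footprint ?_
  have hM1 : M ≤ M ^ 3 := Nat.le_self_pow (by norm_num) M
  have hM2 : M ^ 2 ≤ M ^ 3 := Nat.pow_le_pow_right hpos (by norm_num)
  refine (multiplesCmd_within s h7).seq (t₂ := 200 * M ^ 3 + 700 * M ^ 2 + 800 * M + 100) ?_
    (by rw [hM]; omega)
  rintro s₁ ⟨hE₁, h28, hmult⟩
  rw [hM] at h28 hmult
  have hM₁ : s₁.natVar 0 = M := by rw [hE₁.natVar 0 (by decide), hM]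
  have c₁ : s₁.realArr 9 = s.realArr 9 := hE₁.realArr 9 (by decide)
  have hS₁ : Setting M (s.realArr 9) s₁ := ⟨hM₁, h28, c₁, hmult⟩
  refine (Within.forUp procs_footprint (n := M)
    (t := (100 * M + 100) + ((M + 1) * (200 * M + 220) + ((M + 1) * 20 + 20)))
    (fun k s' => Partial M (matrix M (s.realArr 9)) k (s'.realArr 11) (s'.realArr 12)
      (s'.natArr 4))
    hM₁ (by decide) (by decide) ?_ ?_).mono ?_ ?_
  · refine Partial.empty hA (fun r => ?_) (fun j => ?_) (fun j => ?_)
    · rw [Store.setNat_realArr, hE₁.realArr 11 (by decide), hu]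
    · rw [Store.setNat_realArr, hE₁.realArr 12 (by decide), hv]
    · rw [Store.setNat_natArr, hE₁.natArr 4 (by decide), hp]
  · intro k s₂ hk hi hE hP
    have hS₂ := hS₁.of_eqOff hE (by decide)
    simp only [block]
    refine (initPath_within hS₂ hi hk hP).seq ?_ le_rfl
    rintro s₃ ⟨hE₃, h22₃, h25₃, hP₃⟩
    have hS₃ := hS₂.of_eqOff hE₃ (by decide)
    refine (pathLoop_within hS₃ h22₃ h25₃ hP₃).seq ?_ le_rfl
    rintro s₄ ⟨hE₄, cnt, hP₄, hcnt, h₁, h₂, h₃, h₄, h₅⟩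
    obtain ⟨ord, hord, hA₄⟩ := Path.augment hP₄ h₁ h₂ h₃ h₄ h₅
    exact (augmentLoop_within (f := M + 1) (by omega) hA₄).mono le_rfl fun s₅ h => h.2
  · nlinarith
  · rintro s' ⟨hE, hP⟩
    exact ⟨(hS₁.of_eqOff hE (by decide)).mult, hP⟩

end RealRAM

namespace MPCA

/-! ### Blocks -/

variable {M N K : ℕ}

/-- The channels `j * K, …, j * K + K - 1`. -/
def tile (N K j : ℕ) : Finset (Fin N) := Finset.univ.filter fun n => (n : ℕ) / K = j

theorem mem_tile (hK : 0 < K) {j : ℕ} {n : Fin N} :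
    n ∈ tile N K j ↔ j * K ≤ n ∧ (n : ℕ) < j * K + K := by
  rw [tile, Finset.mem_filter, Nat.div_eq_iff hK]
  simp only [Finset.mem_univ, true_and]
  omega

theorem sum_tile (hK : 0 < K) (hN : N = M * K) {j : ℕ} (hj : j < M) (f : Fin N → ℝ) (h : ℕ → ℝ)
    (hf : ∀ n : Fin N, f n = h n) :
    ∑ n ∈ tile N K j, f n = ∑ i ∈ Finset.range K, h (j * K + i) := by
  have hle : j * K + K ≤ N := by
    rw [hN, ← Nat.succ_mul]
    exact Nat.mul_le_mul_right K hj
  refine Finset.sum_bij' (fun n _ => (n : ℕ) - j * K)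
    (fun i hi => ⟨j * K + i, by rw [Finset.mem_range] at hi; omega⟩) ?_ ?_ ?_ ?_ ?_
  · intro n hn
    rw [mem_tile hK] at hn
    rw [Finset.mem_range]
    omega
  · intro i hi
    rw [Finset.mem_range] at hi
    rw [mem_tile hK]
    simp [hi]
  · intro n hn
    rw [mem_tile hK] at hn
    ext
    simp only
    omega
  · intro i hi
    simp
  · intro n hn
    rw [mem_tile hK] at hn
    rw [hf, Nat.add_sub_cancel' hn.1]

theorem card_tile (hK : 0 < K) (hN : N = M * K) {j : ℕ} (hj : j < M) : (tile N K j).card = K := by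
  have := sum_tile hK hN hj (fun _ => 1) (fun _ => 1) (fun _ => rfl)
  simpa using this

theorem ordConnected_tile (hK : 0 < K) (j : ℕ) : (tile N K j : Set (Fin N)).OrdConnected := by
  refine ⟨fun a ha b hb c hc => ?_⟩
  rw [Finset.mem_coe, mem_tile hK] at ha hb ⊢
  have h₁ : (a : ℕ) ≤ c := hc.1
  have h₂ : (c : ℕ) ≤ b := hc.2
  omega

/-- An order-connected finite set is the interval from its minimum to its maximum, and the
cardinality fixes the length. -/
theorem exists_interval {s : Finset (Fin N)} (hK : 0 < K) (hcard : s.card = K)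
    (hs : (s : Set (Fin N)).OrdConnected) :
    ∃ a : ℕ, a + K ≤ N ∧ ∀ n : Fin N, n ∈ s ↔ a ≤ n ∧ (n : ℕ) < a + K := by
  have hne : s.Nonempty := Finset.card_pos.1 (by omega)
  have heq : s = Finset.Icc (s.min' hne) (s.max' hne) := by
    ext n
    rw [Finset.mem_Icc]
    exact ⟨fun hn => ⟨s.min'_le n hn, s.le_max' n hn⟩,
      fun hn => hs.out (s.min'_mem hne) (s.max'_mem hne) hn⟩
  have hc : (s.max' hne : ℕ) + 1 - s.min' hne = K := by
    rw [← Fin.card_Icc, ← heq, hcard]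
  have hb := (s.max' hne).isLt
  refine ⟨s.min' hne, by omega, fun n => ?_⟩
  conv_lhs => rw [heq]
  rw [Finset.mem_Icc, Fin.le_def, Fin.le_def]
  omega

/-- Disjoint blocks of `N / M` consecutive channels are tiles. -/
theorem exists_tiles (hK : 0 < K) (hN : N = M * K) (ch : Fin M → Finset (Fin N))
    (hd : ∀ m₁ m₂, m₁ ≠ m₂ → Disjoint (ch m₁) (ch m₂)) (hcard : ∀ m, (ch m).card = K)
    (hs : ∀ m, (ch m : Set (Fin N)).OrdConnected) :
    ∃ σ : Fin M → Fin M, Function.Bijective σ ∧ ∀ m, ch m = tile N K (σ m) := by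
  choose a haN ha using fun m => exists_interval hK (hcard m) (hs m)
  have hcover : ∀ n : Fin N, ∃ m, n ∈ ch m := by
    -- Counting: disjoint sets with `M * K = N` elements in total leave no channel out.
    have huniv : Finset.univ.biUnion ch = Finset.univ := by
      rw [← Finset.card_eq_iff_eq_univ, Finset.card_biUnion fun m₁ _ m₂ _ h => hd m₁ m₂ h]
      simp [hcard, hN]
    intro n
    have : n ∈ Finset.univ.biUnion ch := by rw [huniv]; exact Finset.mem_univ n
    simpa using this
  have hunique : ∀ n m₁ m₂, n ∈ ch m₁ → n ∈ ch m₂ → m₁ = m₂ := fun n m₁ m₂ h₁ h₂ => by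
    by_contra hne
    exact Finset.disjoint_left.1 (hd m₁ m₂ hne) h₁ h₂
  -- Suppose the block containing channel `j * K` started earlier, at `a`. By induction some block
  -- starts at the multiple `a / K * K`; it contains channel `a`, so it is the same block and `a` is
  -- that multiple. But then it ends before `j * K`.
  have hstart : ∀ j, j < M → ∃ m, a m = j * K := by
    intro j
    induction j using Nat.strong_induction_on with
    | _ j ih =>
      intro hj
      have hjK : j * K < N := by
        rw [hN]
        exact Nat.mul_lt_mul_of_pos_right hj hK
      obtain ⟨m, hm⟩ := hcover ⟨j * K, hjK⟩
      refine ⟨m, ?_⟩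
      have hm' := (ha m _).1 hm
      simp only at hm'
      by_contra hne
      have hlt : a m < j * K := by omega
      have hj' : a m / K < j := (Nat.div_lt_iff_lt_mul hK).2 hlt
      obtain ⟨m', hm''⟩ := ih (a m / K) hj' (by omega)
      have hdiv := Nat.div_add_mod' (a m) K
      have hmod := Nat.mod_lt (a m) hK
      have hle : (a m / K + 1) * K ≤ j * K := Nat.mul_le_mul_right K hj'
      rw [Nat.succ_mul] at hle
      have e : m' = m := hunique ⟨a m, by omega⟩ m' m
        ((ha m' _).2 (by simp only; omega)) ((ha m _).2 (by simp only; omega))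
      rw [e] at hm''
      omega
  choose τ hτ using fun j : Fin M => hstart j j.isLt
  have hinj : Function.Injective τ := fun i j e => by
    have h₁ := hτ i
    rw [e, hτ j] at h₁
    exact Fin.ext (Nat.eq_of_mul_eq_mul_right hK h₁).symm
  let e := Equiv.ofBijective τ (Finite.injective_iff_bijective.1 hinj)
  refine ⟨e.symm, e.symm.bijective, fun m => ?_⟩
  have hm : a m = (e.symm m : ℕ) * K := by
    rw [← hτ]
    exact congrArg a (e.apply_symm_apply m).symm
  ext n
  rw [ha, mem_tile hK, hm]

/-! ### From the contents of the store to solutions of the instance. -/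

theorem encode_gain (I : MPCA M N) (m : Fin M) (n : Fin N) :
    I.encode.realArr 0 (m * N + n) = I.gain m n := by
  have hlt : (m : ℕ) * N + n < M * N := by
    have := Nat.mul_le_mul_right N m.isLt
    rw [Nat.succ_mul] at this
    omega
  have h₁ : Fin.divNat (⟨m * N + n, hlt⟩ : Fin (M * N)) = m := by
    ext
    simp only [Fin.coe_divNat]
    rw [mul_comm, Nat.mul_add_div (by omega), Nat.div_eq_of_lt n.isLt, add_zero]
  have h₂ : Fin.modNat (⟨m * N + n, hlt⟩ : Fin (M * N)) = n := by
    ext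
    simp only [Fin.coe_modNat]
    rw [mul_comm, Nat.mul_add_mod, Nat.mod_eq_of_lt n.isLt]
  simp [encode, hlt, h₁, h₂]

theorem encode_target (I : MPCA M N) (m : Fin M) : I.encode.realArr 1 m = I.target m := by
  simp [encode]

open RealRAM in
/-- What water-filling achieves for user `m` on the block `j`. -/
theorem waterfill_block (I : MPCA M N) (hK : 0 < K) (hN : N = M * K) (m j : Fin M) {ν : ℝ}
    (hν : IsLevel (I.encode.realArr 0) ((m * M + j) * K) K (I.target m * Real.log 2) ν) :
    I.target m ≤ ∑ n ∈ tile N K j,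
      Real.logb 2 (1 + max (ν - 1 / I.gain m n) 0 * I.gain m n) ∧
    ∑ n ∈ tile N K j, max (ν - 1 / I.gain m n) 0
      = fillPower (I.encode.realArr 0) ((m * M + j) * K) K ν ∧
    ∀ P : Fin N → ℝ, (∀ n ∈ tile N K j, 0 ≤ P n) →
      I.target m ≤ ∑ n ∈ tile N K j, Real.logb 2 (1 + P n * I.gain m n) →
      fillPower (I.encode.realArr 0) ((m * M + j) * K) K ν ≤ ∑ n ∈ tile N K j, P n := by
  obtain ⟨μ, rfl, hμ⟩ := hν
  have hlog : 0 < Real.log 2 := Real.log_pos one_lt_two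
  have hidx : (m * M + j : ℕ) * K = m * N + j * K := by
    rw [hN]
    ring
  rw [hidx] at hμ ⊢
  set G := I.encode.realArr 0 with hG
  have hgain : ∀ n : Fin N, I.gain m n = G (m * N + n) := fun n => (I.encode_gain m n).symm
  have hpos : ∀ i ∈ Finset.range K, 0 < G (m * N + j * K + i) := by
    intro i hi
    rw [Finset.mem_range] at hi
    have hle : (j : ℕ) * K + i < N := by
      have := Nat.mul_le_mul_right K j.isLt
      rw [hN]
      rw [Nat.succ_mul] at this
      omega
    have := hgain ⟨j * K + i, hle⟩
    rw [add_assoc, ← this]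
    exact I.gain_pos _ _
  obtain ⟨h₁, h₂⟩ := waterfill (Finset.range K) _ hpos hμ
  refine ⟨?_, ?_, fun P hP hT => ?_⟩
  · rw [sum_tile hK hN j.isLt _ (fun n => Real.log (1 + max (Real.exp μ - 1 / G (m * N + n)) 0 *
      G (m * N + n)) / Real.log 2) (fun n => by rw [hgain]; rfl), ← Finset.sum_div, le_div_iff₀ hlog]
    simpa only [add_assoc] using h₁
  · rw [sum_tile hK hN j.isLt _ (fun n => max (Real.exp μ - 1 / G (m * N + n)) 0)
      (fun n => by rw [hgain])]
    simp only [fillPower, add_assoc]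
  -- The default value is never read, since tiles lie within the range of channels.
  · set P' : ℕ → ℝ := fun n => if h : n < N then P ⟨n, h⟩ else 0 with hP'
    have hPP : ∀ n : Fin N, P n = P' n := fun n => by simp [hP']
    rw [sum_tile hK hN j.isLt _ P' hPP]
    rw [sum_tile hK hN j.isLt _ (fun n => Real.log (1 + P' n * G (m * N + n)) / Real.log 2)
      (fun n => by rw [hgain, hPP]; rfl), ← Finset.sum_div, le_div_iff₀ hlog] at hT
    refine h₂ (fun i => P' (j * K + i)) (fun i hi => ?_) (by simpa only [add_assoc] using hT)
    rw [Finset.mem_range] at hi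
    have hle : (j : ℕ) * K + i < N := by
      have := Nat.mul_le_mul_right K j.isLt
      rw [hN]
      rw [Nat.succ_mul] at this
      omega
    have := hP ⟨j * K + i, hle⟩ ((mem_tile hK).2 (by simp [hi]))
    rwa [hPP] at this

open RealRAM Assignment in
/-- An optimal assignment of users to blocks gives an optimal solution. -/
theorem uniformBlockOptimal_decode (I : MPCA M N) (hK : 0 < K) (hN : N = M * K) (hM : 0 < M)
    {cost lev u v : ℕ → ℝ} {p : ℕ → ℕ} {s : Store}
    (htable : ∀ c < M * M,
      IsLevel (I.encode.realArr 0) (c * K) K (I.encode.realArr 1 (c / M) * Real.log 2)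
        (lev (M + 1 + c)) ∧
      cost (M + 1 + c) = fillPower (I.encode.realArr 0) (c * K) K (lev (M + 1 + c)))
    (hp : Partial M (matrix M cost) M u v p)
    (huser : ∀ n < N, s.natArr 0 n = p (n / K + 1) - 1)
    (hpower : ∀ n < N, s.realArr 2 n = max (lev (p (n / K + 1) * M + (n / K + 1)) -
      1 / I.encode.realArr 0 ((p (n / K + 1) - 1) * N + n)) 0) :
    I.UniformBlockOptimal (decode M N s) := by
  obtain ⟨q, hq, hqp⟩ := hp.bijective
  have hcell : ∀ m j : Fin M, ((m : ℕ) + 1) * M + (j + 1) = M + 1 + (m * M + j) := fun m j => by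
    ring
  have hindex : ∀ m j : Fin M, (m * M + j : ℕ) < M * M := fun m j => by
    have := Nat.mul_le_mul_right M m.isLt
    rw [Nat.succ_mul] at this
    omega
  have hlev : ∀ m j : Fin M, IsLevel (I.encode.realArr 0) ((m * M + j) * K) K
      (I.target m * Real.log 2) (lev (M + 1 + (m * M + j))) := fun m j => by
    have := (htable _ (hindex m j)).1
    rwa [show (m * M + j : ℕ) / M = m by
      rw [mul_comm, Nat.mul_add_div hM, Nat.div_eq_of_lt j.isLt, add_zero], encode_target] at this
  have hcost : ∀ m j : Fin M, matrix M cost (m + 1) (j + 1) =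
      fillPower (I.encode.realArr 0) ((m * M + j) * K) K (lev (M + 1 + (m * M + j))) :=
    fun m j => by
      rw [matrix, hcell]
      exact (htable _ (hindex m j)).2
  have hchan : ∀ j : Fin M, (decode M N s).channels (q j) = tile N K j := by
    intro j
    ext n
    have hnM : (n : ℕ) / K < M := Nat.div_lt_of_lt_mul (by rw [mul_comm, ← hN]; exact n.isLt)
    have hn := hqp ⟨n / K, hnM⟩
    simp only at hn
    simp only [decode, Finset.mem_filter, Finset.mem_univ, true_and, tile]
    rw [huser n n.isLt, ← hn, Nat.add_sub_cancel, Fin.val_inj, hq.injective.eq_iff, Fin.ext_iff]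
  have hpow : ∀ j : Fin M, ∀ n ∈ tile N K j, (decode M N s).power (q j) n
      = max (lev (M + 1 + (q j * M + j)) - 1 / I.gain (q j) n) 0 := by
    intro j n hn
    have hn' : (n : ℕ) / K = j := by simpa [tile] using hn
    rw [decode]
    simp only
    rw [hpower n n.isLt, hn', ← hqp, hcell, Nat.add_sub_cancel, encode_gain]
  have hwater := fun j => waterfill_block I hK hN (q j) j (hlev (q j) j)
  have hNM : N / M = K := by rw [hN, Nat.mul_div_cancel_left K hM]
  refine ⟨⟨⟨fun m₁ m₂ hne => ?_, fun m => ?_, fun m => ?_⟩, fun m => ?_, fun m => ?_⟩,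
    fun S' hS' => ?_⟩
  · rw [Finset.disjoint_left]
    intro n h₁ h₂
    simp only [decode, Finset.mem_filter, Finset.mem_univ, true_and] at h₁ h₂
    exact hne (Fin.ext (h₁.symm.trans h₂))
  · obtain ⟨j, rfl⟩ := hq.surjective m
    intro n hn
    rw [hchan] at hn
    rw [hpow j n hn]
    exact le_max_right _ _
  · obtain ⟨j, rfl⟩ := hq.surjective m
    rw [hchan, Finset.sum_congr rfl fun n hn => by rw [hpow j n hn]]
    exact (hwater j).1
  · obtain ⟨j, rfl⟩ := hq.surjective m
    rw [hchan, card_tile hK hN j.isLt, hNM]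
  · obtain ⟨j, rfl⟩ := hq.surjective m
    rw [hchan]
    exact ordConnected_tile hK _
  -- A competitor is a bijection `σ` with some powers. Each user pays at least the table entry for
  -- its tile, and the matching minimizes the sum of these entries.
  · obtain ⟨σ, hσ, htile⟩ := exists_tiles hK hN S'.channels hS'.disjoint
      (fun m => (hS'.card_eq m).trans hNM) hS'.consecutive
    calc (decode M N s).totalPower
        = ∑ j : Fin M, matrix M cost (p (j + 1)) (j + 1) := by
          rw [Solution.totalPower, ← hq.sum_comp]
          refine Finset.sum_congr rfl fun j _ => ?_
          rw [hchan, Finset.sum_congr rfl (hpow j), (hwater j).2.1, ← hqp, hcost]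
      _ ≤ ∑ m : Fin M, matrix M cost (m + 1) (σ m + 1) := hp.optimal σ hσ
      _ ≤ S'.totalPower := by
          refine Finset.sum_le_sum fun m _ => ?_
          rw [hcost, htile]
          refine (waterfill_block I hK hN m (σ m) (hlev m (σ m))).2.2 _ (fun n hn => ?_) ?_
          · rw [← htile] at hn
            exact hS'.power_nonneg m n hn
          · rw [← htile]
            exact hS'.rate_ge m

end MPCA

namespace RealRAM

/-! ### The program -/

/-- Compute the number of channels per user. -/
def lengthCmd : Cmd :=
  .loop (.natLt (.var 11) (.var 1)) (.seq
    (.setNat 11 (.add (.var 11) (.var 0)))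
    (.setNat 10 (.add (.var 10) (.lit 1))))

/-- Tabulate the multiples of `N`. -/
def rowsCmd : Cmd := forUp 24 0 (.putNat 8 col (.add (.get 8 (.var 24)) (.var 1)))

/-- Write the solution for one channel. -/
def outputBody : Cmd := .seq
  (block [
    .putNat 0 (.var 17) (.var 27),
    .setReal 6 (.sub (.var 5) (.div (.ofNat (.lit 1)) (.get 0 (.add (.var 26) (.var 17)))))])
  (.seq
    (.ite (.realLt (.ofNat (.lit 0)) (.var 6)) (.putReal 2 (.var 17) (.var 6))
      (.putReal 2 (.var 17) (.ofNat (.lit 0))))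
    (.setNat 17 (.add (.var 17) (.lit 1))))

/-- Write the solution for one block. -/
def outputBlock : Cmd := .seq
  (block [
    .setNat 27 (.sub (.get 4 (.add (.var 18) (.lit 1))) (.lit 1)),
    .setNat 26 (.get 8 (.var 27)),
    .setReal 5 (.get 10 (.add (.get 7 (.get 4 (.add (.var 18) (.lit 1))))
      (.add (.var 18) (.lit 1))))])
  (forUp 16 10 outputBody)

/-- Write the solution. -/
def outputCmd : Cmd := .seq (.setNat 17 (.lit 0)) (forUp 18 0 outputBlock)

/-- The program that solves the restricted problem. -/
def allocation : Program where
  procs := procs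
  main := block [lengthCmd, tableCmd, hungarianCmd, rowsCmd, outputCmd]

/-! ### Correctness of the remaining commands of the program. -/

theorem lengthCmd_within (s : Store) {M K : ℕ} (hpos : 0 < M) (hM : s.natVar 0 = M)
    (hN : s.natVar 1 = M * K) (h₁₀ : s.natVar 10 = 0) (h₁₁ : s.natVar 11 = 0) :
    Within procs lengthCmd s (20 * K + 10) fun s' =>
      EqOff (lengthCmd.footprint searchFootprint) s s' ∧ s'.natVar 10 = K := by
  refine Within.frame procs_footprint ?_
  have key := Within.loop (procs := procs) (t := 10) (b := .natLt (.var 11) (.var 1))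
    (body := .seq (.setNat 11 (.add (.var 11) (.var 0))) (.setNat 10 (.add (.var 10) (.lit 1))))
    (Inv := fun f s' => s'.natVar 10 + f = K ∧ s'.natVar 11 = s'.natVar 10 * M ∧
      s'.natVar 0 = M ∧ s'.natVar 1 = M * K) ?_ K s ⟨by omega, by simp [h₁₀, h₁₁], hM, hN⟩
  · refine key.mono ?_ ?_
    · simp only [BExp.cost, NExp.cost]
      omega
    · rintro s' ⟨hb, f, hf, h11, h0, h1⟩
      simp only [BExp.holds, NExp.eval, h11, h1, not_lt, mul_comm M K] at hb
      have := Nat.le_of_mul_le_mul_right hb hpos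
      omega
  · rintro f s₁ ⟨hf, h11, h0, h1⟩ hb
    simp only [BExp.holds, NExp.eval, h11, h1, mul_comm M K] at hb
    have := Nat.lt_of_mul_lt_mul_right hb
    refine ⟨f - 1, by omega, .flat rfl (by decide) ?_⟩
    simp [h11, h0, h1]
    constructor
    · omega
    · ring

theorem rowsCmd_within (s : Store) (h0 : s.natArr 8 0 = 0) :
    Within procs rowsCmd s (50 * s.natVar 0 + 20) fun s' =>
      EqOff (rowsCmd.footprint searchFootprint) s s' ∧
      ∀ r ≤ s.natVar 0, s'.natArr 8 r = r * s.natVar 1 := by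
  refine (Within.forUp procs_footprint (t := 20) (n := s.natVar 0)
    (fun c s' => ∀ r ≤ c, s'.natArr 8 r = r * s.natVar 1) rfl
    (by decide) (by decide) (by simpa using h0) ?_).mono (by omega) fun s' h => h
  intro c s₁ hc hi hE hI
  have h0₁ : s₁.natVar 1 = s.natVar 1 := hE.natVar 1 (by decide)
  refine .flat rfl (by decide) fun r hr => ?_
  rcases (by omega : r ≤ c ∨ r = c + 1) with hr' | rfl
  · have : r ≠ c + 1 := by omega
    simp [col, hi, Function.update_of_ne this, hI r hr']
  · simp [col, hi, hI c le_rfl, h0₁]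
    ring

/-- The matching is one-based: the table of levels is addressed with the row `r` itself, the user
and the gains with `r - 1`. Variable `17` passes through all channels in order, which avoids
computing `j * K + i`. -/
theorem outputCmd_within (s : Store) {M N K : ℕ} (hM : s.natVar 0 = M) (hK : s.natVar 10 = K)
    (hp : ∀ j < M, s.natArr 4 (j + 1) ≤ M) (h7 : ∀ r ≤ M, s.natArr 7 r = r * M)
    (h8 : ∀ r ≤ M, s.natArr 8 r = r * N) :
    Within procs outputCmd s (M * (60 * K + 60) + 20) fun s' =>
      ∀ n < M * K, s'.natArr 0 n = s.natArr 4 (n / K + 1) - 1 ∧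
        s'.realArr 2 n = max (s.realArr 10 (s.natArr 4 (n / K + 1) * M + (n / K + 1)) -
          1 / s.realArr 0 ((s.natArr 4 (n / K + 1) - 1) * N + n)) 0 := by
  set I : ℕ → Store → Prop := fun c s' => s'.natVar 17 = c ∧
    ∀ n < c, s'.natArr 0 n = s.natArr 4 (n / K + 1) - 1 ∧
      s'.realArr 2 n = max (s.realArr 10 (s.natArr 4 (n / K + 1) * M + (n / K + 1)) -
        1 / s.realArr 0 ((s.natArr 4 (n / K + 1) - 1) * N + n)) 0 with hI
  refine Within.seq (t₁ := 2) (t₂ := M * (60 * K + 60) + 10)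
    (Q₁ := fun s' => s' = s.setNat 17 0) (.flat rfl le_rfl rfl) ?_ (by omega)
  rintro _ rfl
  refine (Within.forUp procs_footprint (n := M) (fun j => I (j * K)) (by simp [hM]) (by decide)
    (by decide) (by simp [hI]) ?_ (t := 60 * K + 50)).mono (by nlinarith) fun s' h => h.2.2
  intro j s₁ hj hi hE hI₁
  have K₁ : s₁.natVar 10 = K := by rw [hE.natVar 10 (by decide)]; simp [hK]
  have p₁ : s₁.natArr 4 = s.natArr 4 := by rw [hE.natArr 4 (by decide)]; rfl
  have m₁ : s₁.natArr 7 = s.natArr 7 := by rw [hE.natArr 7 (by decide)]; rfl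
  have n₁ : s₁.natArr 8 = s.natArr 8 := by rw [hE.natArr 8 (by decide)]; rfl
  have g₁ : s₁.realArr 0 = s.realArr 0 := by rw [hE.realArr 0 (by decide)]; rfl
  have l₁ : s₁.realArr 10 = s.realArr 10 := by rw [hE.realArr 10 (by decide)]; rfl
  have hpj := hp j hj
  set r := s.natArr 4 (j + 1) with hr
  refine Within.seq (t₁ := 40) (t₂ := 60 * K + 10) (Q₁ := fun s₂ => s₂.natVar 27 = r - 1 ∧
    s₂.natVar 26 = (r - 1) * N ∧ s₂.realVar 5 = s.realArr 10 (r * M + (j + 1)) ∧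
    s₂.natVar 10 = K ∧ s₂.realArr 0 = s.realArr 0 ∧ I (j * K) s₂)
    (.flat rfl (by decide) ?_) ?_ (by omega)
  · simp [hi, p₁, n₁, m₁, l₁, g₁, ← hr, h7 r hpj, h8 (r - 1) (by omega), K₁]
    simpa [hI] using hI₁
  rintro s₂ ⟨h27, h26, h5, K₂, g₂, hI₂⟩
  refine (Within.forUp procs_footprint (n := K) (fun i => I (j * K + i)) K₂ (by decide)
    (by decide) (by simpa [hI] using hI₂) ?_ (t := 50)).mono (by omega) fun s' h => ?_
  · intro i s₃ hi₃ hi' hE₃ ⟨h17, hI₃⟩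
    have a₃ := (hE₃.natVar 27 (by decide)).trans h27
    have b₃ := (hE₃.natVar 26 (by decide)).trans h26
    have c₃ := (hE₃.realVar 5 (by decide)).trans h5
    have g₃ : s₃.realArr 0 = s.realArr 0 := (hE₃.realArr 0 (by decide)).trans g₂
    have hdiv : (j * K + i) / K = j := by
      rw [mul_comm, Nat.mul_add_div (by omega), Nat.div_eq_of_lt hi₃, add_zero]
    set x := s.realArr 10 (r * M + (j + 1)) - 1 / s.realArr 0 ((r - 1) * N + (j * K + i)) with hx
    have hstore : outputBody.eff s₃ = (((s₃.putNat 0 (j * K + i) (r - 1)).setReal 6 x).putReal 2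
        (j * K + i) (max x 0)).setNat 17 (j * K + i + 1) := by
      simp only [outputBody, block, Cmd.eff, BExp.holds, RExp.eval, NExp.eval,
        Store.setReal_realVar, Store.putNat_realVar, Store.putNat_natVar, Store.putNat_realArr,
        if_true, h17, a₃, b₃, c₃, g₃, Nat.cast_zero, Nat.cast_one, ← hx]
      rcases lt_or_ge 0 x with h | h
      · rw [if_pos h, max_eq_left h.le]
        simp [h17]
      · rw [if_neg (not_lt.2 h), max_eq_right h]
        simp [h17]
    refine .flat rfl (by decide) ?_
    rw [hstore]
    refine ⟨by simp [add_assoc], fun n hn => ?_⟩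
    rcases (by omega : n < j * K + i ∨ n = j * K + i) with hn' | rfl
    · have hne : n ≠ j * K + i := by omega
      have := hI₃ n hn'
      simpa [Function.update_of_ne hne] using this
    · rw [hdiv, ← hr]
      simp [hx]
  · have h2 := h.2
    rw [← Nat.succ_mul] at h2
    simpa [hI] using h2

end RealRAM

/-! ### Assembly of the program and the total time. -/

theorem theorem4 :
    ∃ (prog : RealRAM.Program) (C : ℕ),
      ∀ (M N : ℕ), 0 < M → M ≤ N → M ∣ N → ∀ I : MPCA M N,
        ∃ (s : RealRAM.Store) (t : ℕ),
          prog.Halts I.encode s t ∧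
          t ≤ C * max (M ^ 3) (M * N) ∧
          I.UniformBlockOptimal (MPCA.decode M N s) := by
  refine ⟨RealRAM.allocation, 10000, ?_⟩
  rintro M N hM hMN ⟨K, hN⟩ I
  have hK : 0 < K := by
    rcases Nat.eq_zero_or_pos K with rfl | h
    · omega
    · exact h
  suffices h : RealRAM.Within RealRAM.procs RealRAM.allocation.main I.encode
      (10000 * max (M ^ 3) (M * N)) fun s => I.UniformBlockOptimal (MPCA.decode M N s) by
    obtain ⟨s, t, h₁, h₂, h₃⟩ := h
    exact ⟨s, t, h₁, h₂, h₃⟩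
  have hM1 : M ≤ M ^ 3 := Nat.le_self_pow (by norm_num) M
  -- The main terms are `6000 * (M * N)` for the table and `3000 * M ^ 3` for the Hungarian method.
  -- The rest absorbs the lower terms by means of `M ≤ M ^ 3` and `N ≤ M * N`.
  have hbound : 3500 * M ^ 3 + 6300 * (M * N) ≤ 10000 * max (M ^ 3) (M * N) := by
    have := le_max_left (M ^ 3) (M * N)
    have := le_max_right (M ^ 3) (M * N)
    omega
  have hNpos : 0 < N := by omega
  have hMNN : N ≤ M * N := Nat.le_mul_of_pos_left N hM
  have hKN : K ≤ N := by rw [hN]; exact Nat.le_mul_of_pos_left K hM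
  simp only [RealRAM.allocation, RealRAM.block]
  refine (RealRAM.lengthCmd_within I.encode (M := M) (K := K) hM (by simp [MPCA.encode])
    (by simp [MPCA.encode, hN]) (by simp [MPCA.encode]) (by simp [MPCA.encode])).seq
    (t₂ := 3400 * M ^ 3 + 6250 * (M * N)) ?_ (by omega)
  rintro s₁ ⟨hE₁, h10⟩
  have v0 : s₁.natVar 0 = M := by rw [hE₁.natVar 0 (by decide)]; simp [MPCA.encode]
  have v1 : s₁.natVar 1 = N := by rw [hE₁.natVar 1 (by decide)]; simp [MPCA.encode]
  have r₁ : s₁.realArr = I.encode.realArr := funext fun a => hE₁.realArr a (by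
    simp [RealRAM.lengthCmd, RealRAM.Cmd.footprint, RealRAM.Footprint.union])
  refine (RealRAM.tableCmd_within s₁ v0 h10 hK fun m hm => ?_).seq
    (t₂ := 3200 * M ^ 3 + 100 * (M * N)) ?_ ?_
  · rw [r₁]
    have := I.encode_target ⟨m, hm⟩
    simp only at this
    rw [this]
    exact I.target_pos _
  swap
  · have : M * M * K = M * N := by rw [hN]; ring
    rw [this]
    omega
  rintro s₂ ⟨hE₂, htable⟩
  rw [r₁] at htable
  -- Up to this point only the stack of the search was written to, so the matching and the tables of
  -- multiples are still zero, as their initialization requires.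
  have n₀ : ∀ a, a ≠ 1 → a ≠ 2 → a ≠ 3 → s₂.natArr a = fun _ => 0 := fun a h₁ h₂ h₃ => by
    rw [hE₂.natArr a (by
      simp [RealRAM.tableCmd, RealRAM.cellCmd, RealRAM.copyCmd, RealRAM.levelInput,
        RealRAM.blockCost, RealRAM.forUp, RealRAM.Cmd.footprint, RealRAM.Footprint.union,
        RealRAM.searchFootprint, h₁, h₂, h₃]), hE₁.natArr a (by
      simp [RealRAM.lengthCmd, RealRAM.Cmd.footprint, RealRAM.Footprint.union])]
    rfl
  refine (RealRAM.hungarianCmd_within (M := M) s₂ (by rw [hE₂.natVar 0 (by decide), v0]) hM ?_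
    (by rw [n₀ 7 (by decide) (by decide) (by decide)])
    (fun j => by rw [n₀ 4 (by decide) (by decide) (by decide)])
    (fun r => by rw [hE₂.realArr 11 (by decide), r₁]; simp [MPCA.encode])
    (fun j => by rw [hE₂.realArr 12 (by decide), r₁]; simp [MPCA.encode])).seq
    (t₂ := 200 * M ^ 3 + 100 * (M * N)) ?_ (by omega)
  · intro r j hr hr' hj hj'
    obtain ⟨r, rfl⟩ := Nat.exists_eq_add_of_le' hr
    obtain ⟨j, rfl⟩ := Nat.exists_eq_add_of_le' hj
    have hlt : r * M + j < M * M := by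
      have := Nat.mul_le_mul_right M hr'
      rw [Nat.succ_mul] at this
      omega
    rw [RealRAM.matrix, show (r + 1) * M + (j + 1) = M + 1 + (r * M + j) by ring,
      (htable _ hlt).2]
    exact Finset.sum_nonneg fun i _ => le_max_right _ _
  rintro s₃ ⟨hE₃, h7, hpart⟩
  have v0₃ : s₃.natVar 0 = M := by rw [hE₃.natVar 0 (by decide), hE₂.natVar 0 (by decide), v0]
  have v1₃ : s₃.natVar 1 = N := by rw [hE₃.natVar 1 (by decide), hE₂.natVar 1 (by decide), v1]
  have v10₃ : s₃.natVar 10 = K := by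
    rw [hE₃.natVar 10 (by decide), hE₂.natVar 10 (by decide), h10]
  refine (RealRAM.rowsCmd_within s₃ (by
    rw [hE₃.natArr 8 (by decide), n₀ 8 (by decide) (by decide) (by decide)])).seq
    (t₂ := 100 * M ^ 3 + 80 * (M * N)) ?_ (by rw [v0₃]; omega)
  rintro s₄ ⟨hE₄, h8⟩
  rw [v0₃, v1₃] at h8
  have p₄ : s₄.natArr 4 = s₃.natArr 4 := hE₄.natArr 4 (by decide)
  have m₄ : s₄.natArr 7 = s₃.natArr 7 := hE₄.natArr 7 (by decide)
  have l₄ : s₄.realArr 10 = s₂.realArr 10 := by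
    rw [hE₄.realArr 10 (by decide), hE₃.realArr 10 (by decide)]
  have g₄ : s₄.realArr 0 = I.encode.realArr 0 := by
    rw [hE₄.realArr 0 (by decide), hE₃.realArr 0 (by decide), hE₂.realArr 0 (by decide), r₁]
  refine (RealRAM.outputCmd_within (M := M) (N := N) (K := K) s₄
    (by rw [hE₄.natVar 0 (by decide), v0₃]) (by rw [hE₄.natVar 10 (by decide), v10₃])
    (fun j hj => by rw [p₄]; exact hpart.range _ (by omega) (by omega))
    (by rw [m₄]; exact h7) h8).mono ?_ fun s₅ h => ?_
  · have : M * (60 * K + 60) = 60 * (M * K) + 60 * M := by ring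
    rw [this, ← hN]
    omega
  · rw [p₄, l₄, g₄, ← hN] at h
    exact I.uniformBlockOptimal_decode hK hN hM htable hpart (fun n hn => (h n hn).1)
      fun n hn => (h n hn).2
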